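/- **Setting.** Fix $\tau\in\mathbb C$ with $\operatorname{Im}\tau>0$, put $q=e^{2\pi i\tau}$, and let $$\theta(x)=2q^{1/8}\sin(\pi x)\prod_{n\ge 1}(1-q^n)(1-q^ne^{2\pi i x})(1-q^n/e^{2\pi i x}).$$ Let $\delta$ be the meromorphic function determined by $\delta(e^{2\pi i a},e^{2\pi i b})=\dfrac{\theta'(0)\,\theta(a+b)}{\theta(a)\theta(b)}$. Fix integers $r\ge 0$ and $m\ge 2r$, and consider meromorphic functions of the variables $x_1,\dots,x_m,u,\mu_1,\dots,\mu_r,h$ (written multiplicatively as arguments of $\delta$, and additively, as coordinates on a vector space $\mathbb C^{m+r+2}$, elsewhere). *Types.* A meromorphic function $f$ of $z\in\mathbb C^{m+r+2}$ is pure of type $\tfrac12 z^{T}Az$, where $A$ is a symmetric integral matrix, if for all integral vectors $k,l$ $$f(z+k+l\tau)=(-1)^{k^TAk}\,(-q^{-1/2})^{l^TAl}\,e^{-2\pi i\,l^TAz}f(z),\qquad q^{1/2}=e^{\pi i\tau}.$$ A nonzero pure function has exactly one type, denoted $\mathrm{type}(f)$. *Operations.* Let $s_i=(i,i+1)$ act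 on functions by exchanging $x_i$ and $x_{i+1}$. For a character $\nu$ put $$\mathfrak C_i^{\nu}(f)=\delta\big(\tfrac{x_{i+1}}{x_i},\nu\big)f+\delta\big(\tfrac{x_i}{x_{i+1}},h\big)\,s_if,\qquad \overline{\mathfrak C}{}_i^{\nu}=\frac1{\delta(\nu,h)}\,\mathfrak C_i^{\nu},$$ the latter being defined when $\nu\ne 1$ and $\nu h\neq 1$. For $f\ne0$ pure, the admissible parameter of the $i$-th operation is, additively, $\nu=\partial_i(\mathrm{type}(f))-h$ with $\partial_i(Q)=\frac{Q-s_iQ}{x_i-x_{i+1}}$. For a word $s_{i_1}\cdots s_{i_\ell}$ let $\overline{\mathfrak C}{}_{i_1}^{\nu_1}\cdots\overline{\mathfrak C}{}_{i_\ell}^{\nu_\ell}(f)$ be the composition in which every $\nu_k$ is the admissible parameter of the $k$-th operation applied to $\overline{\mathfrak C}{}_{i_{k+1}}^{\nu_{k+1}}\cdots\overline{\mathfrak C}{}_{i_\ell}^{\nu_\ell}(f)$; it is defined if all the operations in it are. For $w\in\mathfrak S_m$ we say that $\overline{\mathfrak C}{}_w^{\diamond}(f)$ is defined and equal to $g$ if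 this composition is defined for every reduced word of $w$, and has the value $g$ for every word of $w$, reduced or not, for which it is defined. *Link patterns.* A labelled link pattern is a sequence $\mathcal P=((a_1,b_1),\dots,(a_r,b_r))$ of pairs (source, target) such that $a_1,b_1,\dots,a_r,b_r\in\{1,\dots,m\}$ are all different. A permutation $w\in\mathfrak S_m$ acts on it by permuting the nodes $1,\dots,m$, and $\sigma\in\mathfrak S_r$ acts, written $\sigma^\mu$, by giving the pair with label $j$ the label $\sigma(j)$. On functions, $\sigma^\mu$ replaces $\mu_j$ by $\mu_{\sigma(j)}$. Let $\mathcal P^{\min}_{m,r}=((m-r+1,1),\dots,(m,r))$, with loose nodes $r+1,\dots,m-r$, and $$\mathcal E\ell\ell(\mathcal P^{\min}_{m,r})=\prod_{i=1}^r\Big(\delta\big(u\tfrac{x_i}{x_{m-r+i}},\mu_i\big)\prod_{j=m-r+i+1}^m\delta\big(u\tfrac{x_i}{x_j},h\big)\Big).$$ **Theorem.** Let $\mathcal P$ be a labelled link pattern of size $m$ and rank $r$, and let $w\in\mathfrak S_m$, $\sigma\in\mathfrak S_r$ be permutations such that $\mathcal P=\sigma^\mu w\,\mathcal P^{\min}_{m,r}$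 and $w$ preserves the order of the loose nodes (that is, $w$ is increasing on $\{r+1,\dots,m-r\}$). Then $\overline{\mathfrak C}{}_w^{\diamond}(\mathcal E\ell\ell(\mathcal P^{\min}_{m,r}))$ is defined, and the function $$\sigma^\mu\,\overline{\mathfrak C}{}_w^{\diamond}(\mathcal E\ell\ell(\mathcal P^{\min}_{m,r}))$$ does not depend on the choice of such $\sigma$ and $w$. -/

import Mathlib

namespace EllLink

open scoped UpperHalfPlane
open Complex

/-! ### The theta function -/

/-- `q = exp (2 π i τ)`. -/
noncomputable def nome (τ : ℍ) : ℂ := exp (2 * Real.pi * I * (τ : ℂ))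

/-- The Jacobi theta function
`θ_τ(x) = 2 q^{1/8} sin(π x) ∏_{n ≥ 1} (1 - q^n) (1 - q^n e^{2πix}) (1 - q^n / e^{2πix})`. -/
noncomputable def theta (τ : ℍ) (x : ℂ) : ℂ :=
  2 * exp (2 * Real.pi * I * (τ : ℂ) / 8) * sin (Real.pi * x) *
    ∏' n : ℕ, ((1 - nome τ ^ (n + 1)) * (1 - nome τ ^ (n + 1) * exp (2 * Real.pi * I * x)) *
      (1 - nome τ ^ (n + 1) / exp (2 * Real.pi * I * x)))

theorem norm_nome_lt_one (τ : ℍ) : ‖nome τ‖ < 1 := by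
  have h : ‖Function.Periodic.qParam 1 (τ : ℂ)‖ < 1 := by
    simpa using UpperHalfPlane.norm_qParam_lt_one 1 τ
  have e : nome τ = Function.Periodic.qParam 1 (τ : ℂ) := by
    simp [nome, Function.Periodic.qParam]
  rwa [e]

theorem hasProdLocallyUniformly_aux {q : ℂ} (hq : ‖q‖ < 1) {g : ℂ → ℂ} (hg : Continuous g) :
    HasProdLocallyUniformlyOn (fun (n : ℕ) x ↦ 1 + -(q ^ (n + 1) * g x))
      (fun x ↦ ∏' n : ℕ, (1 + -(q ^ (n + 1) * g x))) Set.univ := by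
  apply hasProdLocallyUniformlyOn_of_forall_compact isOpen_univ
  intro K _ hK
  obtain ⟨C, hC⟩ := hK.exists_bound_of_continuousOn hg.continuousOn
  have hs : Summable fun n : ℕ ↦ ‖q‖ ^ (n + 1) * C :=
    ((summable_nat_add_iff 1).mpr (summable_geometric_of_lt_one (norm_nonneg _) hq)).mul_right C
  refine hs.hasProdUniformlyOn_nat_one_add hK (.of_forall fun n x hx ↦ ?_)
    (fun n ↦ by fun_prop)
  rw [norm_neg, norm_mul, norm_pow]
  exact mul_le_mul_of_nonneg_left (hC x hx) (by positivity)

theorem multipliable_aux {q : ℂ} (hq : ‖q‖ < 1) (c : ℂ) :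
    Multipliable fun n : ℕ ↦ (1 + -(q ^ (n + 1) * c)) :=
  (hasProdLocallyUniformly_aux hq (g := fun _ ↦ c) continuous_const).multipliableLocallyUniformlyOn
    |>.multipliable (Set.mem_univ (0 : ℂ))

theorem differentiable_aux {q : ℂ} (hq : ‖q‖ < 1) {g : ℂ → ℂ} (hg : Differentiable ℂ g) :
    Differentiable ℂ (fun x ↦ ∏' n : ℕ, (1 + -(q ^ (n + 1) * g x))) := by
  rw [← differentiableOn_univ]
  refine (hasProdLocallyUniformly_aux hq hg.continuous).differentiableOn
    (.of_forall fun s ↦ ?_) isOpen_univ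
  exact DifferentiableOn.fun_finsetProd (fun _ _ ↦ by fun_prop)

theorem differentiable_theta (τ : ℍ) : Differentiable ℂ (theta τ) := by
  have hq := norm_nome_lt_one τ
  have e : theta τ = fun x ↦ 2 * exp (2 * Real.pi * I * (τ : ℂ) / 8) * sin (Real.pi * x) *
      (((∏' n : ℕ, (1 + -(nome τ ^ (n + 1) * 1))) *
        (∏' n : ℕ, (1 + -(nome τ ^ (n + 1) * exp (2 * Real.pi * I * x))))) *
        ∏' n : ℕ, (1 + -(nome τ ^ (n + 1) * (exp (2 * Real.pi * I * x))⁻¹))) := by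
    funext x
    rw [← (multipliable_aux hq _).tprod_mul (multipliable_aux hq _),
      ← ((multipliable_aux hq _).mul (multipliable_aux hq _)).tprod_mul (multipliable_aux hq _)]
    simp only [theta, mul_one, sub_eq_add_neg, div_eq_mul_inv]
  rw [e]
  have h1 := differentiable_aux hq (g := fun x ↦ exp (2 * Real.pi * I * x)) (by fun_prop)
  have h2 := differentiable_aux hq (g := fun x ↦ (exp (2 * Real.pi * I * x))⁻¹)
    (Differentiable.fun_inv (by fun_prop) fun x ↦ exp_ne_zero _)
  exact Differentiable.mul (by fun_prop) (((differentiable_const _).mul h1).mul h2)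

/-! ### Entire and meromorphic functions on `ℂ^ι` -/

section Functions

variable (ι : Type) [Fintype ι]

/-- The algebra of holomorphic functions on `ℂ^ι`. -/
def Entire : Subalgebra ℂ ((ι → ℂ) → ℂ) where
  carrier := {f | AnalyticOnNhd ℂ f Set.univ}
  mul_mem' hf hg := hf.mul hg
  add_mem' hf hg := hf.add hg
  algebraMap_mem' _ := analyticOnNhd_const

instance : IsDomain (Entire ι) := by
  have : NoZeroDivisors (Entire ι) := by
    refine ⟨fun {f g} h ↦ ?_⟩
    by_contra! hne
    obtain ⟨z, hz⟩ : ∃ z, f.1 z ≠ 0 := by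
      by_contra! hf
      exact hne.1 (Subtype.ext (funext hf))
    have hfz : ∀ᶠ y in nhds z, f.1 y ≠ 0 :=
      (f.2 z (Set.mem_univ z)).continuousAt.eventually_ne hz
    have hg : g.1 =ᶠ[nhds z] 0 := by
      filter_upwards [hfz] with y hy
      have : f.1 y * g.1 y = 0 := congrFun (congrArg Subtype.val h) y
      exact (mul_eq_zero.mp this).resolve_left hy
    have := AnalyticOnNhd.eqOn_zero_of_preconnected_of_eventuallyEq_zero g.2 isPreconnected_univ
      (Set.mem_univ z) hg
    exact hne.2 (Subtype.ext (funext fun y ↦ this (Set.mem_univ y)))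
  exact NoZeroDivisors.to_isDomain _

/-- The field of meromorphic functions on `ℂ^ι`: quotients of holomorphic functions. -/
abbrev Mero : Type := FractionRing (Entire ι)

variable {ι}

/-- Composition `f ↦ f ∘ φ` with a biholomorphic self-map of `ℂ^ι`, on holomorphic functions. -/
def compEntire (φ : (ι → ℂ) ≃ (ι → ℂ)) (h : AnalyticOnNhd ℂ φ Set.univ)
    (h' : AnalyticOnNhd ℂ φ.symm Set.univ) : Entire ι ≃+* Entire ι where
  toFun f := ⟨f.1 ∘ φ, fun z _ ↦ (f.2 (φ z) (Set.mem_univ _)).comp (h z (Set.mem_univ z))⟩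
  invFun f := ⟨f.1 ∘ φ.symm,
    fun z _ ↦ (f.2 (φ.symm z) (Set.mem_univ _)).comp (h' z (Set.mem_univ z))⟩
  left_inv f := Subtype.ext (funext fun z ↦ congrArg f.1 (φ.apply_symm_apply z))
  right_inv f := Subtype.ext (funext fun z ↦ congrArg f.1 (φ.symm_apply_apply z))
  map_mul' _ _ := rfl
  map_add' _ _ := rfl

theorem analytic_coord (i : ι) (c : ℂ) :
    AnalyticOnNhd ℂ (fun z : ι → ℂ ↦ z i + c) Set.univ := fun z _ ↦
  ((ContinuousLinearMap.proj (R := ℂ) (φ := fun _ : ι ↦ ℂ) i).analyticAt z).add analyticAt_const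

/-- Substitution of variables: the `i`-th variable is replaced by the `e i`-th one. -/
noncomputable def permute (e : Equiv.Perm ι) : Mero ι ≃+* Mero ι :=
  IsFractionRing.ringEquivOfRingEquiv
    (compEntire
      { toFun := fun z i ↦ z (e i)
        invFun := fun z i ↦ z (e.symm i)
        left_inv := fun z ↦ funext fun i ↦ by simp
        right_inv := fun z ↦ funext fun i ↦ by simp }
      (AnalyticOnNhd.pi fun i ↦ by simpa using analytic_coord (e i) 0)
      (AnalyticOnNhd.pi fun i ↦ by simpa using analytic_coord (e.symm i) 0))

/-- Translation of the argument, `f(z) ↦ f(z + c)`. -/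
noncomputable def translate (c : ι → ℂ) : Mero ι ≃+* Mero ι :=
  IsFractionRing.ringEquivOfRingEquiv
    (compEntire
      { toFun := fun z i ↦ z i + c i
        invFun := fun z i ↦ z i + -c i
        left_inv := fun z ↦ funext fun i ↦ by simp
        right_inv := fun z ↦ funext fun i ↦ by simp }
      (AnalyticOnNhd.pi fun i ↦ analytic_coord i (c i))
      (AnalyticOnNhd.pi fun i ↦ analytic_coord i (-c i)))

/-- The value at `z` of the integral linear form with coefficients `a`. -/
def evalForm (a : ι → ℤ) (z : ι → ℂ) : ℂ := ∑ i, (a i : ℂ) * z i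

theorem analyticAt_evalForm (a : ι → ℤ) (z : ι → ℂ) : AnalyticAt ℂ (evalForm a) z := by
  unfold evalForm
  exact Finset.analyticAt_fun_sum _ fun i _ ↦ analyticAt_const.mul
    ((ContinuousLinearMap.proj (R := ℂ) (φ := fun _ : ι ↦ ℂ) i).analyticAt z)

/-- `θ_τ(a(z))`, for an integral linear form `a`, as a meromorphic function. -/
noncomputable def thetaForm (τ : ℍ) (a : ι → ℤ) : Mero ι :=
  algebraMap (Entire ι) (Mero ι) ⟨fun z ↦ theta τ (evalForm a z), fun z _ ↦
    ((differentiable_theta τ).analyticAt _).comp (analyticAt_evalForm a z)⟩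

/-- `F_τ(a, b) = θ'(0) θ(a + b) / (θ(a) θ(b))`, that is `δ(e^{2πia}, e^{2πib})`, for integral
linear forms `a`, `b`. It is defined when `a ≠ 0` and `b ≠ 0`. -/
noncomputable def delta (τ : ℍ) (a b : ι → ℤ) : Mero ι :=
  algebraMap ℂ (Mero ι) (deriv (theta τ) 0) * thetaForm τ (a + b) /
    (thetaForm τ a * thetaForm τ b)

/-! ### Types

A quadratic form is recorded by its symmetric matrix `A`, the form being `½ zᵀ A z`. -/

/-- The symmetric matrix of the quadratic form `a(z) b(z)`. -/
def prodForm (a b : ι → ℤ) : Matrix ι ι ℤ := Matrix.vecMulVec a b + Matrix.vecMulVec b a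

/-- The factor of automorphy
`(-1)^{k·k} (-q^{-1/2})^{l·l} e^{-2πi l·z}` attached to the symmetric matrix `A`,
where `u·v = uᵀ A v`. -/
noncomputable def automorphyFactor (τ : ℍ) (A : Matrix ι ι ℤ) (k l : ι → ℤ) : Entire ι :=
  ⟨fun z ↦ (-1) ^ (k ⬝ᵥ A.mulVec k) * (-exp (-(Real.pi * I * (τ : ℂ)))) ^ (l ⬝ᵥ A.mulVec l) *
      exp (-(2 * Real.pi * I) * evalForm (Matrix.vecMul l A) z), fun z _ ↦
    analyticAt_const.mul (analyticAt_const.mul (analyticAt_evalForm _ z)).cexp⟩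

/-- `f` is pure of type `½ zᵀ A z`: it is a (meromorphic) section of the line bundle over the
power `E^ι` of the elliptic curve `E = ℂ / (ℤ + τ ℤ)` attached to `A`. -/
def HasType (τ : ℍ) (f : Mero ι) (A : Matrix ι ι ℤ) : Prop :=
  A.IsSymm ∧ ∀ k l : ι → ℤ,
    translate (fun i ↦ (k i : ℂ) + (l i : ℂ) * (τ : ℂ)) f =
      algebraMap (Entire ι) (Mero ι) (automorphyFactor τ A k l) * f

end Functions

/-! ### The variables and the elliptic Demazure operations -/

/-- The variables `x_1, …, x_m`, `u`, `μ_1, …, μ_r`, `h` (indices start at `0`). -/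
inductive Var (m r : ℕ) : Type
  | x (i : Fin m)
  | u
  | mu (j : Fin r)
  | h
  deriving DecidableEq, Fintype

variable {m r : ℕ}

/-- The linear form given by a variable. -/
def coord (v : Var m r) : Var m r → ℤ := Pi.single v 1

/-- The permutation of the variables that moves the `μ_j` by `σ` and fixes the others. -/
def Var.permMu (σ : Equiv.Perm (Fin r)) : Equiv.Perm (Var m r) where
  toFun
    | .mu j => .mu (σ j)
    | v => v
  invFun
    | .mu j => .mu (σ.symm j)
    | v => v
  left_inv v := by cases v <;> simp
  right_inv v := by cases v <;> simp

/-- `σ^μ` on functions: `μ_j` is replaced by `μ_{σ(j)}`. -/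
noncomputable def actMu (σ : Equiv.Perm (Fin r)) : Mero (Var m r) ≃+* Mero (Var m r) :=
  permute (Var.permMu σ)

/-- The position `i` (of `i, i + 1`), for `i` an index of a simple transposition. -/
def pos (i : Fin (m - 1)) : Fin m := ⟨i, by omega⟩

/-- The position `i + 1`. -/
def posSucc (i : Fin (m - 1)) : Fin m := ⟨i + 1, by omega⟩

/-- The simple transposition `s_i = (i, i + 1)`. -/
def simple (i : Fin (m - 1)) : Equiv.Perm (Fin m) := Equiv.swap (pos i) (posSucc i)

/-- `s_i` as a permutation of all the variables: it exchanges `x_i` and `x_{i+1}`. -/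
def simpleVar (i : Fin (m - 1)) : Equiv.Perm (Var m r) :=
  Equiv.swap (Var.x (pos i)) (Var.x (posSucc i))

/-- The linear form `x_i - x_{i+1}`. -/
def root (i : Fin (m - 1)) : Var m r → ℤ := coord (.x (pos i)) - coord (.x (posSucc i))

/-- `𝔠_i^ν f = δ(x_{i+1} / x_i, ν) f + δ(x_i / x_{i+1}, h) s_i f`. -/
noncomputable def dem (τ : ℍ) (i : Fin (m - 1)) (ν : Var m r → ℤ) (f : Mero (Var m r)) :
    Mero (Var m r) :=
  delta τ (-root i) ν * f + delta τ (root i) (coord .h) * permute (simpleVar i) f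

/-- The normalized operation, `𝔠_i^ν` divided by `δ(ν, h)`. It is defined when `ν ≠ 0` and
`ν + h ≠ 0`. -/
noncomputable def demBar (τ : ℍ) (i : Fin (m - 1)) (ν : Var m r → ℤ) (f : Mero (Var m r)) :
    Mero (Var m r) :=
  (delta τ ν (coord .h))⁻¹ * dem τ i ν f

/-- `ν` is the admissible parameter `∂_i(type f) - h`, where
`∂_i Q = (Q - s_i Q) / (x_i - x_{i+1})`, of the `i`-th operation applied to the nonzero pure
function `f`. -/
def Admissible (τ : ℍ) (i : Fin (m - 1)) (f : Mero (Var m r)) (ν : Var m r → ℤ) : Prop :=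
  f ≠ 0 ∧ ∃ A : Matrix (Var m r) (Var m r) ℤ, HasType τ f A ∧
    A - A.submatrix (simpleVar i) (simpleVar i) = prodForm (root i) (ν + coord .h)

/-- `DiamondWord τ [i_1, …, i_ℓ] f g`: the composition of the normalized operations
`i_1, …, i_ℓ` (the last one is applied first) with the admissible parameters is defined on `f`,
and its value is `g`. -/
inductive DiamondWord (τ : ℍ) (f : Mero (Var m r)) :
    List (Fin (m - 1)) → Mero (Var m r) → Prop
  | nil : DiamondWord τ f [] f
  | cons (i : Fin (m - 1)) (s : List (Fin (m - 1))) (g : Mero (Var m r)) (ν : Var m r → ℤ)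
      (hg : DiamondWord τ f s g) (hν : Admissible τ i g ν) (h0 : ν ≠ 0)
      (hh : ν + coord .h ≠ 0) : DiamondWord τ f (i :: s) (demBar τ i ν g)

/-- The permutation `s_{i_1} ⋯ s_{i_ℓ}` presented by a word. -/
def wordProd (s : List (Fin (m - 1))) : Equiv.Perm (Fin m) := (s.map simple).prod

/-- The word is a reduced presentation of `w`. -/
def IsReducedWord (s : List (Fin (m - 1))) (w : Equiv.Perm (Fin m)) : Prop :=
  wordProd s = w ∧ ∀ s' : List (Fin (m - 1)), wordProd s' = w → s.length ≤ s'.length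

/-- `C̄_w^◇(f)` is defined and equal to `g`: the composition is defined along every reduced
presentation of `w`, and its value is `g` along every presentation of `w`, reduced or not, along
which it is defined. -/
def IsDiamond (τ : ℍ) (w : Equiv.Perm (Fin m)) (f g : Mero (Var m r)) : Prop :=
  (∀ s, IsReducedWord s w → DiamondWord τ f s g) ∧
    ∀ s g', wordProd s = w → DiamondWord τ f s g' → g' = g

/-! ### Labelled link patterns -/

/-- A labelled link pattern of size `m` and rank `r`: a sequence of `r` pairs (source, target) of
nodes, all `2 r` nodes being different. -/
@[ext]
structure LinkPattern (m r : ℕ) where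
  source : Fin r → Fin m
  target : Fin r → Fin m
  distinct : Function.Injective (Sum.elim source target)

/-- The action of a permutation of the nodes. -/
def LinkPattern.permNodes (w : Equiv.Perm (Fin m)) (P : LinkPattern m r) : LinkPattern m r where
  source := w ∘ P.source
  target := w ∘ P.target
  distinct := by
    rw [← Sum.comp_elim]
    exact w.injective.comp P.distinct

/-- The action of a permutation of the labels: the arrow with label `j` gets the label `σ j`. -/
def LinkPattern.permLabels (σ : Equiv.Perm (Fin r)) (P : LinkPattern m r) : LinkPattern m r where
  source := P.source ∘ σ.symm
  target := P.target ∘ σ.symm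
  distinct := by
    rw [← Sum.elim_comp_map]
    exact P.distinct.comp (Sum.map_injective.mpr ⟨σ.symm.injective, σ.symm.injective⟩)

/-- The node `i` among the first `r` nodes. -/
def firstNode (hmr : 2 * r ≤ m) (i : Fin r) : Fin m := ⟨i, by omega⟩

/-- The node `m - r + i` among the last `r` nodes. -/
def lastNode (hmr : 2 * r ≤ m) (i : Fin r) : Fin m := ⟨m - r + i, by omega⟩

/-- The minimal link pattern, with the arrows `m - r + i ↦ i`. -/
def minPattern (hmr : 2 * r ≤ m) : LinkPattern m r where
  source := lastNode hmr
  target := firstNode hmr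
  distinct := by
    rintro (i | i) (j | j) h <;>
      simp only [Sum.elim_inl, Sum.elim_inr, firstNode, lastNode, Fin.mk.injEq] at h
    · exact congrArg _ (Fin.ext (by omega))
    · omega
    · omega
    · exact congrArg _ (Fin.ext h)

/-- `w` preserves the order of the loose nodes `r + 1, …, m - r` of the minimal pattern. -/
def PreservesLooseOrder (r : ℕ) (w : Equiv.Perm (Fin m)) : Prop :=
  ∀ i j : Fin m, r ≤ (i : ℕ) → i < j → (j : ℕ) < m - r → w i < w j

/-- The elliptic class of the minimal pattern,
`∏_i δ(u x_i / x_{m-r+i}, μ_i) ∏_{j > m-r+i} δ(u x_i / x_j, h)`. -/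
noncomputable def ellMin (τ : ℍ) (hmr : 2 * r ≤ m) : Mero (Var m r) :=
  ∏ i : Fin r,
    (delta τ (coord .u + coord (.x (firstNode hmr i)) - coord (.x (lastNode hmr i)))
        (coord (.mu i)) *
      ∏ j ∈ Finset.univ.filter (fun j : Fin m ↦ lastNode hmr i < j),
        delta τ (coord .u + coord (.x (firstNode hmr i)) - coord (.x j)) (coord .h))

end EllLink

/-! The type of the minimal class is a form symmetric in the `x_k` plus `∑ x_k (κ_k - k h)`, where
the weights `κ` (`minWeight`) are `μ_i + (r-1)h` at the target of arrow `i`, `-μ_i + (m-r)h` at its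
source, and `k h` at a loose node `k` (indices from `0`). For a function of weight `κ` the
admissible parameter of the `i`-th operation is `κ_i - κ_{i+1}`, and the result has weight `κ ∘ s_i`
(`HasWeight.admissible_iff`, `HasWeight.demBar`). Hence after a word with product `w` the weight is
`κ ∘ w⁻¹`, and every parameter is dictated by the permutation reached so far.

With these parameters the normalized operations satisfy the Coxeter relations: the operation with
parameter `-ν` inverts the one with parameter `ν`, distant operations commute, and the braid
relation holds with parameters `p`, `p + q`, `q` (`demBar_neg_demBar`, `demBar_comm`,
`demBar_braid`). The quadratic and braid relations come from Weierstrass' three-term relation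
`theta_three_term`. A diamond argument on descents (`descend_eq`) then yields a value `ellValue`
depending on `w` alone.

Definedness is read off the weights. They are pairwise distinct, so `ν ≠ 0`; and `ν + h = 0` happens
only when positions `i`, `i + 1` carry loose nodes `p`, `p + 1` in this order, which is the case
where `s_i` would destroy the order of the loose nodes. So the words on which the composition is
defined stay among the permutations preserving that order, and reduced words of such a permutation
never leave them.

For independence, two choices for the same pattern satisfy `w₁ = w₂ c`, where `c` permutes the
arrows of the minimal pattern by `π = σ₂⁻¹ σ₁` and fixes the loose nodes
(`isLabelPerm_of_permLabels_eq`). It remains to see that multiplying by `c` on the right amounts to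
acting by `π⁻¹` on the `μ_j` (`ellValue_mul`). Induction on `π` and on `w` reduces this to `w = 1`
and an adjacent transposition, where it is the four-term identity `delta_four_term`. -/

namespace EllLink

open scoped UpperHalfPlane
open Complex

/-! ### Zeros and quasi-periodicity of the theta function -/

/-- The infinite product `∏_{n ≥ 1} (1 - q^n c)`. -/
noncomputable def qProd (q c : ℂ) : ℂ := ∏' n : ℕ, (1 + -(q ^ (n + 1) * c))

theorem qProd_eq_mul {q : ℂ} (hq : ‖q‖ < 1) (c : ℂ) :
    qProd q c = (1 - q * c) * qProd q (q * c) := by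
  unfold qProd
  rw [tprod_eq_zero_mul']
  · simp only [zero_add, pow_one, sub_eq_add_neg]
    congr 1
    exact tprod_congr fun n ↦ by ring
  · exact (multipliable_aux hq (q * c)).congr fun n ↦ by ring

theorem qProd_eq_zero {q : ℂ} (hq : ‖q‖ < 1) {c : ℂ} (h : qProd q c = 0) :
    ∃ n : ℕ, q ^ (n + 1) * c = 1 := by
  by_contra! hne
  refine tprod_one_add_ne_zero_of_summable (f := fun n : ℕ ↦ -(q ^ (n + 1) * c)) ?_ ?_ h
  · intro n hn
    exact hne n (by linear_combination -hn)
  · simp only [norm_neg, norm_mul, norm_pow]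
    exact ((summable_nat_add_iff 1).mpr
      (summable_geometric_of_lt_one (norm_nonneg _) hq)).mul_right _

theorem theta_eq_qProd (τ : ℍ) (x : ℂ) :
    theta τ x = 2 * exp (2 * Real.pi * I * (τ : ℂ) / 8) * sin (Real.pi * x) *
      (qProd (nome τ) 1 * qProd (nome τ) (exp (2 * Real.pi * I * x)) *
        qProd (nome τ) (exp (2 * Real.pi * I * x))⁻¹) := by
  have hq := norm_nome_lt_one τ
  unfold qProd
  rw [← (multipliable_aux hq _).tprod_mul (multipliable_aux hq _),
      ← ((multipliable_aux hq _).mul (multipliable_aux hq _)).tprod_mul (multipliable_aux hq _)]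
  simp only [theta, mul_one, sub_eq_add_neg, div_eq_mul_inv]

theorem theta_neg (τ : ℍ) (x : ℂ) : theta τ (-x) = -theta τ x := by
  rw [theta_eq_qProd, theta_eq_qProd]
  simp only [mul_neg, exp_neg, sin_neg, inv_inv]
  ring

theorem theta_zero (τ : ℍ) : theta τ 0 = 0 := by
  simp [theta_eq_qProd]

theorem theta_add_one (τ : ℍ) (x : ℂ) : theta τ (x + 1) = -theta τ x := by
  rw [theta_eq_qProd, theta_eq_qProd]
  have h1 : exp (2 * Real.pi * I * (x + 1)) = exp (2 * Real.pi * I * x) := by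
    rw [mul_add, mul_one, exp_add, exp_two_pi_mul_I, mul_one]
  rw [h1, mul_add, mul_one, sin_add_pi]
  ring

theorem theta_add_tau (τ : ℍ) (x : ℂ) :
    theta τ (x + τ) = -exp (-(Real.pi * I * (τ : ℂ))) * exp (-(2 * Real.pi * I) * x) *
      theta τ x := by
  have hq := norm_nome_lt_one τ
  rw [theta_eq_qProd, theta_eq_qProd]
  set s := exp (Real.pi * I * x) with hs
  set t := exp (Real.pi * I * τ) with ht
  have hs0 : s ≠ 0 := exp_ne_zero _
  have ht0 : t ≠ 0 := exp_ne_zero _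
  have e1 : exp (2 * Real.pi * I * x) = s ^ 2 := by
    rw [hs, ← exp_nat_mul]; congr 1; push_cast; ring
  have e2 : nome τ = t ^ 2 := by
    rw [nome, ht, ← exp_nat_mul]; congr 1; push_cast; ring
  have e3 : exp (2 * Real.pi * I * (x + τ)) = t ^ 2 * s ^ 2 := by
    rw [← e1, ← e2, nome, ← exp_add]; congr 1; ring
  have e4 : exp (-(Real.pi * I * (τ : ℂ))) = t⁻¹ := by rw [exp_neg]
  have e5 : exp (-(2 * Real.pi * I) * x) = (s ^ 2)⁻¹ := by rw [neg_mul, exp_neg, e1]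
  have e6 : sin (Real.pi * x) = (s⁻¹ - s) * I / 2 := by
    rw [sin, hs, ← exp_neg]
    congr 4 <;> ring_nf
  have e7 : sin (Real.pi * (x + τ)) = ((s * t)⁻¹ - s * t) * I / 2 := by
    rw [sin, hs, ht, ← exp_add, ← exp_neg]
    congr 4 <;> ring_nf
  rw [e3, e4, e5, e6, e7, e1, e2]
  rw [e2] at hq
  -- The shift removes the factor `1 - t²s²` from one product and adds `1 - s⁻²` to the other; with
  -- the ratio of the sines this gives `-t⁻¹ s⁻²`.
  rw [qProd_eq_mul hq (s ^ 2), qProd_eq_mul hq (t ^ 2 * s ^ 2)⁻¹,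
    show t ^ 2 * (t ^ 2 * s ^ 2)⁻¹ = (s ^ 2)⁻¹ by field_simp]
  field_simp
  ring

theorem theta_add_int (τ : ℍ) (x : ℂ) (n : ℤ) : theta τ (x + n) = (-1) ^ n * theta τ x := by
  induction n with
  | zero => simp
  | succ k ih =>
    rw [zpow_add₀ (by norm_num), zpow_one]
    push_cast at ih ⊢
    rw [← add_assoc, theta_add_one, ih]
    ring
  | pred k ih =>
    have h := theta_add_one τ (x + ((-(k : ℤ) - 1 : ℤ) : ℂ))
    push_cast at ih h ⊢
    rw [show x + (-(k : ℂ) - 1) + 1 = x + -k by ring, ih] at h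
    rw [zpow_sub₀ (by norm_num), zpow_one]
    linear_combination h

theorem theta_add_int_mul_tau (τ : ℍ) (x : ℂ) (p : ℤ) :
    theta τ (x + p * τ) = (-exp (-(Real.pi * I * (τ : ℂ)))) ^ (p * p) *
      exp (-(2 * Real.pi * I) * (p * x)) * theta τ x := by
  have hne : -exp (-(Real.pi * I * (τ : ℂ))) ≠ 0 := neg_ne_zero.mpr (exp_ne_zero _)
  have hexp : exp (-(2 * Real.pi * I) * (τ : ℂ)) = (-exp (-(Real.pi * I * (τ : ℂ)))) ^ (2 : ℤ) := by
    rw [show (2 : ℤ) = ((2 : ℕ) : ℤ) from rfl, zpow_natCast, neg_sq, ← exp_nat_mul]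
    congr 1; push_cast; ring
  have hk : ∀ k : ℤ, exp (-(2 * Real.pi * I) * (k * τ)) =
      (-exp (-(Real.pi * I * (τ : ℂ)))) ^ (2 * k) := fun k ↦ by
    rw [zpow_mul, ← hexp, ← exp_int_mul]; congr 1; ring
  have step : ∀ k : ℤ, theta τ (x + ((k + 1 : ℤ) : ℂ) * τ) =
      -exp (-(Real.pi * I * (τ : ℂ))) * (exp (-(2 * Real.pi * I) * x) *
        (-exp (-(Real.pi * I * (τ : ℂ)))) ^ (2 * k)) * theta τ (x + k * τ) := fun k ↦ by
    rw [← hk, ← exp_add, ← mul_add, ← theta_add_tau]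
    congr 1; push_cast; ring
  have hx : ∀ k : ℤ, exp (-(2 * Real.pi * I) * (((k + 1 : ℤ) : ℂ) * x)) =
      exp (-(2 * Real.pi * I) * (k * x)) * exp (-(2 * Real.pi * I) * x) := fun k ↦ by
    rw [← exp_add]; congr 1; push_cast; ring
  have hz : ∀ k : ℤ, (-exp (-(Real.pi * I * (τ : ℂ)))) ^ ((k + 1) * (k + 1)) =
      (-exp (-(Real.pi * I * (τ : ℂ)))) ^ (k * k) * (-exp (-(Real.pi * I * (τ : ℂ)))) ^ (2 * k) *
        -exp (-(Real.pi * I * (τ : ℂ))) := fun k ↦ by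
    rw [← zpow_add₀ hne, ← zpow_add_one₀ hne]; congr 1; ring
  induction p with
  | zero => simp
  | succ k ih =>
    rw [step, ih, hx, hz]
    ring
  | pred k ih =>
    have h := step (-(k : ℤ) - 1)
    have h1 := hx (-(k : ℤ) - 1)
    have h2 := hz (-(k : ℤ) - 1)
    rw [sub_add_cancel] at h h1 h2
    rw [ih, h1, h2] at h
    refine mul_left_cancel₀ (mul_ne_zero hne (mul_ne_zero (exp_ne_zero (-(2 * Real.pi * I) * x))
      (zpow_ne_zero (2 * (-(k : ℤ) - 1)) hne))) (h.symm.trans ?_)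
    ring

/-- The factor of automorphy of the theta function. -/
theorem theta_add_lattice (τ : ℍ) (x : ℂ) (n p : ℤ) :
    theta τ (x + (n + p * τ)) = (-1) ^ (n * n) * (-exp (-(Real.pi * I * (τ : ℂ)))) ^ (p * p) *
      exp (-(2 * Real.pi * I) * (p * x)) * theta τ x := by
  -- `n * n` has the parity of `n`; the square is the shape `kᵀAk` required by types.
  have h : ((-1 : ℂ)) ^ (n * n) = (-1) ^ n := by
    rcases Int.even_or_odd n with hn | hn
    · rw [(hn.mul_left n).neg_one_zpow, hn.neg_one_zpow]
    · rw [(hn.mul hn).neg_one_zpow, hn.neg_one_zpow]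
  rw [h, show x + (n + p * τ) = x + p * τ + n by ring, theta_add_int, theta_add_int_mul_tau]
  ring

/-- The sine accounts for the integers, the two `x`-dependent products for the points with `p < 0`
and `p > 0`, and the constant product has no zero because `|q| < 1`. -/
theorem exists_lattice_of_theta_eq_zero {τ : ℍ} {x : ℂ} (h : theta τ x = 0) :
    ∃ n p : ℤ, x = n + p * τ := by
  have hq := norm_nome_lt_one τ
  have hpi : (2 * Real.pi * I : ℂ) ≠ 0 := two_pi_I_ne_zero
  have hpow : ∀ k : ℕ, nome τ ^ k = exp (2 * Real.pi * I * (k * τ)) := fun k ↦ by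
    rw [nome, ← exp_nat_mul]; congr 1; ring
  rw [theta_eq_qProd] at h
  have h2 : (2 : ℂ) * exp (2 * Real.pi * I * (τ : ℂ) / 8) ≠ 0 :=
    mul_ne_zero two_ne_zero (exp_ne_zero _)
  rcases mul_eq_zero.mp h with h | h
  · have h := (mul_eq_zero.mp h).resolve_left h2
    obtain ⟨n, hn⟩ := Complex.sin_eq_zero_iff.mp h
    have hpi' : (Real.pi : ℂ) ≠ 0 := ofReal_ne_zero.mpr Real.pi_ne_zero
    refine ⟨n, 0, mul_left_cancel₀ hpi' ?_⟩
    rw [hn]; push_cast; ring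
  · rcases mul_eq_zero.mp h with h | h
    · rcases mul_eq_zero.mp h with h | h
      · obtain ⟨n, hn⟩ := qProd_eq_zero hq h
        rw [mul_one] at hn
        have := pow_lt_one₀ (norm_nonneg _) hq (Nat.succ_ne_zero n)
        rw [← norm_pow, Nat.succ_eq_add_one, hn, norm_one] at this
        exact (lt_irrefl _ this).elim
      · obtain ⟨n, hn⟩ := qProd_eq_zero hq h
        rw [hpow, ← exp_add, exp_eq_one_iff] at hn
        obtain ⟨k, hk⟩ := hn
        refine ⟨k, -(n + 1), mul_left_cancel₀ hpi ?_⟩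
        push_cast at hk ⊢
        linear_combination hk
    · obtain ⟨n, hn⟩ := qProd_eq_zero hq h
      rw [hpow, ← exp_neg, ← exp_add, exp_eq_one_iff] at hn
      obtain ⟨k, hk⟩ := hn
      refine ⟨-k, n + 1, mul_left_cancel₀ hpi ?_⟩
      push_cast at hk ⊢
      linear_combination -hk

theorem qProd_one_ne_zero {q : ℂ} (hq : ‖q‖ < 1) : qProd q 1 ≠ 0 := by
  intro h
  obtain ⟨n, hn⟩ := qProd_eq_zero hq h
  rw [mul_one] at hn
  have := pow_lt_one₀ (norm_nonneg _) hq (Nat.succ_ne_zero n)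
  rw [← norm_pow, Nat.succ_eq_add_one, hn, norm_one] at this
  exact lt_irrefl _ this

theorem deriv_theta_zero_ne_zero (τ : ℍ) : deriv (theta τ) 0 ≠ 0 := by
  have hq := norm_nome_lt_one τ
  have e : theta τ = fun x ↦ sin (Real.pi * x) * (2 * exp (2 * Real.pi * I * (τ : ℂ) / 8) *
      (qProd (nome τ) 1 * qProd (nome τ) (exp (2 * Real.pi * I * x)) *
        qProd (nome τ) (exp (2 * Real.pi * I * x))⁻¹)) := by
    funext x
    rw [theta_eq_qProd]
    ring
  have h1 : Differentiable ℂ fun x ↦ qProd (nome τ) (exp (2 * Real.pi * I * x)) :=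
    differentiable_aux hq (g := fun x ↦ exp (2 * Real.pi * I * x)) (by fun_prop)
  have h2 : Differentiable ℂ fun x ↦ qProd (nome τ) (exp (2 * Real.pi * I * x))⁻¹ :=
    differentiable_aux hq (g := fun x ↦ (exp (2 * Real.pi * I * x))⁻¹)
      (Differentiable.fun_inv (by fun_prop) fun x ↦ exp_ne_zero _)
  have hsin : HasDerivAt (fun x : ℂ ↦ sin (Real.pi * x)) (Real.pi : ℂ) 0 := by
    have := ((hasDerivAt_id (0 : ℂ)).const_mul (Real.pi : ℂ)).csin
    simpa using this
  have h3 : DifferentiableAt ℂ (fun x ↦ 2 * exp (2 * Real.pi * I * (τ : ℂ) / 8) *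
      (qProd (nome τ) 1 * qProd (nome τ) (exp (2 * Real.pi * I * x)) *
        qProd (nome τ) (exp (2 * Real.pi * I * x))⁻¹)) 0 := by
    fun_prop
  have := (hsin.mul h3.hasDerivAt).deriv
  rw [e]
  erw [this]
  have h1' := qProd_one_ne_zero hq
  simp [h1', Real.pi_ne_zero]

/-- Differentiating the automorphy relation at `0` transports the simple zero at the origin to every
lattice point. -/
theorem deriv_theta_lattice_ne_zero (τ : ℍ) (n p : ℤ) : deriv (theta τ) (n + p * τ) ≠ 0 := by
  have hd : ∀ x, DifferentiableAt ℂ (theta τ) x := fun x ↦ differentiable_theta τ x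
  have e : (fun x ↦ theta τ (x + (n + p * τ))) = fun x ↦ ((-1) ^ (n * n) *
      (-exp (-(Real.pi * I * (τ : ℂ)))) ^ (p * p) *
      exp (-(2 * Real.pi * I) * (p * x))) * theta τ x :=
    funext fun x ↦ theta_add_lattice τ x n p
  have h1 := deriv_comp_add_const (theta τ) (n + p * τ : ℂ) 0
  rw [zero_add] at h1
  rw [← h1, e]
  have h2 : DifferentiableAt ℂ (fun x : ℂ ↦ ((-1) ^ (n * n) *
      (-exp (-(Real.pi * I * (τ : ℂ)))) ^ (p * p) *
      exp (-(2 * Real.pi * I) * (p * x)))) 0 := by fun_prop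
  have h3 := (h2.hasDerivAt.mul (hd 0).hasDerivAt).deriv
  erw [h3]
  simp only [theta_zero, mul_zero, zero_add, exp_zero, mul_one]
  exact mul_ne_zero (mul_ne_zero (zpow_ne_zero _ (by norm_num))
    (zpow_ne_zero _ (neg_ne_zero.mpr (exp_ne_zero _)))) (deriv_theta_zero_ne_zero τ)

/-! ### The three-term relation -/

theorem eq_of_mul_eq_mul_of_differentiable {f g H : ℂ → ℂ} (hf : Differentiable ℂ f)
    (hg : Differentiable ℂ g) (hH : Differentiable ℂ H) {x₀ : ℂ} (hx₀ : H x₀ ≠ 0)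
    (h : ∀ x, H x * f x = H x * g x) : f = g := by
  have hH' : AnalyticOnNhd ℂ H Set.univ := fun x _ ↦ hH.analyticAt x
  have hfg : AnalyticOnNhd ℂ (fun x ↦ f x - g x) Set.univ := fun x _ ↦ (hf.sub hg).analyticAt x
  have := hH'.eq_zero_or_eq_zero_of_mul_eq_zero hfg
    (fun x _ ↦ by simp only [mul_sub, h x, sub_self]) isPreconnected_univ
  rcases this with h0 | h0
  · exact (hx₀ (h0 x₀ (Set.mem_univ _))).elim
  · exact funext fun x ↦ sub_eq_zero.mp (h0 x (Set.mem_univ _))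

/-- An entire function which vanishes at the zeros of an entire function with simple zeros is
a multiple of it. -/
theorem exists_differentiable_quotient {G H : ℂ → ℂ} (hG : Differentiable ℂ G)
    (hH : Differentiable ℂ H) (hz : ∀ x, H x = 0 → G x = 0 ∧ deriv H x ≠ 0) :
    ∃ D : ℂ → ℂ, Differentiable ℂ D ∧ ∀ x, G x = H x * D x := by
  classical
  -- Near a zero `x₀` of `H` this function is the quotient of the divided differences of `G` and `H`
  -- at `x₀`, and the denominator does not vanish at `x₀` since the zero is simple.
  refine ⟨fun x ↦ if H x = 0 then deriv G x / deriv H x else G x / H x, fun x₀ ↦ ?_, fun x ↦ ?_⟩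
  · by_cases h0 : H x₀ = 0
    · obtain ⟨hG0, hd⟩ := hz x₀ h0
      have hGs : DifferentiableAt ℂ (dslope G x₀) x₀ :=
        ((differentiableOn_dslope Filter.univ_mem).mpr hG.differentiableOn).differentiableAt
          Filter.univ_mem
      have hHs : DifferentiableAt ℂ (dslope H x₀) x₀ :=
        ((differentiableOn_dslope Filter.univ_mem).mpr hH.differentiableOn).differentiableAt
          Filter.univ_mem
      have hne : dslope H x₀ x₀ ≠ 0 := by rwa [dslope_same]
      refine (hGs.div hHs hne).congr_of_eventuallyEq ?_
      filter_upwards [hHs.continuousAt.eventually_ne hne] with x hx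
      by_cases hxx : x = x₀
      · subst hxx
        simp [h0]
      · have h1 := sub_smul_dslope H x₀ x
        have h2 := sub_smul_dslope G x₀ x
        rw [h0, sub_zero, smul_eq_mul] at h1
        rw [hG0, sub_zero, smul_eq_mul] at h2
        have h3 : x - x₀ ≠ 0 := sub_ne_zero.mpr hxx
        simp only [Pi.div_apply, ← h1, ← h2, mul_eq_zero, h3, hx, or_self, if_false]
        exact mul_div_mul_left _ _ h3
    · refine ((hG x₀).div (hH x₀) h0).congr_of_eventuallyEq ?_
      filter_upwards [(hH x₀).continuousAt.eventually_ne h0] with x hx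
      simp [hx]
  · by_cases h0 : H x = 0
    · simp [h0, (hz x h0).1]
    · simp only [h0, if_false]
      field_simp

/-- A holomorphic function with periods `1` and `τ` is constant. -/
theorem eq_of_doubly_periodic (τ : ℍ) {D : ℂ → ℂ} (hD : Differentiable ℂ D)
    (h1 : ∀ x, D (x + 1) = D x) (h2 : ∀ x, D (x + τ) = D x) (x y : ℂ) : D x = D y := by
  refine hD.apply_eq_apply_of_bounded ?_ x y
  -- Liouville: all values are taken on the compact fundamental parallelogram, reached by taking
  -- fractional parts of the coordinates in the basis `1, τ`.
  have hK : IsCompact ((fun p : ℝ × ℝ ↦ (p.1 : ℂ) + p.2 * τ) ''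
      (Set.Icc (0 : ℝ) 1 ×ˢ Set.Icc (0 : ℝ) 1)) :=
    (isCompact_Icc.prod isCompact_Icc).image (by fun_prop)
  refine (hK.image hD.continuous).isBounded.subset ?_
  rintro _ ⟨z, rfl⟩
  have hp1 : Function.Periodic D 1 := h1
  have hp2 : Function.Periodic D τ := h2
  have him : (τ : ℂ).im ≠ 0 := τ.im_ne_zero
  set t : ℝ := z.im / (τ : ℂ).im with ht
  set s : ℝ := z.re - t * (τ : ℂ).re with hs
  have hz : z = s + t * τ := by
    apply Complex.ext
    · simp [hs]
    · simp only [add_im, ofReal_im, zero_add, mul_im, ofReal_re, zero_mul, add_zero, ht]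
      field_simp
  refine ⟨((Int.fract s : ℝ) : ℂ) + (Int.fract t : ℝ) * τ, ⟨(Int.fract s, Int.fract t),
    ⟨⟨Int.fract_nonneg s, (Int.fract_lt_one s).le⟩, Int.fract_nonneg t,
      (Int.fract_lt_one t).le⟩, rfl⟩, ?_⟩
  have e : z = ((Int.fract s : ℝ) : ℂ) + (Int.fract t : ℝ) * τ + ⌊t⌋ * τ + ⌊s⌋ * 1 := by
    rw [hz]
    nth_rw 1 [← Int.fract_add_floor s, ← Int.fract_add_floor t]
    push_cast
    ring
  rw [e, hp1.int_mul ⌊s⌋, hp2.int_mul ⌊t⌋]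

/-- The quotient `G / H` extends to an entire function, and the common multipliers make it doubly
periodic, hence constant. -/
theorem exists_eq_mul_of_quasiPeriodic (τ : ℍ) {G H : ℂ → ℂ} (hG : Differentiable ℂ G)
    (hH : Differentiable ℂ H) (hz : ∀ x, H x = 0 → G x = 0 ∧ deriv H x ≠ 0)
    {c₁ c₂ : ℂ → ℂ} (hc₁ : ∀ x, c₁ x ≠ 0) (hc₂ : ∀ x, c₂ x ≠ 0)
    (hG1 : ∀ x, G (x + 1) = c₁ x * G x) (hH1 : ∀ x, H (x + 1) = c₁ x * H x)
    (hG2 : ∀ x, G (x + τ) = c₂ x * G x) (hH2 : ∀ x, H (x + τ) = c₂ x * H x) :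
    ∃ c : ℂ, ∀ x, G x = H x * c := by
  obtain ⟨D, hD, hGD⟩ := exists_differentiable_quotient hG hH hz
  have hx₀ : ∃ x₀, H x₀ ≠ 0 := by
    by_contra! h0
    have hH0 : H = fun _ ↦ 0 := funext h0
    exact (hz 0 (h0 0)).2 (by rw [hH0]; simp)
  obtain ⟨x₀, hx₀⟩ := hx₀
  have key : ∀ (p : ℂ) (c : ℂ → ℂ), (∀ x, c x ≠ 0) → (∀ x, G (x + p) = c x * G x) →
      (∀ x, H (x + p) = c x * H x) → ∀ x, D (x + p) = D x := by
    intro p c hc h1 h2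
    refine congrFun (eq_of_mul_eq_mul_of_differentiable (f := fun x ↦ D (x + p)) (g := D)
      (by fun_prop) hD hH hx₀ fun x ↦ ?_)
    have h3 := hGD (x + p)
    rw [h1, h2, hGD x] at h3
    exact mul_left_cancel₀ (hc x) (by linear_combination -h3)
  exact ⟨D 0, fun x ↦ by
    rw [hGD x, eq_of_doubly_periodic τ hD (key 1 c₁ hc₁ hG1 hH1) (key τ c₂ hc₂ hG2 hH2) x 0]⟩

/-- The multiplier depends on `a` and `b` only through `a + b`, so all products of two theta
functions in the three-term relation are sections of one line bundle in the variable `h`. -/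
theorem exists_theta_mul_theta_add_lattice (τ : ℍ) (c h : ℂ) (n p : ℤ) :
    ∃ k : ℂ, k ≠ 0 ∧ ∀ a b : ℂ, a + b = c →
      theta τ (a + (h + (n + p * τ))) * theta τ (b + (h + (n + p * τ))) =
        k * (theta τ (a + h) * theta τ (b + h)) := by
  set K : ℂ := -exp (-(Real.pi * I * (τ : ℂ)))
  have hK0 : K ≠ 0 := neg_ne_zero.mpr (exp_ne_zero _)
  refine ⟨((-1) ^ (n * n) * K ^ (p * p)) ^ 2 * exp (-(2 * Real.pi * I) * (p * (c + 2 * h))),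
    mul_ne_zero (pow_ne_zero _ (mul_ne_zero (zpow_ne_zero _ (by norm_num))
      (zpow_ne_zero _ hK0))) (exp_ne_zero _), ?_⟩
  rintro a b rfl
  rw [← add_assoc a, ← add_assoc b, theta_add_lattice, theta_add_lattice,
    show -(2 * Real.pi * I) * (p * (a + b + 2 * h)) = -(2 * Real.pi * I) * (p * (a + h)) +
      -(2 * Real.pi * I) * (p * (b + h)) by ring, exp_add]
  ring

theorem theta_add_lattice_ne_zero {τ : ℍ} {a : ℂ} (ha : theta τ a ≠ 0) (n p : ℤ) :
    theta τ (a + (n + p * τ)) ≠ 0 := by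
  rw [theta_add_lattice]
  exact mul_ne_zero (mul_ne_zero (mul_ne_zero (zpow_ne_zero _ (by norm_num))
    (zpow_ne_zero _ (neg_ne_zero.mpr (exp_ne_zero _)))) (exp_ne_zero _)) ha

/-- In the variable `h` both sides have the same multipliers. The factor `θ(h) θ(A + B + h)` has
zeros at the classes of `0` and `-(A + B)`, which are distinct and simple because `θ(A + B) ≠ 0`,
and the left side vanishes at both. So the two are proportional. -/
theorem theta_three_term_generic (τ : ℍ) {A B : ℂ} (C : ℂ) (hA : theta τ A ≠ 0)
    (hB : theta τ B ≠ 0) (hAB : theta τ (A + B) ≠ 0) (h : ℂ) :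
    theta τ (A + h) * theta τ (B + h) * (theta τ C * theta τ (A + B - C)) -
      theta τ (C + h) * theta τ (A + B - C + h) * (theta τ A * theta τ B) =
    theta τ h * theta τ (A + B + h) * (theta τ (A - C) * theta τ (C - B)) := by
  have hd := differentiable_theta τ
  have hod := theta_neg τ
  set G : ℂ → ℂ := fun h ↦ theta τ (A + h) * theta τ (B + h) * (theta τ C * theta τ (A + B - C)) -
      theta τ (C + h) * theta τ (A + B - C + h) * (theta τ A * theta τ B) with hG
  set H : ℂ → ℂ := fun h ↦ theta τ (0 + h) * theta τ (A + B + h) with hH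
  have hdH : ∀ x, deriv H x =
      deriv (theta τ) x * theta τ (A + B + x) + theta τ x * deriv (theta τ) (A + B + x) := by
    intro x
    have e1 : HasDerivAt (fun h ↦ theta τ (0 + h)) (deriv (theta τ) x) x := by
      simpa using (hd x).hasDerivAt
    have e2 : HasDerivAt (fun h ↦ theta τ (A + B + h)) (deriv (theta τ) (A + B + x)) x :=
      HasDerivAt.comp_const_add (A + B) x (hd (A + B + x)).hasDerivAt
    have h3 := (e1.mul e2).deriv
    rw [zero_add] at h3
    exact h3
  have quasi : ∀ (x : ℂ) (n p : ℤ), ∃ k : ℂ, k ≠ 0 ∧ G (x + (n + p * τ)) = k * G x ∧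
      H (x + (n + p * τ)) = k * H x := by
    intro x n p
    obtain ⟨k, hk, e⟩ := exists_theta_mul_theta_add_lattice τ (A + B) x n p
    refine ⟨k, hk, ?_, e 0 (A + B) (zero_add _)⟩
    simp only [hG]
    rw [e A B rfl, e C (A + B - C) (by ring)]
    ring
  have hz : ∀ x, H x = 0 → G x = 0 ∧ deriv H x ≠ 0 := by
    intro x hx
    rw [hdH]
    rcases mul_eq_zero.mp hx with h0 | h0
    · rw [zero_add] at h0
      obtain ⟨n, p, rfl⟩ := exists_lattice_of_theta_eq_zero h0
      refine ⟨?_, ?_⟩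
      · obtain ⟨k, -, e, -⟩ := quasi 0 n p
        rw [zero_add] at e
        rw [e]
        simp only [hG, add_zero]
        ring
      · rw [h0, zero_mul, add_zero]
        exact mul_ne_zero (deriv_theta_lattice_ne_zero τ n p) (theta_add_lattice_ne_zero hAB n p)
    · obtain ⟨n, p, e⟩ := exists_lattice_of_theta_eq_zero h0
      obtain rfl : x = -(A + B) + (n + p * τ) := by rw [← e]; ring
      refine ⟨?_, ?_⟩
      · obtain ⟨k, -, e, -⟩ := quasi (-(A + B)) n p
        rw [e]
        simp only [hG]
        rw [show A + -(A + B) = -B by ring, show B + -(A + B) = -A by ring,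
          show A + B - C + -(A + B) = -C by ring, show C + -(A + B) = -(A + B - C) by ring]
        simp only [hod]
        ring
      · rw [h0, mul_zero, zero_add, e]
        exact mul_ne_zero (theta_add_lattice_ne_zero (by rwa [hod, neg_ne_zero]) n p)
          (deriv_theta_lattice_ne_zero τ n p)
  choose k hk hkG hkH using quasi
  obtain ⟨c, hc⟩ := exists_eq_mul_of_quasiPeriodic τ (G := G) (H := H)
    (by fun_prop) (by fun_prop) hz (fun x ↦ hk x 1 0) (fun x ↦ hk x 0 1)
    (fun x ↦ by simpa using hkG x 1 0) (fun x ↦ by simpa using hkH x 1 0)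
    (fun x ↦ by simpa using hkG x 0 1) (fun x ↦ by simpa using hkH x 0 1)
  -- The constant is found at `h = -A`, where the first term vanishes; `θ(A) θ(B)` is then
  -- cancelled.
  have h1 := hc (-A)
  have h2 := hc h
  simp only [hG, hH, zero_add] at h1 h2
  rw [h2]
  congr 1
  rw [show C + -A = -(A - C) by ring, show A + B - C + -A = -(C - B) by ring,
    show A + B + -A = B by ring, show A + -A = 0 by ring, theta_zero, hod, hod, hod] at h1
  refine mul_left_cancel₀ (mul_ne_zero hA hB) ?_
  linear_combination h1

theorem exists_theta_ne_zero (τ : ℍ) : ∃ x, theta τ x ≠ 0 := by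
  by_contra! h
  refine deriv_theta_zero_ne_zero τ ?_
  rw [show theta τ = fun _ ↦ 0 from funext h]
  simp

/-- Weierstrass' three-term relation for the theta function. -/
theorem theta_three_term (τ : ℍ) (A B C h : ℂ) :
    theta τ (A + h) * theta τ (B + h) * (theta τ C * theta τ (A + B - C)) -
      theta τ (C + h) * theta τ (A + B - C + h) * (theta τ A * theta τ B) =
    theta τ h * theta τ (A + B + h) * (theta τ (A - C) * theta τ (C - B)) := by
  have hd := differentiable_theta τ
  obtain ⟨x₀, hx₀⟩ := exists_theta_ne_zero τ
  have hprod : ∀ {f g : ℂ → ℂ}, Differentiable ℂ f → Differentiable ℂ g → (∃ x, f x ≠ 0) →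
      (∃ x, g x ≠ 0) → ∃ x, f x * g x ≠ 0 := by
    rintro f g hf hg ⟨x, hx⟩ ⟨y, hy⟩
    by_contra! h0
    exact hy (congrFun (eq_of_mul_eq_mul_of_differentiable hg (differentiable_const 0) hf hx
      fun z ↦ by simp [h0 z]) y)
  -- To remove the genericity assumptions `A` and `B` are both moved by `t`. The product of the
  -- three theta values that must not vanish is not identically zero in `t`, so the identity extends
  -- to `t = 0`.
  obtain ⟨t₀, ht₀⟩ := hprod (f := fun t ↦ theta τ (A + t) * theta τ (B + t))
    (g := fun t ↦ theta τ (A + t + (B + t))) (by fun_prop) (by fun_prop)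
    (hprod (by fun_prop) (by fun_prop) ⟨x₀ - A, by simpa using hx₀⟩ ⟨x₀ - B, by simpa using hx₀⟩)
    ⟨(x₀ - A - B) / 2, by
      rwa [show A + (x₀ - A - B) / 2 + (B + (x₀ - A - B) / 2) = x₀ by ring]⟩
  have := congrFun (eq_of_mul_eq_mul_of_differentiable
    (f := fun t ↦ theta τ (A + t + h) * theta τ (B + t + h) *
        (theta τ C * theta τ (A + t + (B + t) - C)) -
      theta τ (C + h) * theta τ (A + t + (B + t) - C + h) * (theta τ (A + t) * theta τ (B + t)))
    (g := fun t ↦ theta τ h * theta τ (A + t + (B + t) + h) *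
      (theta τ (A + t - C) * theta τ (C - (B + t))))
    (H := fun t ↦ theta τ (A + t) * theta τ (B + t) * theta τ (A + t + (B + t)))
    (by fun_prop) (by fun_prop) (by fun_prop) ht₀ fun t ↦ ?_) 0
  · simpa using this
  · by_cases h0 : theta τ (A + t) * theta τ (B + t) * theta τ (A + t + (B + t)) = 0
    · simp only [h0, zero_mul]
    · obtain ⟨h1, h2⟩ := mul_ne_zero_iff.mp h0
      obtain ⟨h1, h3⟩ := mul_ne_zero_iff.mp h1
      congr 1
      exact theta_three_term_generic τ C h1 h3 h2 h

/-! ### Addition formulas for `delta` evaluated at linear forms. -/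

section Forms

variable {ι : Type} [Fintype ι]

/-! ### Theta functions of linear forms -/

theorem evalForm_zero (z : ι → ℂ) : evalForm 0 z = 0 := by simp [evalForm]

theorem evalForm_add (a b : ι → ℤ) (z : ι → ℂ) :
    evalForm (a + b) z = evalForm a z + evalForm b z := by
  simp [evalForm, add_mul, Finset.sum_add_distrib]

theorem evalForm_neg (a : ι → ℤ) (z : ι → ℂ) : evalForm (-a) z = -evalForm a z := by
  simp [evalForm]

theorem evalForm_sub (a b : ι → ℤ) (z : ι → ℂ) :
    evalForm (a - b) z = evalForm a z - evalForm b z := by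
  rw [sub_eq_add_neg, evalForm_add, evalForm_neg, sub_eq_add_neg]

theorem exists_evalForm_eq {a : ι → ℤ} (ha : a ≠ 0) (x : ℂ) : ∃ z, evalForm a z = x := by
  classical
  obtain ⟨i, hi⟩ := Function.ne_iff.mp ha
  have hi' : (a i : ℂ) ≠ 0 := Int.cast_ne_zero.mpr hi
  refine ⟨Pi.single i (x / a i), ?_⟩
  rw [evalForm, Finset.sum_eq_single i (fun j _ hj ↦ by simp [hj]) (by simp), Pi.single_eq_same]
  field_simp

theorem thetaForm_neg (τ : ℍ) (a : ι → ℤ) : thetaForm τ (-a) = -thetaForm τ a := by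
  rw [thetaForm, thetaForm, ← map_neg]
  congr 1
  refine Subtype.ext (funext fun z ↦ ?_)
  simp [evalForm_neg, theta_neg]

theorem thetaForm_ne_zero (τ : ℍ) {a : ι → ℤ} (ha : a ≠ 0) : thetaForm τ a ≠ 0 := by
  intro h
  rw [thetaForm, ← map_zero (algebraMap (Entire ι) (Mero ι))] at h
  have h := congrArg Subtype.val (IsFractionRing.injective (Entire ι) (Mero ι) h)
  obtain ⟨x, hx⟩ := exists_theta_ne_zero τ
  obtain ⟨z, rfl⟩ := exists_evalForm_eq ha x
  exact hx (congrFun h z)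

theorem thetaForm_three_term (τ : ℍ) (A B C h : ι → ℤ) :
    thetaForm τ (A + h) * thetaForm τ (B + h) * (thetaForm τ C * thetaForm τ (A + B - C)) -
      thetaForm τ (C + h) * thetaForm τ (A + B - C + h) * (thetaForm τ A * thetaForm τ B) =
    thetaForm τ h * thetaForm τ (A + B + h) * (thetaForm τ (A - C) * thetaForm τ (C - B)) := by
  simp only [thetaForm, ← map_mul, ← map_sub]
  congr 1
  refine Subtype.ext (funext fun z ↦ ?_)
  have := theta_three_term τ (evalForm A z) (evalForm B z) (evalForm C z) (evalForm h z)
  simp only [← evalForm_add, ← evalForm_sub] at this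
  exact this

/-- The three-term relation, with all arguments named. -/
theorem thetaForm_relation (τ : ℍ) {A B C D a b c d e f g h : ι → ℤ} (ha : a = A + h)
    (hb : b = B + h) (hD : D = A + B - C) (hc : c = C + h) (hd : d = D + h)
    (he : e = A + B + h) (hf : f = A - C) (hg : g = C - B) :
    thetaForm τ a * thetaForm τ b * (thetaForm τ C * thetaForm τ D) -
      thetaForm τ c * thetaForm τ d * (thetaForm τ A * thetaForm τ B) =
    thetaForm τ h * thetaForm τ e * (thetaForm τ f * thetaForm τ g) := by
  subst ha hb hD hc hd he hf hg
  exact thetaForm_three_term τ A B C h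

theorem algebraMap_deriv_theta_ne_zero (τ : ℍ) :
    algebraMap ℂ (Mero ι) (deriv (theta τ) 0) ≠ 0 :=
  (map_ne_zero _).mpr (deriv_theta_zero_ne_zero τ)

/-! ### Relations between the functions `delta` -/

theorem delta_ne_zero (τ : ℍ) {a b : ι → ℤ} (ha : a ≠ 0) (hb : b ≠ 0) (hab : a + b ≠ 0) :
    delta τ a b ≠ 0 :=
  div_ne_zero (mul_ne_zero (algebraMap_deriv_theta_ne_zero τ) (thetaForm_ne_zero τ hab))
    (mul_ne_zero (thetaForm_ne_zero τ ha) (thetaForm_ne_zero τ hb))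

theorem delta_neg_neg (τ : ℍ) (a b : ι → ℤ) : delta τ (-a) (-b) = -delta τ a b := by
  rw [delta, delta, ← neg_add, thetaForm_neg, thetaForm_neg, thetaForm_neg]
  ring

theorem delta_neg_right (τ : ℍ) (a b : ι → ℤ) : delta τ a (-b) = -delta τ (-a) b := by
  rw [← delta_neg_neg, neg_neg]

/-- Fay's identity: after clearing denominators it is a single instance of the three-term relation.
It gives the coefficients of `s_i f` and `s_j f` in the braid relation. -/
theorem delta_fay (τ : ℍ) {x y s t : ι → ℤ} (hx : x ≠ 0) (hy : y ≠ 0) (hxy : x - y ≠ 0)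
    (hs : s ≠ 0) (ht : t ≠ 0) (hst : s + t ≠ 0) :
    delta τ x s * delta τ y t =
      delta τ x (s + t) * delta τ (y - x) t + delta τ y (s + t) * delta τ (x - y) s := by
  have key := thetaForm_relation τ (A := y + t) (B := x - y) (C := x) (D := t) (h := s)
    (a := y + (s + t)) (b := x - y + s) (c := x + s) (d := s + t) (e := x + (s + t))
    (f := y - x + t) (g := y)
    (by abel) (by abel) (by abel) (by abel) (by abel) (by abel) (by abel) (by abel)
  have hx' := thetaForm_ne_zero τ hx
  have hy' := thetaForm_ne_zero τ hy
  have hxy' := thetaForm_ne_zero τ hxy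
  have hs' := thetaForm_ne_zero τ hs
  have ht' := thetaForm_ne_zero τ ht
  have hst' := thetaForm_ne_zero τ hst
  simp only [delta]
  rw [show thetaForm τ (y - x) = -thetaForm τ (x - y) by rw [← thetaForm_neg, neg_sub]]
  field_simp
  linear_combination -(algebraMap ℂ (Mero ι) (deriv (theta τ) 0) ^ 2 * key)

/-- `F(a, b) F(-a, b) = ℘(b) - ℘(a)`. -/
theorem delta_mul_delta_neg_add (τ : ℍ) {a ν h : ι → ℤ} (ha : a ≠ 0) (hν : ν ≠ 0) (hh : h ≠ 0) :
    delta τ (-a) (-ν) * delta τ (-a) ν + delta τ a h * delta τ (-a) h =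
      delta τ ν h * delta τ (-ν) h := by
  -- In terms of `℘` the identity reads `-(℘(ν) - ℘(a)) + (℘(h) - ℘(a)) = ℘(h) - ℘(ν)`.
  have key := thetaForm_relation τ (A := h + a) (B := h - a) (C := h) (D := h) (h := ν - h)
    (a := a + ν) (b := ν - a) (c := ν) (d := ν) (e := ν + h) (f := a) (g := a)
    (by abel) (by abel) (by abel) (by abel) (by abel) (by abel) (by abel) (by abel)
  have ha' := thetaForm_ne_zero τ ha
  have hν' := thetaForm_ne_zero τ hν
  have hh' := thetaForm_ne_zero τ hh
  simp only [delta_neg_right τ (-a) ν, neg_neg]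
  simp only [delta, thetaForm_neg]
  rw [show -a + ν = ν - a by abel, show -a + h = h - a by abel, show -ν + h = -(ν - h) by abel,
    show a + h = h + a by abel, thetaForm_neg]
  field_simp
  linear_combination algebraMap ℂ (Mero ι) (deriv (theta τ) 0) ^ 2 * key

/-- The product formula for `℘(a) - ℘(b)`; the contribution `℘(h)` cancels, so the right side is
free of `h`. -/
theorem delta_mul_delta_neg_sub (τ : ℍ) {a b h : ι → ℤ} (ha : a ≠ 0) (hb : b ≠ 0) (hh : h ≠ 0) :
    delta τ b h * delta τ (-b) h - delta τ a h * delta τ (-a) h =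
      algebraMap ℂ (Mero ι) (deriv (theta τ) 0) ^ 2 * thetaForm τ (a + b) * thetaForm τ (b - a) /
        (thetaForm τ a ^ 2 * thetaForm τ b ^ 2) := by
  have key := thetaForm_relation τ (A := a + b) (B := b - a) (C := b) (D := b) (h := h - b)
    (a := a + h) (b := h - a) (c := h) (d := h) (e := b + h) (f := a) (g := a)
    (by abel) (by abel) (by abel) (by abel) (by abel) (by abel) (by abel) (by abel)
  have ha' := thetaForm_ne_zero τ ha
  have hb' := thetaForm_ne_zero τ hb
  have hh' := thetaForm_ne_zero τ hh
  simp only [delta, thetaForm_neg]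
  rw [show -a + h = h - a by abel, show -b + h = h - b by abel]
  field_simp
  linear_combination algebraMap ℂ (Mero ι) (deriv (theta τ) 0) ^ 2 * key

/-- The coefficient of `f` in the braid relation. The terms with `h` and those without it change,
under exchange of `a` and `b`, by opposite multiples `(℘(a) - ℘(b)) δ(a + b, p + q)`. -/
theorem delta_braid (τ : ℍ) {a b p q h : ι → ℤ} (ha : a ≠ 0) (hb : b ≠ 0) (hab : a + b ≠ 0)
    (hp : p ≠ 0) (hq : q ≠ 0) (hpq : p + q ≠ 0) (hh : h ≠ 0) :
    delta τ a p * delta τ a q * delta τ b (p + q) + delta τ a h * delta τ (-a) h *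
      delta τ (a + b) (p + q) =
    delta τ b p * delta τ b q * delta τ a (p + q) + delta τ b h * delta τ (-b) h *
      delta τ (a + b) (p + q) := by
  have key := thetaForm_relation τ (A := b + p) (B := b + q) (C := b) (D := b + (p + q))
    (h := a - b) (a := a + p) (b := a + q) (c := a) (d := a + (p + q)) (e := a + b + (p + q))
    (f := p) (g := -q)
    (by abel) (by abel) (by abel) (by abel) (by abel) (by abel) (by abel) (by abel)
  have ha' := thetaForm_ne_zero τ ha
  have hb' := thetaForm_ne_zero τ hb
  have hab' := thetaForm_ne_zero τ hab
  have hp' := thetaForm_ne_zero τ hp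
  have hq' := thetaForm_ne_zero τ hq
  have hpq' := thetaForm_ne_zero τ hpq
  have h1 := delta_mul_delta_neg_sub τ ha hb hh
  have h2 : delta τ a p * delta τ a q * delta τ b (p + q) -
      delta τ b p * delta τ b q * delta τ a (p + q) =
      (algebraMap ℂ (Mero ι) (deriv (theta τ) 0) ^ 2 * thetaForm τ (a + b) * thetaForm τ (b - a) /
        (thetaForm τ a ^ 2 * thetaForm τ b ^ 2)) * delta τ (a + b) (p + q) := by
    rw [show b - a = -(a - b) by abel]
    rw [thetaForm_neg] at key ⊢
    simp only [delta]
    field_simp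
    linear_combination algebraMap ℂ (Mero ι) (deriv (theta τ) 0) ^ 3 * key
  linear_combination h2 - delta τ (a + b) (p + q) * h1

/-- Two of the terms share the factor `δ(b, h)`, the other two share `δ(b, μ₁) δ(c, μ₂)`. By the
three-term relation each remaining difference is, up to sign, the factor shared by the other pair
times one and the same theta quotient, and the signs are opposite. -/
theorem delta_four_term (τ : ℍ) {a b c μ₁ μ₂ h : ι → ℤ} (ha : a ≠ 0) (hb : b ≠ 0) (hc : c ≠ 0)
    (hd : b + c - a ≠ 0) (hab : a - b ≠ 0) (hca : c - a ≠ 0) (h1 : μ₁ ≠ 0) (h2 : μ₂ ≠ 0)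
    (h12 : μ₂ - μ₁ ≠ 0) (hh : h ≠ 0) :
    delta τ (a - b) (μ₂ - μ₁) * (delta τ a μ₁ * delta τ b h * delta τ (b + c - a) μ₂) +
      delta τ (b - a) h * (delta τ b μ₁ * delta τ a h * delta τ c μ₂) =
    delta τ (c - a) (μ₂ - μ₁) * (delta τ a μ₂ * delta τ b h * delta τ (b + c - a) μ₁) +
      delta τ (a - c) h * (delta τ c μ₂ * delta τ (b + c - a) h * delta τ b μ₁) := by
  obtain ⟨d, rfl⟩ : ∃ d, b = d + a - c := ⟨b + c - a, by abel⟩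
  obtain ⟨ν, rfl⟩ : ∃ ν, μ₂ = ν + μ₁ := ⟨μ₂ - μ₁, by abel⟩
  rw [show d + a - c + c - a = d by abel] at hd ⊢
  rw [add_sub_cancel_right] at h12 ⊢
  have key1 := thetaForm_relation τ (A := a) (B := d + a - c - a) (C := d) (D := a - c) (h := h)
    (a := a + h) (b := d + a - c - a + h) (c := d + h) (d := a - c + h) (e := d + a - c + h)
    (f := a - d) (g := c)
    (by abel) (by abel) (by abel) (by abel) (by abel) (by abel) (by abel) (by abel)
  have key2 := thetaForm_relation τ (A := a - (d + a - c)) (B := d + μ₁) (C := c - a)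
    (D := a + μ₁) (h := ν) (a := a - (d + a - c) + ν) (b := d + (ν + μ₁)) (c := c - a + ν)
    (d := a + (ν + μ₁)) (e := c + (ν + μ₁)) (f := a - d) (g := -(d + a - c + μ₁))
    (by abel) (by abel) (by abel) (by abel) (by abel) (by abel) (by abel) (by abel)
  have ha' := thetaForm_ne_zero τ ha
  have hb' := thetaForm_ne_zero τ hb
  have hc' := thetaForm_ne_zero τ hc
  have hd' := thetaForm_ne_zero τ hd
  have hab' := thetaForm_ne_zero τ hab
  have hca' := thetaForm_ne_zero τ hca
  have h1' := thetaForm_ne_zero τ h1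
  have h2' := thetaForm_ne_zero τ h2
  have h12' := thetaForm_ne_zero τ h12
  have hh' := thetaForm_ne_zero τ hh
  have e1 : thetaForm τ (d + a - c - a) = -thetaForm τ (a - (d + a - c)) := by
    rw [← thetaForm_neg, neg_sub]
  have e2 : thetaForm τ (a - c) = -thetaForm τ (c - a) := by
    rw [← thetaForm_neg, neg_sub]
  rw [e1, e2] at key1
  rw [thetaForm_neg] at key2
  set D := algebraMap ℂ (Mero ι) (deriv (theta τ) 0) with hD
  have g1 : delta τ a h * delta τ (d + a - c - a) h - delta τ d h * delta τ (a - c) h =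
      delta τ (d + a - c) h * (D * thetaForm τ (d + a - c) * thetaForm τ c * thetaForm τ (a - d) /
        (thetaForm τ a * thetaForm τ d * thetaForm τ (a - (d + a - c)) * thetaForm τ (c - a))) := by
    simp only [delta, e1, e2, ← hD]
    field_simp
    linear_combination D ^ 2 * key1
  have g2 : delta τ (a - (d + a - c)) ν * delta τ a μ₁ * delta τ d (ν + μ₁) -
      delta τ (c - a) ν * delta τ a (ν + μ₁) * delta τ d μ₁ =
      -delta τ (d + a - c) μ₁ * delta τ c (ν + μ₁) *
      (D * thetaForm τ (d + a - c) * thetaForm τ c * thetaForm τ (a - d) /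
        (thetaForm τ a * thetaForm τ d * thetaForm τ (a - (d + a - c)) * thetaForm τ (c - a))) := by
    simp only [delta, ← hD]
    field_simp
    linear_combination D ^ 3 * key2
  linear_combination delta τ (d + a - c) h * g2 +
    delta τ (d + a - c) μ₁ * delta τ c (ν + μ₁) * g1

end Forms

/-! ### Transport of functions and of their types under substitutions and translations. -/

section Types

set_option linter.unusedSectionVars false

variable {ι : Type} [Fintype ι]

/-! ### Substitutions and translations -/

theorem Mero.map_add (e : Mero ι ≃+* Mero ι) (f g : Mero ι) : e (f + g) = e f + e g :=
  e.map_add' f g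

theorem Mero.map_mul (e : Mero ι ≃+* Mero ι) (f g : Mero ι) : e (f * g) = e f * e g :=
  e.map_mul' f g

theorem Mero.map_zero (e : Mero ι ≃+* Mero ι) : e 0 = 0 := by
  simp

theorem Mero.map_one (e : Mero ι ≃+* Mero ι) : e 1 = 1 := by
  simp

theorem Mero.map_inv (e : Mero ι ≃+* Mero ι) (f : Mero ι) : e f⁻¹ = (e f)⁻¹ := by
  by_cases hf : f = 0
  · rw [hf, inv_zero, Mero.map_zero, inv_zero]
  · refine eq_inv_of_mul_eq_one_left ?_
    rw [← Mero.map_mul, inv_mul_cancel₀ hf, Mero.map_one]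

theorem Mero.map_div (e : Mero ι ≃+* Mero ι) (f g : Mero ι) : e (f / g) = e f / e g := by
  rw [div_eq_mul_inv, Mero.map_mul, Mero.map_inv, div_eq_mul_inv]

theorem Mero.map_prod (e : Mero ι ≃+* Mero ι) {α : Type*} (s : Finset α) (f : α → Mero ι) :
    e (∏ i ∈ s, f i) = ∏ i ∈ s, e (f i) := by
  classical
  induction s using Finset.induction_on with
  | empty => exact Mero.map_one e
  | insert a s ha ih => rw [Finset.prod_insert ha, Finset.prod_insert ha, Mero.map_mul, ih]

/-- The action of a permutation of the variables on linear forms. -/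
def permForm (e : Equiv.Perm ι) : (ι → ℤ) ≃+ (ι → ℤ) where
  toFun a := a ∘ e.symm
  invFun a := a ∘ e
  left_inv a := funext fun i ↦ by simp
  right_inv a := funext fun i ↦ by simp
  map_add' _ _ := rfl

theorem permForm_apply (e : Equiv.Perm ι) (a : ι → ℤ) (i : ι) :
    permForm e a i = a (e.symm i) := rfl

theorem evalForm_permForm (e : Equiv.Perm ι) (a : ι → ℤ) (z : ι → ℂ) :
    evalForm (permForm e a) z = evalForm a (z ∘ e) := by
  rw [evalForm, evalForm, ← Equiv.sum_comp e]
  simp [permForm_apply]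

theorem permute_entire (e : Equiv.Perm ι) (f g : Entire ι) (h : ∀ z, f.1 (z ∘ e) = g.1 z) :
    permute e (algebraMap (Entire ι) (Mero ι) f) = algebraMap (Entire ι) (Mero ι) g := by
  rw [permute, IsFractionRing.ringEquivOfRingEquiv_algebraMap]
  exact congrArg _ (Subtype.ext (funext h))

theorem translate_entire (c : ι → ℂ) (f g : Entire ι)
    (h : ∀ z, f.1 (fun i ↦ z i + c i) = g.1 z) :
    translate c (algebraMap (Entire ι) (Mero ι) f) = algebraMap (Entire ι) (Mero ι) g := by
  rw [translate, IsFractionRing.ringEquivOfRingEquiv_algebraMap]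
  exact congrArg _ (Subtype.ext (funext h))

/-- The action of a permutation of the variables on holomorphic functions. -/
def permuteEntire (e : Equiv.Perm ι) (f : Entire ι) : Entire ι :=
  ⟨fun z ↦ f.1 (fun i ↦ z (e i)), fun z _ ↦ (f.2 _ (Set.mem_univ _)).comp
    (AnalyticAt.pi fun i ↦
      (ContinuousLinearMap.proj (R := ℂ) (φ := fun _ : ι ↦ ℂ) (e i)).analyticAt z)⟩

/-- The action of a translation on holomorphic functions. -/
def translateEntire (c : ι → ℂ) (f : Entire ι) : Entire ι :=
  ⟨fun z ↦ f.1 (fun i ↦ z i + c i), fun z _ ↦ (f.2 _ (Set.mem_univ _)).comp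
    (AnalyticAt.pi fun i ↦ analytic_coord i (c i) z (Set.mem_univ _))⟩

theorem permute_thetaForm (τ : ℍ) (e : Equiv.Perm ι) (a : ι → ℤ) :
    permute e (thetaForm τ a) = thetaForm τ (permForm e a) := by
  exact permute_entire _ _ _ fun z ↦ congrArg (theta τ) (evalForm_permForm e a z).symm

theorem algebraMap_complex (c : ℂ) :
    algebraMap ℂ (Mero ι) c = algebraMap (Entire ι) (Mero ι) (algebraMap ℂ (Entire ι) c) :=
  IsScalarTower.algebraMap_apply ℂ (Entire ι) (Mero ι) c

theorem permute_algebraMap (e : Equiv.Perm ι) (c : ℂ) :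
    permute e (algebraMap ℂ (Mero ι) c) = algebraMap ℂ (Mero ι) c := by
  rw [algebraMap_complex]
  exact permute_entire _ _ _ fun z ↦ rfl

theorem translate_algebraMap (v : ι → ℂ) (c : ℂ) :
    translate v (algebraMap ℂ (Mero ι) c) = algebraMap ℂ (Mero ι) c := by
  rw [algebraMap_complex]
  exact translate_entire _ _ _ fun z ↦ rfl

theorem permute_delta (τ : ℍ) (e : Equiv.Perm ι) (a b : ι → ℤ) :
    permute e (delta τ a b) = delta τ (permForm e a) (permForm e b) := by
  rw [delta, delta, Mero.map_div, Mero.map_mul, Mero.map_mul, permute_algebraMap,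
    permute_thetaForm, permute_thetaForm, permute_thetaForm, (permForm e).map_add]

theorem permute_mul (e e' : Equiv.Perm ι) (f : Mero ι) :
    permute (e * e') f = permute e (permute e' f) := by
  have key : ∀ a : Entire ι, permute (e * e') (algebraMap (Entire ι) (Mero ι) a) =
      permute e (permute e' (algebraMap (Entire ι) (Mero ι) a)) := fun a ↦ by
    rw [permute_entire e' a (permuteEntire e' a) fun z ↦ rfl,
      permute_entire e (permuteEntire e' a) (permuteEntire (e * e') a) fun z ↦ rfl]
    exact permute_entire _ _ _ fun z ↦ rfl
  obtain ⟨a, b, -, rfl⟩ := IsFractionRing.div_surjective (A := Entire ι) f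
  rw [Mero.map_div, Mero.map_div, Mero.map_div, key, key]

theorem permute_one (f : Mero ι) : permute (1 : Equiv.Perm ι) f = f := by
  obtain ⟨a, b, -, rfl⟩ := IsFractionRing.div_surjective (A := Entire ι) f
  rw [Mero.map_div, permute_entire 1 a a fun z ↦ rfl, permute_entire 1 b b fun z ↦ rfl]

theorem translate_permute (c : ι → ℂ) (e : Equiv.Perm ι) (f : Mero ι) :
    translate c (permute e f) = permute e (translate (c ∘ e) f) := by
  have key : ∀ a : Entire ι, translate c (permute e (algebraMap (Entire ι) (Mero ι) a)) =
      permute e (translate (c ∘ e) (algebraMap (Entire ι) (Mero ι) a)) := fun a ↦ by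
    rw [permute_entire e a (permuteEntire e a) fun z ↦ rfl,
      translate_entire c _ (translateEntire c (permuteEntire e a)) fun z ↦ rfl,
      translate_entire (c ∘ e) a (translateEntire (c ∘ e) a) fun z ↦ rfl]
    exact (permute_entire _ _ _ fun z ↦ rfl).symm
  obtain ⟨a, b, -, rfl⟩ := IsFractionRing.div_surjective (A := Entire ι) f
  rw [Mero.map_div, Mero.map_div, Mero.map_div, Mero.map_div, key, key]

/-! ### Types -/

theorem automorphyFactor_add (τ : ℍ) (A B : Matrix ι ι ℤ) (k l : ι → ℤ) :
    automorphyFactor τ (A + B) k l = automorphyFactor τ A k l * automorphyFactor τ B k l := by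
  refine Subtype.ext (funext fun z ↦ ?_)
  have h : -exp (-(Real.pi * I * (τ : ℂ))) ≠ 0 := neg_ne_zero.mpr (exp_ne_zero _)
  change _ = (automorphyFactor τ A k l).1 z * (automorphyFactor τ B k l).1 z
  simp only [automorphyFactor, Matrix.add_mulVec, Matrix.vecMul_add, dotProduct_add,
    evalForm_add, mul_add, exp_add, zpow_add₀ h, zpow_add₀ (show (-1 : ℂ) ≠ 0 by norm_num)]
  ring

theorem automorphyFactor_zero (τ : ℍ) (k l : ι → ℤ) :
    automorphyFactor τ (0 : Matrix ι ι ℤ) k l = 1 := by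
  refine Subtype.ext (funext fun z ↦ ?_)
  simp [automorphyFactor, evalForm_zero]

theorem HasType.mul {τ : ℍ} {f g : Mero ι} {A B : Matrix ι ι ℤ} (hf : HasType τ f A)
    (hg : HasType τ g B) : HasType τ (f * g) (A + B) :=
  ⟨hf.1.add hg.1, fun k l ↦ by
    rw [Mero.map_mul, hf.2, hg.2, automorphyFactor_add, map_mul]; ring⟩

theorem HasType.add {τ : ℍ} {f g : Mero ι} {A : Matrix ι ι ℤ} (hf : HasType τ f A)
    (hg : HasType τ g A) : HasType τ (f + g) A :=
  ⟨hf.1, fun k l ↦ by rw [Mero.map_add, hf.2, hg.2]; ring⟩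

theorem HasType.inv {τ : ℍ} {f : Mero ι} {A : Matrix ι ι ℤ} (hf : HasType τ f A) :
    HasType τ f⁻¹ (-A) :=
  ⟨hf.1.neg, fun k l ↦ by
    rw [Mero.map_inv, hf.2, mul_inv]
    congr 1
    refine (eq_inv_of_mul_eq_one_left ?_).symm
    rw [← map_mul, ← automorphyFactor_add, neg_add_cancel, automorphyFactor_zero, map_one]⟩

theorem hasType_algebraMap (τ : ℍ) (c : ℂ) : HasType τ (algebraMap ℂ (Mero ι) c) 0 :=
  ⟨Matrix.isSymm_zero, fun k l ↦ by
    rw [translate_algebraMap, automorphyFactor_zero, map_one, one_mul]⟩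

theorem hasType_one (τ : ℍ) : HasType τ (1 : Mero ι) 0 := by
  simpa using hasType_algebraMap (ι := ι) τ 1

theorem HasType.prod {τ : ℍ} {α : Type*} (s : Finset α) {f : α → Mero ι}
    {A : α → Matrix ι ι ℤ} (h : ∀ i ∈ s, HasType τ (f i) (A i)) :
    HasType τ (∏ i ∈ s, f i) (∑ i ∈ s, A i) := by
  classical
  induction s using Finset.induction_on with
  | empty => simpa using hasType_one τ
  | insert a s ha ih =>
    rw [Finset.prod_insert ha, Finset.sum_insert ha]
    exact (h a (Finset.mem_insert_self _ _)).mul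
      (ih fun i hi ↦ h i (Finset.mem_insert_of_mem hi))

theorem evalForm_int (a k : ι → ℤ) : evalForm a (fun i ↦ (k i : ℂ)) = ((a ⬝ᵥ k : ℤ) : ℂ) := by
  simp [evalForm, dotProduct]

theorem hasType_thetaForm (τ : ℍ) (a : ι → ℤ) :
    HasType τ (thetaForm τ a) (Matrix.vecMulVec a a) := by
  refine ⟨Matrix.ext fun i j ↦ mul_comm _ _, fun k l ↦ ?_⟩
  rw [thetaForm, ← map_mul]
  refine translate_entire _ _ _ fun z ↦ ?_
  have h1 : ∀ v : ι → ℤ, v ⬝ᵥ (Matrix.vecMulVec a a).mulVec v = (a ⬝ᵥ v) * (a ⬝ᵥ v) := fun v ↦ by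
    rw [Matrix.vecMulVec_mulVec, dotProduct_smul, dotProduct_comm v]
    simp
  have h2 : evalForm a (fun i ↦ z i + ((k i : ℂ) + (l i : ℂ) * (τ : ℂ))) =
      evalForm a z + (((a ⬝ᵥ k : ℤ) : ℂ) + ((a ⬝ᵥ l : ℤ) : ℂ) * τ) := by
    rw [← evalForm_int, ← evalForm_int]
    simp only [evalForm, mul_add, Finset.sum_add_distrib, Finset.sum_mul, mul_assoc]
  have h3 : evalForm (Matrix.vecMul l (Matrix.vecMulVec a a)) z =
      ((a ⬝ᵥ l : ℤ) : ℂ) * evalForm a z := by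
    rw [Matrix.vecMul_vecMulVec, dotProduct_comm]
    simp [evalForm, Finset.mul_sum, mul_assoc]
  change theta τ (evalForm a (fun i ↦ z i + ((k i : ℂ) + (l i : ℂ) * (τ : ℂ)))) =
    (-1) ^ (k ⬝ᵥ (Matrix.vecMulVec a a).mulVec k) * (-exp (-(Real.pi * I * (τ : ℂ)))) ^
      (l ⬝ᵥ (Matrix.vecMulVec a a).mulVec l) *
      exp (-(2 * Real.pi * I) * evalForm (Matrix.vecMul l (Matrix.vecMulVec a a)) z) *
        theta τ (evalForm a z)
  rw [h1, h1, h2, h3, theta_add_lattice]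

theorem prodForm_add_left (a b c : ι → ℤ) : prodForm (a + b) c = prodForm a c + prodForm b c := by
  ext i j; simp [prodForm, Matrix.vecMulVec_apply]; ring

theorem prodForm_add_right (a b c : ι → ℤ) : prodForm a (b + c) = prodForm a b + prodForm a c := by
  ext i j; simp [prodForm, Matrix.vecMulVec_apply]; ring

theorem prodForm_neg_left (a b : ι → ℤ) : prodForm (-a) b = -prodForm a b := by
  ext i j; simp [prodForm, Matrix.vecMulVec_apply]; ring

theorem prodForm_neg_right (a b : ι → ℤ) : prodForm a (-b) = -prodForm a b := by
  ext i j; simp [prodForm, Matrix.vecMulVec_apply]; ring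

theorem prodForm_sub_left (a b c : ι → ℤ) : prodForm (a - b) c = prodForm a c - prodForm b c := by
  rw [sub_eq_add_neg, prodForm_add_left, prodForm_neg_left, sub_eq_add_neg]

theorem prodForm_sub_right (a b c : ι → ℤ) : prodForm a (b - c) = prodForm a b - prodForm a c := by
  rw [sub_eq_add_neg, prodForm_add_right, prodForm_neg_right, sub_eq_add_neg]

theorem prodForm_sum_right {α : Type*} (s : Finset α) (a : ι → ℤ) (b : α → ι → ℤ) :
    prodForm a (∑ i ∈ s, b i) = ∑ i ∈ s, prodForm a (b i) :=
  map_sum (AddMonoidHom.mk' (prodForm a) (prodForm_add_right a)) b s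

theorem prodForm_submatrix (a b : ι → ℤ) (e : Equiv.Perm ι) :
    (prodForm a b).submatrix e.symm e.symm = prodForm (permForm e a) (permForm e b) := rfl

/-- A nonzero linear form can be cancelled from a product of forms; this makes the admissible
parameter unique. -/
theorem prodForm_right_injective {a b c : ι → ℤ} (ha : a ≠ 0) (h : prodForm a b = prodForm a c) :
    b = c := by
  obtain ⟨i, hi⟩ := Function.ne_iff.mp ha
  rw [Pi.zero_apply] at hi
  have h1 : ∀ j, a i * (b j - c j) + a j * (b i - c i) = 0 := fun j ↦ by
    have := congrFun (congrFun h i) j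
    simp only [prodForm, Matrix.add_apply, Matrix.vecMulVec_apply] at this
    linear_combination this
  have h2 : b i - c i = 0 := by
    have := h1 i
    rw [← two_mul] at this
    simpa [hi] using this
  funext j
  have := h1 j
  rw [h2, mul_zero, add_zero] at this
  exact sub_eq_zero.mp ((mul_eq_zero.mp this).resolve_left hi)

/-- The theta factors contribute `½(a + b)² - ½a² - ½b² = ab`. -/
theorem hasType_delta (τ : ℍ) (a b : ι → ℤ) : HasType τ (delta τ a b) (prodForm a b) := by
  have h := ((hasType_algebraMap τ (deriv (theta τ) 0)).mul (hasType_thetaForm τ (a + b))).mul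
    ((hasType_thetaForm τ a).mul (hasType_thetaForm τ b)).inv
  rw [← div_eq_mul_inv] at h
  have e : prodForm a b = 0 + Matrix.vecMulVec (a + b) (a + b) +
      -(Matrix.vecMulVec a a + Matrix.vecMulVec b b) := by
    ext i j
    simp [prodForm, Matrix.vecMulVec_apply]
    ring
  rw [e]
  exact h

theorem HasType.permute {τ : ℍ} {f : Mero ι} {A : Matrix ι ι ℤ} (hf : HasType τ f A)
    (e : Equiv.Perm ι) : HasType τ (permute e f) (A.submatrix e.symm e.symm) := by
  refine ⟨hf.1.submatrix _, fun k l ↦ ?_⟩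
  rw [translate_permute]
  have h := hf.2 (k ∘ e) (l ∘ e)
  have h1 : ∀ v : ι → ℤ, (v ∘ e) ⬝ᵥ A.mulVec (v ∘ e) =
      v ⬝ᵥ (A.submatrix e.symm e.symm).mulVec v := fun v ↦ by
    rw [Matrix.submatrix_mulVec_equiv, Equiv.symm_symm, dotProduct_comp_equiv_symm]
  have h2 : ∀ z : ι → ℂ, evalForm (Matrix.vecMul (l ∘ e) A) (z ∘ e) =
      evalForm (Matrix.vecMul l (A.submatrix e.symm e.symm)) z := fun z ↦ by
    rw [← evalForm_permForm, Matrix.submatrix_vecMul_equiv, Equiv.symm_symm]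
    rfl
  change EllLink.permute e (translate (fun i ↦ ((k ∘ e) i : ℂ) + ((l ∘ e) i : ℂ) * (τ : ℂ)) f) = _
  rw [h, Mero.map_mul]
  congr 1
  refine permute_entire _ _ _ fun z ↦ ?_
  change (-1) ^ ((k ∘ e) ⬝ᵥ A.mulVec (k ∘ e)) * (-exp (-(Real.pi * I * (τ : ℂ)))) ^
      ((l ∘ e) ⬝ᵥ A.mulVec (l ∘ e)) *
      exp (-(2 * Real.pi * I) * evalForm (Matrix.vecMul (l ∘ e) A) (z ∘ e)) = _
  rw [h1, h1, h2]
  rfl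

/-- A nonzero pure function has only one type. -/
theorem HasType.unique {τ : ℍ} {f : Mero ι} (hf : f ≠ 0) {A B : Matrix ι ι ℤ}
    (hA : HasType τ f A) (hB : HasType τ f B) : A = B := by
  classical
  have key : ∀ l : ι → ℤ, Matrix.vecMul l A = Matrix.vecMul l B := by
    intro l
    have h := (hA.2 0 l).symm.trans (hB.2 0 l)
    have h := IsFractionRing.injective (Entire ι) (Mero ι) (mul_right_cancel₀ hf h)
    have hz : ∀ z : ι → ℂ, (-exp (-(Real.pi * I * (τ : ℂ)))) ^ (l ⬝ᵥ A.mulVec l) *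
        exp (-(2 * Real.pi * I) * evalForm (Matrix.vecMul l A) z) =
        (-exp (-(Real.pi * I * (τ : ℂ)))) ^ (l ⬝ᵥ B.mulVec l) *
        exp (-(2 * Real.pi * I) * evalForm (Matrix.vecMul l B) z) := fun z ↦ by
      simpa [automorphyFactor] using congrFun (congrArg Subtype.val h) z
    have h0 := hz 0
    have hev : ∀ a : ι → ℤ, evalForm a 0 = 0 := fun a ↦ by simp [evalForm]
    rw [hev, hev, mul_zero, exp_zero, mul_one, mul_one] at h0
    rw [h0] at hz
    have hne : (-exp (-(Real.pi * I * (τ : ℂ)))) ^ (l ⬝ᵥ B.mulVec l) ≠ 0 :=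
      zpow_ne_zero _ (neg_ne_zero.mpr (exp_ne_zero _))
    funext i
    -- At `√-1` times the `i`-th basis vector the exponential is the real number `e^{2πa_i}`, which
    -- determines the integer `a_i`.
    have h1 := mul_left_cancel₀ hne (hz (Pi.single i I))
    have hev : ∀ a : ι → ℤ, -(2 * Real.pi * I) * evalForm a (Pi.single i I) =
        ((2 * Real.pi * a i : ℝ) : ℂ) := fun a ↦ by
      rw [evalForm, Finset.sum_eq_single i (fun j _ hj ↦ by simp [hj]) (by simp),
        Pi.single_eq_same]
      push_cast
      linear_combination -(2 * Real.pi * (a i : ℂ)) * I_mul_I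
    rw [hev, hev, ← ofReal_exp, ← ofReal_exp] at h1
    have h2 := mul_left_cancel₀ (by positivity) (Real.exp_injective (ofReal_injective h1))
    exact_mod_cast h2
  refine Matrix.ext fun i j ↦ ?_
  have := congrFun (key (Pi.single i 1)) j
  simpa using this

end Types

/-! ### Quadratic, commutation and braid relations for `dem` and `demBar`. -/

section Operations

variable {m r : ℕ}

/-! ### Relations between the elliptic Demazure operations -/

theorem permForm_coord (e : Equiv.Perm (Var m r)) (v : Var m r) :
    permForm e (coord v) = coord (e v) := by
  funext w
  rw [permForm_apply]
  by_cases h : w = e v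
  · subst h; simp [coord]
  · have h' : e.symm w ≠ v := fun h' ↦ h (by rw [← h', Equiv.apply_symm_apply])
    simp [coord, h, h']

/-- The linear form does not involve the variables `x_k`. -/
def XFree (a : Var m r → ℤ) : Prop := ∀ k, a (.x k) = 0

theorem XFree.add {a b : Var m r → ℤ} (ha : XFree a) (hb : XFree b) : XFree (a + b) :=
  fun k ↦ by rw [Pi.add_apply, ha k, hb k, add_zero]

theorem XFree.neg {a : Var m r → ℤ} (ha : XFree a) : XFree (-a) :=
  fun k ↦ by rw [Pi.neg_apply, ha k, neg_zero]

theorem XFree.sub {a b : Var m r → ℤ} (ha : XFree a) (hb : XFree b) : XFree (a - b) :=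
  fun k ↦ by rw [Pi.sub_apply, ha k, hb k, sub_zero]

theorem XFree.zsmul {a : Var m r → ℤ} (ha : XFree a) (c : ℤ) : XFree (c • a) :=
  fun k ↦ by rw [Pi.smul_apply, ha k, smul_zero]

theorem xFree_h : XFree (coord (.h : Var m r)) := fun k ↦ by simp [coord]

theorem xFree_mu (j : Fin r) : XFree (coord (.mu j : Var m r)) := fun k ↦ by simp [coord]

theorem simpleVar_x (i : Fin (m - 1)) (k : Fin m) :
    (simpleVar i : Equiv.Perm (Var m r)) (.x k) = .x (simple i k) := by
  simp only [simpleVar, simple, Equiv.swap_apply_def, Var.x.injEq]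
  split_ifs <;> rfl

theorem simpleVar_of_ne_x (i : Fin (m - 1)) {v : Var m r} (hv : ∀ k, v ≠ .x k) :
    simpleVar i v = v :=
  Equiv.swap_apply_of_ne_of_ne (hv _) (hv _)

theorem simpleVar_symm (i : Fin (m - 1)) :
    (simpleVar i : Equiv.Perm (Var m r)).symm = simpleVar i := Equiv.symm_swap _ _

theorem permForm_simpleVar_of_xFree (i : Fin (m - 1)) {a : Var m r → ℤ} (ha : XFree a) :
    permForm (simpleVar i) a = a := by
  funext v
  rw [permForm_apply, simpleVar_symm]
  by_cases hv : ∃ k, v = .x k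
  · obtain ⟨k, rfl⟩ := hv
    rw [simpleVar_x, ha, ha]
  · push Not at hv
    rw [simpleVar_of_ne_x i hv]

theorem permForm_simpleVar_coord_x (i : Fin (m - 1)) (k : Fin m) :
    permForm (simpleVar i) (coord (.x k : Var m r)) = coord (.x (simple i k)) := by
  rw [permForm_coord, simpleVar_x]

theorem simple_pos (i : Fin (m - 1)) : simple i (pos i) = posSucc i := Equiv.swap_apply_left _ _

theorem simple_posSucc (i : Fin (m - 1)) : simple i (posSucc i) = pos i :=
  Equiv.swap_apply_right _ _

theorem simple_of_ne (i : Fin (m - 1)) {k : Fin m} (h1 : (k : ℕ) ≠ i) (h2 : (k : ℕ) ≠ i + 1) :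
    simple i k = k :=
  Equiv.swap_apply_of_ne_of_ne (fun h ↦ h1 (congrArg Fin.val h)) fun h ↦ h2 (congrArg Fin.val h)

theorem permForm_simpleVar_root (i : Fin (m - 1)) :
    permForm (simpleVar i) (root i : Var m r → ℤ) = -root i := by
  rw [root, map_sub, permForm_simpleVar_coord_x, permForm_simpleVar_coord_x, simple_pos,
    simple_posSucc, neg_sub]

theorem permForm_simpleVar_root_of_far {i j : Fin (m - 1)} (h : (i : ℕ) + 2 ≤ j ∨ (j : ℕ) + 2 ≤ i) :
    permForm (simpleVar i) (root j : Var m r → ℤ) = root j := by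
  rw [root, map_sub, permForm_simpleVar_coord_x, permForm_simpleVar_coord_x,
    simple_of_ne i, simple_of_ne i] <;> simp only [pos, posSucc] <;> omega

theorem posSucc_eq_pos {i j : Fin (m - 1)} (h : (i : ℕ) + 1 = j) : posSucc i = pos j :=
  Fin.ext h

theorem permForm_simpleVar_root_succ {i j : Fin (m - 1)} (h : (i : ℕ) + 1 = j) :
    permForm (simpleVar i) (root j : Var m r → ℤ) = root i + root j := by
  rw [root, root, map_sub, permForm_simpleVar_coord_x, permForm_simpleVar_coord_x,
    ← posSucc_eq_pos h, simple_posSucc, simple_of_ne i]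
  · abel
  all_goals simp only [posSucc]; omega

theorem permForm_simpleVar_root_pred {i j : Fin (m - 1)} (h : (i : ℕ) + 1 = j) :
    permForm (simpleVar j) (root i : Var m r → ℤ) = root i + root j := by
  rw [root, root, map_sub, permForm_simpleVar_coord_x, permForm_simpleVar_coord_x,
    posSucc_eq_pos h, simple_pos, simple_of_ne j]
  · abel
  all_goals simp only [pos]; omega

theorem root_ne_zero (i : Fin (m - 1)) : (root i : Var m r → ℤ) ≠ 0 := fun h ↦ by
  have := congrFun h (.x (pos i))
  simp [root, coord, pos, posSucc] at this

theorem root_add_root_ne_zero {i j : Fin (m - 1)} (h : (i : ℕ) + 1 = j) :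
    (root i + root j : Var m r → ℤ) ≠ 0 := fun h0 ↦ by
  have := congrFun h0 (.x (pos i))
  have h1 : i ≠ j := fun h1 ↦ by rw [h1] at h; omega
  have h2 : (i : ℕ) ≠ j + 1 := by omega
  have h3 : (i : ℕ) ≠ j := by omega
  simp [root, coord, pos, posSucc  , h2, h3] at this

theorem coord_ne_zero (v : Var m r) : coord v ≠ 0 := fun h ↦ by
  have := congrFun h v
  simp [coord] at this

/-- The action of `s_i` on functions. -/
noncomputable def simpleAct (i : Fin (m - 1)) (f : Mero (Var m r)) : Mero (Var m r) :=
  permute (simpleVar i) f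

theorem simpleAct_add (i : Fin (m - 1)) (f g : Mero (Var m r)) :
    simpleAct i (f + g) = simpleAct i f + simpleAct i g := Mero.map_add _ f g

theorem simpleAct_mul (i : Fin (m - 1)) (f g : Mero (Var m r)) :
    simpleAct i (f * g) = simpleAct i f * simpleAct i g := Mero.map_mul _ f g

theorem simpleAct_inv (i : Fin (m - 1)) (f : Mero (Var m r)) :
    simpleAct i f⁻¹ = (simpleAct i f)⁻¹ := Mero.map_inv _ f

theorem simpleAct_zero (i : Fin (m - 1)) : simpleAct i (0 : Mero (Var m r)) = 0 := Mero.map_zero _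

theorem simpleAct_delta (τ : ℍ) (i : Fin (m - 1)) (a b : Var m r → ℤ) :
    simpleAct i (delta τ a b) =
      delta τ (permForm (simpleVar i) a) (permForm (simpleVar i) b) := permute_delta τ _ a b

theorem dem_eq (τ : ℍ) (i : Fin (m - 1)) (ν : Var m r → ℤ) (f : Mero (Var m r)) :
    dem τ i ν f = delta τ (-root i) ν * f + delta τ (root i) (coord .h) * simpleAct i f := rfl

theorem simpleAct_simpleAct (i : Fin (m - 1)) (f : Mero (Var m r)) :
    simpleAct i (simpleAct i f) = f := by
  have h := permute_mul (simpleVar i) (simpleVar i) f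
  rw [simpleVar, Equiv.swap_mul_self, permute_one] at h
  exact h.symm

theorem simpleAct_comm {i j : Fin (m - 1)} (h : (i : ℕ) + 2 ≤ j) (f : Mero (Var m r)) :
    simpleAct i (simpleAct j f) = simpleAct j (simpleAct i f) := by
  have key : (simpleVar i * simpleVar j : Equiv.Perm (Var m r)) = simpleVar j * simpleVar i := by
    refine (Equiv.Perm.disjoint_iff_disjoint_support.mpr ?_).commute
    rw [simpleVar, simpleVar, Equiv.Perm.support_swap, Equiv.Perm.support_swap]
    · simp only [Finset.disjoint_insert_left, Finset.disjoint_singleton_left, Finset.mem_insert,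
        Finset.mem_singleton, Var.x.injEq, pos, posSucc, Fin.mk.injEq]
      omega
    all_goals simp [pos, posSucc]
  have e := permute_mul (simpleVar i) (simpleVar j) f
  rw [key] at e
  exact e.symm.trans (permute_mul (simpleVar j) (simpleVar i) f)

theorem simpleAct_braid {i j : Fin (m - 1)} (h : (i : ℕ) + 1 = j) (f : Mero (Var m r)) :
    simpleAct i (simpleAct j (simpleAct i f)) = simpleAct j (simpleAct i (simpleAct j f)) := by
  have key : (simpleVar i * (simpleVar j * simpleVar i) : Equiv.Perm (Var m r)) =
      simpleVar j * (simpleVar i * simpleVar j) := by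
    rw [simpleVar, simpleVar, ← posSucc_eq_pos h]
    have h1 : (Var.x (pos i) : Var m r) ≠ .x (posSucc i) := by simp [pos, posSucc]
    have h2 : (Var.x (posSucc i) : Var m r) ≠ .x (posSucc j) := by
      simp only [posSucc, ne_eq, Var.x.injEq, Fin.mk.injEq]; omega
    have h3 : (Var.x (pos i) : Var m r) ≠ .x (posSucc j) := by
      simp only [pos, posSucc, ne_eq, Var.x.injEq, Fin.mk.injEq]; omega
    rw [← mul_assoc, ← mul_assoc, Equiv.swap_mul_swap_mul_swap h1 h3,
      Equiv.swap_comm (Var.x (pos i)),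
      Equiv.swap_comm (Var.x (posSucc i)) (Var.x (posSucc j)),
      Equiv.swap_mul_swap_mul_swap h2.symm h3.symm, Equiv.swap_comm]
  have e := permute_mul (simpleVar i) (simpleVar j * simpleVar i) f
  have e' := permute_mul (simpleVar j) (simpleVar i * simpleVar j) f
  rw [permute_mul (simpleVar j)] at e
  rw [permute_mul (simpleVar i)] at e'
  rw [key] at e
  exact e.symm.trans e'

theorem dem_zero (τ : ℍ) (i : Fin (m - 1)) (ν : Var m r → ℤ) : dem τ i ν 0 = 0 := by
  rw [dem_eq, simpleAct_zero, mul_zero, mul_zero, add_zero]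

theorem dem_mul (τ : ℍ) (i : Fin (m - 1)) (ν : Var m r → ℤ) {c f : Mero (Var m r)}
    (hc : simpleAct i c = c) : dem τ i ν (c * f) = c * dem τ i ν f := by
  rw [dem_eq, dem_eq, simpleAct_mul, hc]
  ring

theorem simpleAct_dem (τ : ℍ) (i j : Fin (m - 1)) {ν : Var m r → ℤ} (hν : XFree ν)
    (f : Mero (Var m r)) : simpleAct i (dem τ j ν f) =
      delta τ (-permForm (simpleVar i) (root j)) ν * simpleAct i f +
      delta τ (permForm (simpleVar i) (root j)) (coord .h) * simpleAct i (simpleAct j f) := by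
  rw [dem_eq, simpleAct_add, simpleAct_mul, simpleAct_mul, simpleAct_delta, simpleAct_delta,
    map_neg, permForm_simpleVar_of_xFree i hν, permForm_simpleVar_of_xFree i xFree_h]

/-- The coefficient of `s_i f` is a multiple of `δ(-a, -ν) + δ(a, ν) = 0`, where `a` is the root,
and that of `f` is a difference of `℘`-values in which `℘(a)` drops out. -/
theorem dem_neg_dem (τ : ℍ) (i : Fin (m - 1)) {ν : Var m r → ℤ} (hν : XFree ν) (h0 : ν ≠ 0)
    (f : Mero (Var m r)) :
    dem τ i (-ν) (dem τ i ν f) = delta τ ν (coord .h) * delta τ (-ν) (coord .h) * f := by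
  rw [← delta_mul_delta_neg_add τ (root_ne_zero i) h0 (coord_ne_zero .h), dem_eq,
    simpleAct_dem τ i i hν, permForm_simpleVar_root, neg_neg, simpleAct_simpleAct, dem_eq,
    delta_neg_neg]
  ring

theorem simpleAct_delta_of_xFree (τ : ℍ) (i : Fin (m - 1)) {a b : Var m r → ℤ} (ha : XFree a)
    (hb : XFree b) : simpleAct i (delta τ a b) = delta τ a b := by
  rw [simpleAct_delta, permForm_simpleVar_of_xFree i ha, permForm_simpleVar_of_xFree i hb]

theorem demBar_zero (τ : ℍ) (i : Fin (m - 1)) (ν : Var m r → ℤ) : demBar τ i ν 0 = 0 := by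
  rw [demBar, dem_zero, mul_zero]

theorem dem_demBar (τ : ℍ) (i j : Fin (m - 1)) {ν ν' : Var m r → ℤ} (hν' : XFree ν')
    (f : Mero (Var m r)) :
    dem τ i ν (demBar τ j ν' f) = (delta τ ν' (coord .h))⁻¹ * dem τ i ν (dem τ j ν' f) :=
  dem_mul τ i ν (by rw [simpleAct_inv, simpleAct_delta_of_xFree τ i hν' xFree_h])

theorem demBar_neg_demBar (τ : ℍ) (i : Fin (m - 1)) {ν : Var m r → ℤ} (hν : XFree ν)
    (h0 : ν ≠ 0) (h1 : ν + coord .h ≠ 0) (h2 : -ν + coord .h ≠ 0) (f : Mero (Var m r)) :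
    demBar τ i (-ν) (demBar τ i ν f) = f := by
  have e1 := delta_ne_zero τ h0 (coord_ne_zero .h) h1
  have e2 := delta_ne_zero τ (neg_ne_zero.mpr h0) (coord_ne_zero .h) h2
  rw [demBar, dem_demBar τ i i hν, dem_neg_dem τ i hν h0]
  field_simp

theorem dem_comm (τ : ℍ) {i j : Fin (m - 1)} (h : (i : ℕ) + 2 ≤ j) {ν ν' : Var m r → ℤ}
    (hν : XFree ν) (hν' : XFree ν') (f : Mero (Var m r)) :
    dem τ i ν (dem τ j ν' f) = dem τ j ν' (dem τ i ν f) := by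
  rw [dem_eq, simpleAct_dem τ i j hν', permForm_simpleVar_root_of_far (.inl h),
    simpleAct_comm h, dem_eq, dem_eq τ j, simpleAct_dem τ j i hν,
    permForm_simpleVar_root_of_far (.inr h), dem_eq]
  ring

theorem demBar_comm (τ : ℍ) {i j : Fin (m - 1)} (h : (i : ℕ) + 2 ≤ j) {ν ν' : Var m r → ℤ}
    (hν : XFree ν) (hν' : XFree ν') (f : Mero (Var m r)) :
    demBar τ i ν (demBar τ j ν' f) = demBar τ j ν' (demBar τ i ν f) := by
  rw [demBar, dem_demBar τ i j hν', dem_comm τ h hν hν', demBar, dem_demBar τ j i hν]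
  ring

/-- Both sides are expanded in the six images of `f` under the group generated by `s_i` and `s_j`.
The coefficient of `f` is `delta_braid`, those of `s_i f` and `s_j f` are Fay's identity, and the
remaining three agree term by term. -/
theorem dem_braid (τ : ℍ) {i j : Fin (m - 1)} (h : (i : ℕ) + 1 = j) {p q : Var m r → ℤ}
    (hp : XFree p) (hq : XFree q) (hp0 : p ≠ 0) (hq0 : q ≠ 0) (hpq0 : p + q ≠ 0)
    (f : Mero (Var m r)) :
    dem τ i q (dem τ j (p + q) (dem τ i p f)) = dem τ j p (dem τ i (p + q) (dem τ j q f)) := by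
  have hpq := hp.add hq
  have ha : -(root i : Var m r → ℤ) ≠ 0 := neg_ne_zero.mpr (root_ne_zero i)
  have hb : -(root j : Var m r → ℤ) ≠ 0 := neg_ne_zero.mpr (root_ne_zero j)
  have hab : -(root i + root j : Var m r → ℤ) ≠ 0 := neg_ne_zero.mpr (root_add_root_ne_zero h)
  have e1 := permForm_simpleVar_root (m := m) (r := r) i
  have e2 := permForm_simpleVar_root (m := m) (r := r) j
  have e3 := permForm_simpleVar_root_succ (r := r) h
  have e4 := permForm_simpleVar_root_pred (r := r) h
  have e5 : permForm (simpleVar i) (root i + root j : Var m r → ℤ) = root j := by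
    rw [map_add, e1, e3]; abel
  have e6 : permForm (simpleVar j) (root i + root j : Var m r → ℤ) = root i := by
    rw [map_add, e2, e4]; abel
  set a : Var m r → ℤ := root i
  set b : Var m r → ℤ := root j
  have hbr := delta_braid τ ha hb (by rwa [← neg_add]) hp0 hq0 hpq0 (coord_ne_zero .h)
  have f1 := delta_fay τ hb hab (by rwa [show -b - -(a + b) = -(-a) by abel, neg_ne_zero]) hp0 hq0
    hpq0
  have f2 := delta_fay τ ha hab (by rwa [show -a - -(a + b) = -(-b) by abel, neg_ne_zero]) hq0 hp0
    (by rwa [add_comm])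
  rw [neg_neg, neg_neg, ← neg_add] at hbr
  rw [show -(a + b) - -b = -a by abel, show -b - -(a + b) = a by abel] at f1
  rw [show -(a + b) - -a = -b by abel, show -a - -(a + b) = b by abel, add_comm q p] at f2
  have hbraid := simpleAct_braid h f
  have g1 : ∀ ν f, dem τ i ν f = delta τ (-a) ν * f +
      delta τ a (coord .h) * simpleAct i f := fun _ _ ↦ rfl
  have g2 : ∀ ν f, dem τ j ν f = delta τ (-b) ν * f +
      delta τ b (coord .h) * simpleAct j f := fun _ _ ↦ rfl
  have hh := permForm_simpleVar_of_xFree i (xFree_h (m := m) (r := r))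
  have hh' := permForm_simpleVar_of_xFree j (xFree_h (m := m) (r := r))
  simp only [g1, g2, simpleAct_add, simpleAct_mul, simpleAct_delta, map_neg, e1, e2, e3, e4, e5, e6,
    permForm_simpleVar_of_xFree i hp, permForm_simpleVar_of_xFree i hq,
    permForm_simpleVar_of_xFree i hpq, permForm_simpleVar_of_xFree j hp,
    permForm_simpleVar_of_xFree j hq, permForm_simpleVar_of_xFree j hpq, hh, hh',
    simpleAct_simpleAct, neg_neg, hbraid]
  linear_combination f * hbr - delta τ a (coord .h) * simpleAct i f * f1 +
    delta τ b (coord .h) * simpleAct j f * f2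

theorem demBar_braid (τ : ℍ) {i j : Fin (m - 1)} (h : (i : ℕ) + 1 = j) {p q : Var m r → ℤ}
    (hp : XFree p) (hq : XFree q) (hp0 : p ≠ 0) (hq0 : q ≠ 0) (hpq0 : p + q ≠ 0)
    (f : Mero (Var m r)) :
    demBar τ i q (demBar τ j (p + q) (demBar τ i p f)) =
      demBar τ j p (demBar τ i (p + q) (demBar τ j q f)) := by
  have hpq := hp.add hq
  have inv : ∀ (k : Fin (m - 1)) {ν : Var m r → ℤ}, XFree ν →
      simpleAct k (delta τ ν (coord .h))⁻¹ = (delta τ ν (coord .h))⁻¹ := fun k ν hν ↦ by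
    rw [simpleAct_inv, simpleAct_delta_of_xFree τ k hν xFree_h]
  simp only [demBar]
  rw [dem_mul τ j _ (inv j hp), dem_mul τ i _ (inv i hpq), dem_mul τ i _ (inv i hp),
    dem_mul τ i _ (inv i hq), dem_mul τ j _ (inv j hpq), dem_mul τ j _ (inv j hq),
    dem_braid τ h hp hq hp0 hq0 hpq0]
  ring

end Operations

/-! ### Descents of permutations, exchange, and path independence. -/

section Combinatorics

variable {m : ℕ}

/-! ### Descents and words -/

/-- `i` is a left descent of `w`. -/
def IsDescent (i : Fin (m - 1)) (w : Equiv.Perm (Fin m)) : Prop :=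
  w⁻¹ (posSucc i) < w⁻¹ (pos i)

theorem simple_mul_self (i : Fin (m - 1)) : simple i * simple i = 1 := Equiv.swap_mul_self _ _

theorem simple_mul_simple_mul (i : Fin (m - 1)) (w : Equiv.Perm (Fin m)) :
    simple i * (simple i * w) = w := by rw [← mul_assoc, simple_mul_self, one_mul]

theorem simple_inv (i : Fin (m - 1)) : (simple i)⁻¹ = simple i := Equiv.swap_inv _ _

theorem simple_mul_inv_apply (i : Fin (m - 1)) (w : Equiv.Perm (Fin m)) (k : Fin m) :
    (simple i * w)⁻¹ k = w⁻¹ (simple i k) := by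
  rw [mul_inv_rev, simple_inv, Equiv.Perm.mul_apply]

theorem pos_ne_posSucc (i : Fin (m - 1)) : pos i ≠ posSucc i := fun h ↦ by
  simpa [pos, posSucc] using congrArg Fin.val h

theorem not_isDescent_iff (i : Fin (m - 1)) (w : Equiv.Perm (Fin m)) :
    ¬IsDescent i w ↔ IsDescent i (simple i * w) := by
  rw [IsDescent, IsDescent, simple_mul_inv_apply, simple_mul_inv_apply, simple_pos, simple_posSucc,
    not_lt]
  exact ⟨fun h ↦ lt_of_le_of_ne h fun h' ↦ pos_ne_posSucc i (w⁻¹.injective h'), le_of_lt⟩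

theorem simple_comm {i j : Fin (m - 1)} (h : (i : ℕ) + 2 ≤ j) :
    simple i * simple j = simple j * simple i := by
  refine (Equiv.Perm.disjoint_iff_disjoint_support.mpr ?_).commute
  rw [simple, simple, Equiv.Perm.support_swap (pos_ne_posSucc i),
    Equiv.Perm.support_swap (pos_ne_posSucc j)]
  simp only [Finset.disjoint_insert_left, Finset.disjoint_singleton_left, Finset.mem_insert,
    Finset.mem_singleton, pos, posSucc, Fin.mk.injEq]
  omega

theorem simple_braid {i j : Fin (m - 1)} (h : (i : ℕ) + 1 = j) :
    simple i * simple j * simple i = simple j * simple i * simple j := by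
  have h3 : pos i ≠ posSucc j := fun h' ↦ by
    have := congrArg Fin.val h'
    simp only [pos, posSucc] at this; omega
  have h2 : posSucc i ≠ posSucc j := by rw [posSucc_eq_pos h]; exact pos_ne_posSucc j
  rw [simple, simple, ← posSucc_eq_pos h, Equiv.swap_mul_swap_mul_swap (pos_ne_posSucc i) h3,
    Equiv.swap_comm (pos i), Equiv.swap_comm (posSucc i) (posSucc j),
    Equiv.swap_mul_swap_mul_swap h2.symm h3.symm, Equiv.swap_comm]

/-- A measure that decreases along descents. -/
def descentMeasure (w : Equiv.Perm (Fin m)) : ℕ := ∑ k : Fin m, (k : ℕ) * (m - w⁻¹ k)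

theorem descentMeasure_lt {i : Fin (m - 1)} {w : Equiv.Perm (Fin m)} (h : IsDescent i w) :
    descentMeasure (simple i * w) < descentMeasure w := by
  have hne := pos_ne_posSucc i
  have split : ∀ g : Fin m → ℕ, ∑ k, g k =
      g (pos i) + g (posSucc i) + ∑ k ∈ {pos i, posSucc i}ᶜ, g k := fun g ↦ by
    rw [← Finset.sum_pair hne, Finset.sum_add_sum_compl]
  rw [descentMeasure, descentMeasure, split, split]
  have hrest : ∑ k ∈ ({pos i, posSucc i} : Finset (Fin m))ᶜ, (k : ℕ) * (m - (simple i * w)⁻¹ k) =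
      ∑ k ∈ ({pos i, posSucc i} : Finset (Fin m))ᶜ, (k : ℕ) * (m - w⁻¹ k) := by
    refine Finset.sum_congr rfl fun k hk ↦ ?_
    simp only [Finset.mem_compl, Finset.mem_insert, Finset.mem_singleton, not_or] at hk
    rw [simple_mul_inv_apply, simple, Equiv.swap_apply_of_ne_of_ne hk.1 hk.2]
  rw [hrest, simple_mul_inv_apply, simple_mul_inv_apply, simple_pos, simple_posSucc]
  have h1 : ((w⁻¹ (posSucc i) : Fin m) : ℕ) < w⁻¹ (pos i) := h
  have h2 := (w⁻¹ (pos i)).isLt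
  have e1 : ((pos i : Fin m) : ℕ) = i := rfl
  have e2 : ((posSucc i : Fin m) : ℕ) = i + 1 := rfl
  -- Exchanging the two factors lowers the sum by exactly `d + 1`; the natural subtractions are not
  -- truncated since the values are below `m`.
  obtain ⟨d, hd⟩ : ∃ d, m - (w⁻¹ (posSucc i) : ℕ) = m - (w⁻¹ (pos i) : ℕ) + (d + 1) :=
    ⟨w⁻¹ (pos i) - w⁻¹ (posSucc i) - 1, by omega⟩
  rw [hd, e1, e2]
  nlinarith

/-- A permutation without descents has an increasing inverse, hence is the identity; all others are
reduced along a descent. -/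
theorem perm_descent_induction {P : Equiv.Perm (Fin m) → Prop} (h1 : P 1)
    (hs : ∀ w i, IsDescent i w → P (simple i * w) → P w) (w : Equiv.Perm (Fin m)) : P w := by
  induction hn : descentMeasure w using Nat.strong_induction_on generalizing w with
  | _ n ih =>
    by_cases h : ∃ i, IsDescent i w
    · obtain ⟨i, hi⟩ := h
      exact hs w i hi (ih _ (hn ▸ descentMeasure_lt hi) _ rfl)
    · push Not at h
      have hmono : StrictMono (w⁻¹ : Equiv.Perm (Fin m)) := by
        cases m with
        | zero => exact fun a ↦ a.elim0
        | succ n =>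
          refine Fin.strictMono_iff_lt_succ.mpr fun i ↦ ?_
          have := h i
          rw [IsDescent, not_lt] at this
          exact lt_of_le_of_ne this fun h' ↦ pos_ne_posSucc (m := n + 1) i (w⁻¹.injective h')
      have : (w⁻¹ : Equiv.Perm (Fin m)) = 1 := Equiv.ext fun k ↦
        congrFun ((hmono.range_inj strictMono_id).mp (by simp)) k
      rw [inv_eq_one] at this
      rwa [this]

theorem wordProd_cons (i : Fin (m - 1)) (s : List (Fin (m - 1))) :
    wordProd (i :: s) = simple i * wordProd s := by
  simp [wordProd]

theorem exists_wordProd_eq (w : Equiv.Perm (Fin m)) : ∃ s, wordProd s = w := by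
  induction w using perm_descent_induction with
  | h1 => exact ⟨[], rfl⟩
  | hs w i _ ih =>
    obtain ⟨s, hs⟩ := ih
    exact ⟨i :: s, by rw [wordProd_cons, hs, simple_mul_simple_mul]⟩

theorem exists_isReducedWord (w : Equiv.Perm (Fin m)) : ∃ s, IsReducedWord s w := by
  classical
  have h : ∃ n s, wordProd s = w ∧ s.length = n :=
    (exists_wordProd_eq w).elim fun s hs ↦ ⟨_, s, hs, rfl⟩
  obtain ⟨s, hs, hn⟩ := Nat.find_spec h
  exact ⟨s, hs, fun s' hs' ↦ hn ▸ Nat.find_min' h ⟨s', hs', rfl⟩⟩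

theorem simple_lt_simple {i : Fin (m - 1)} {a b : Fin m} (hab : a < b)
    (h : ¬(a = pos i ∧ b = posSucc i)) : simple i a < simple i b := by
  simp only [simple, Equiv.swap_apply_def, pos, posSucc, Fin.ext_iff, Fin.lt_def] at *
  split_ifs <;> (try simp only) <;> omega

/-- The exchange property. -/
theorem exists_shorter_word (s : List (Fin (m - 1))) {a b : Fin m} (hab : a < b)
    (h : (wordProd s)⁻¹ b < (wordProd s)⁻¹ a) :
    ∃ s', wordProd s' = Equiv.swap a b * wordProd s ∧ s'.length < s.length := by
  induction s generalizing a b with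
  | nil => exact (lt_asymm hab (by simpa [wordProd] using h)).elim
  | cons j t ih =>
    rw [wordProd_cons, simple_mul_inv_apply, simple_mul_inv_apply] at h
    -- Either the transposition is the first letter, which gets deleted, or it is conjugated past
    -- that letter, which keeps the order of the pair it exchanges.
    by_cases hj : a = pos j ∧ b = posSucc j
    · refine ⟨t, ?_, by simp⟩
      rw [hj.1, hj.2, wordProd_cons]
      exact (simple_mul_simple_mul j _).symm
    · obtain ⟨t', ht', hl⟩ := ih (simple_lt_simple hab hj) h
      refine ⟨j :: t', ?_, by simpa using hl⟩
      rw [wordProd_cons, wordProd_cons, ht', ← mul_assoc, ← mul_assoc, Equiv.mul_swap_eq_swap_mul]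
      congr 2
      simp [simple]

theorem IsReducedWord.tail {i : Fin (m - 1)} {s : List (Fin (m - 1))} {w : Equiv.Perm (Fin m)}
    (h : IsReducedWord (i :: s) w) :
    IsReducedWord s (simple i * w) ∧ IsDescent i w := by
  obtain ⟨rfl, h⟩ := h
  rw [wordProd_cons] at h ⊢
  rw [simple_mul_simple_mul, ← not_isDescent_iff]
  refine ⟨⟨rfl, fun s' hs' ↦ ?_⟩, fun hd ↦ ?_⟩
  · have := h (i :: s') (by rw [wordProd_cons, hs'])
    simpa using this
  -- If `i` were a descent of the tail, exchange would give a word for the whole product shorter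
  -- than the tail.
  · obtain ⟨s', hs', hl⟩ := exists_shorter_word s (Fin.lt_def.mpr (Nat.lt_succ_self _) :
      pos i < posSucc i) hd
    have := h s' hs'
    simp only [List.length_cons] at this
    omega

/-! ### Compositions along reduced words -/

section Descend

variable {X : Type*}

open Classical in
/-- The composition of the operations `op` along a chain of descents from `w` to `1`. -/
noncomputable def descend (op : Fin (m - 1) → Equiv.Perm (Fin m) → X → X) (f : X)
    (w : Equiv.Perm (Fin m)) : X :=
  if h : ∃ i, IsDescent i w then
    op h.choose (simple h.choose * w) (descend op f (simple h.choose * w))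
  else f
termination_by descentMeasure w
decreasing_by exact descentMeasure_lt h.choose_spec

theorem descend_one (op : Fin (m - 1) → Equiv.Perm (Fin m) → X → X) (f : X) :
    descend op f 1 = f := by
  rw [descend, dif_neg]
  rintro ⟨i, hi⟩
  have : posSucc i < pos i := by simpa [IsDescent] using hi
  simp [pos, posSucc] at this

/-- If the operations satisfy the braid relations, the composition does not depend on the chain. -/
theorem descend_eq (op : Fin (m - 1) → Equiv.Perm (Fin m) → X → X) (f : X)
    (hcomm : ∀ i j : Fin (m - 1), (i : ℕ) + 2 ≤ j → ∀ u g,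
      op i (simple j * u) (op j u g) = op j (simple i * u) (op i u g))
    (hbraid : ∀ i j : Fin (m - 1), (i : ℕ) + 1 = j → ∀ u g,
      op i (simple j * (simple i * u)) (op j (simple i * u) (op i u g)) =
        op j (simple i * (simple j * u)) (op i (simple j * u) (op j u g)))
    (w : Equiv.Perm (Fin m)) (i : Fin (m - 1)) (hi : IsDescent i w) :
    descend op f w = op i (simple i * w) (descend op f (simple i * w)) := by
  induction hn : descentMeasure w using Nat.strong_induction_on generalizing w i with
  | _ n ih =>
    subst hn
    -- Diamond argument: two distinct descents of `w` can be continued to a common smaller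
    -- permutation, through a square if they are distant and a hexagon if they are adjacent. The
    -- induction hypothesis lets `descend` follow either side.
    have key : ∀ i j : Fin (m - 1), i < j → IsDescent i w → IsDescent j w →
        op i (simple i * w) (descend op f (simple i * w)) =
          op j (simple j * w) (descend op f (simple j * w)) := by
      intro i j hij hi hj
      have hli := descentMeasure_lt hi
      have hlj := descentMeasure_lt hj
      rcases Nat.lt_or_ge ((i : ℕ) + 1) j with h2 | h2
      · have h2 : (i : ℕ) + 2 ≤ j := h2
        have hj' : IsDescent j (simple i * w) := by
          rw [IsDescent, simple_mul_inv_apply, simple_mul_inv_apply, simple_of_ne, simple_of_ne]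
          · exact hj
          all_goals simp only [pos, posSucc]; omega
        have hi' : IsDescent i (simple j * w) := by
          rw [IsDescent, simple_mul_inv_apply, simple_mul_inv_apply, simple_of_ne, simple_of_ne]
          · exact hi
          all_goals simp only [pos, posSucc]; omega
        rw [ih _ hli _ j hj' rfl, ih _ hlj _ i hi' rfl]
        have e : simple j * (simple i * w) = simple i * (simple j * w) := by
          rw [← mul_assoc, ← mul_assoc, simple_comm h2]
        have := hcomm i j h2 (simple j * (simple i * w)) (descend op f (simple j * (simple i * w)))
        rw [simple_mul_simple_mul] at this
        rw [this, e, simple_mul_simple_mul]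
      · have h1 : (i : ℕ) + 1 = j := by have := Fin.lt_def.mp hij; omega
        have hp := posSucc_eq_pos h1
        have sij : simple j (pos i) = pos i := by
          apply simple_of_ne <;> simp only [pos] <;> omega
        have sji : simple i (posSucc j) = posSucc j := by
          apply simple_of_ne <;> simp only [posSucc] <;> omega
        have hi0 : w⁻¹ (posSucc i) < w⁻¹ (pos i) := hi
        have hj0 : w⁻¹ (posSucc j) < w⁻¹ (pos j) := hj
        have d1 : IsDescent j (simple i * w) := by
          rw [IsDescent, simple_mul_inv_apply, simple_mul_inv_apply, sji, ← hp, simple_posSucc]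
          exact (hp ▸ hj0).trans hi0
        have d2 : IsDescent i (simple j * (simple i * w)) := by
          rw [IsDescent, simple_mul_inv_apply, simple_mul_inv_apply, simple_mul_inv_apply,
            simple_mul_inv_apply, sij, simple_pos, hp, simple_pos, sji]
          exact hj0
        have d3 : IsDescent i (simple j * w) := by
          rw [IsDescent, simple_mul_inv_apply, simple_mul_inv_apply, sij, hp, simple_pos]
          exact hj0.trans (hp ▸ hi0)
        have d4 : IsDescent j (simple i * (simple j * w)) := by
          rw [IsDescent, simple_mul_inv_apply, simple_mul_inv_apply, simple_mul_inv_apply,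
            simple_mul_inv_apply, sji, simple_posSucc, ← hp, simple_posSucc, sij]
          exact hi0
        rw [ih _ hli _ j d1 rfl, ih _ ((descentMeasure_lt d1).trans hli) _ i d2 rfl,
          ih _ hlj _ i d3 rfl, ih _ ((descentMeasure_lt d3).trans hlj) _ j d4 rfl]
        set u := simple i * (simple j * (simple i * w)) with hu
        have e : simple j * (simple i * (simple j * w)) = u := by
          rw [hu]
          simp only [← mul_assoc]
          rw [simple_braid h1]
        have := hbraid i j h1 u (descend op f u)
        rw [e]
        have e1 : simple i * u = simple j * (simple i * w) := simple_mul_simple_mul _ _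
        have e2 : simple j * u = simple i * (simple j * w) := by rw [← e, simple_mul_simple_mul]
        rw [e1, e2, simple_mul_simple_mul, simple_mul_simple_mul] at this
        exact this
    have hex : ∃ i, IsDescent i w := ⟨i, hi⟩
    rw [descend, dif_pos hex]
    rcases lt_trichotomy hex.choose i with h | h | h
    · exact key _ _ h hex.choose_spec hi
    · rw [h]
    · exact (key _ _ h hi hex.choose_spec).symm

end Descend

end Combinatorics

section Weights

variable {m r : ℕ}

/-! ### Weights -/

/-- The matrix of the quadratic form `∑ x_k l_k`. -/
def linMat (l : Fin m → Var m r → ℤ) : Matrix (Var m r) (Var m r) ℤ :=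
  ∑ k, prodForm (coord (.x k)) (l k)

theorem linMat_sub (l l' : Fin m → Var m r → ℤ) : linMat (l - l') = linMat l - linMat l' := by
  simp only [linMat, Pi.sub_apply, prodForm_sub_right, Finset.sum_sub_distrib]

theorem linMat_add (l l' : Fin m → Var m r → ℤ) : linMat (l + l') = linMat l + linMat l' := by
  simp only [linMat, Pi.add_apply, prodForm_add_right, Finset.sum_add_distrib]

theorem linMat_sum {α : Type*} (s : Finset α) (l : α → Fin m → Var m r → ℤ) :
    linMat (∑ i ∈ s, l i) = ∑ i ∈ s, linMat (l i) :=
  map_sum (AddMonoidHom.mk' linMat linMat_add) l s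

theorem prodForm_zero_right {ι : Type} (a : ι → ℤ) : prodForm a 0 = 0 := by
  ext i j; simp [prodForm]

theorem linMat_single (k : Fin m) (a : Var m r → ℤ) :
    linMat (Pi.single k a) = prodForm (coord (.x k)) a := by
  rw [linMat, Finset.sum_eq_single k (fun j _ hj ↦ by
    rw [Pi.single_eq_of_ne hj, prodForm_zero_right]) (by simp), Pi.single_eq_same]

theorem linMat_submatrix (i : Fin (m - 1)) {l : Fin m → Var m r → ℤ} (hl : ∀ k, XFree (l k)) :
    (linMat l).submatrix (simpleVar i) (simpleVar i) = linMat (l ∘ simple i) := by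
  have h : ∀ k, (prodForm (coord (.x k)) (l k)).submatrix (simpleVar i) (simpleVar i) =
      prodForm (coord (.x (simple i k))) (l k) := fun k ↦ by
    have := prodForm_submatrix (coord (.x k)) (l k) (simpleVar i)
    rwa [simpleVar_symm, permForm_simpleVar_of_xFree i (hl k), permForm_simpleVar_coord_x] at this
  have h' : (linMat l).submatrix (simpleVar i) (simpleVar i) =
      ∑ k, prodForm (coord (.x (simple i k))) (l k) := by
    simp only [← h]
    ext v w
    simp [linMat, Matrix.sum_apply]
  rw [h', linMat, ← Equiv.sum_comp (simple i)]
  refine Finset.sum_congr rfl fun k _ ↦ ?_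
  simp [simple]

/-- Only positions `i` and `i + 1` change, so `∂_i (∑ x_k l_k) = l_i - l_{i+1}`. -/
theorem linMat_sub_comp_simple (i : Fin (m - 1)) (l : Fin m → Var m r → ℤ) :
    linMat l - linMat (l ∘ simple i) = prodForm (root i) (l (pos i) - l (posSucc i)) := by
  have h : l - l ∘ simple i = Pi.single (pos i) (l (pos i) - l (posSucc i)) -
      Pi.single (posSucc i) (l (pos i) - l (posSucc i)) := by
    funext k
    by_cases h1 : k = pos i
    · subst h1; simp [simple_pos, pos_ne_posSucc]
    · by_cases h2 : k = posSucc i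
      · subst h2; simp [simple_posSucc, (pos_ne_posSucc i).symm]
      · simp [simple, h1, h2, Equiv.swap_apply_of_ne_of_ne]
  rw [← linMat_sub, h, linMat_sub, linMat_single, linMat_single, root, prodForm_sub_left]

/-- `f` is pure of type `∑ x_k (κ_k - k h)` plus a symmetric form. -/
def HasWeight (τ : ℍ) (f : Mero (Var m r)) (κ : Fin m → Var m r → ℤ) : Prop :=
  (∀ k, XFree (κ k)) ∧ ∃ C : Matrix (Var m r) (Var m r) ℤ,
    (∀ i : Fin (m - 1), C.submatrix (simpleVar i) (simpleVar i) = C) ∧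
    HasType τ f (C + linMat fun k ↦ κ k - (k : ℤ) • coord .h)

theorem prodForm_submatrix_of_xFree (i : Fin (m - 1)) {a b : Var m r → ℤ} (ha : XFree a)
    (hb : XFree b) :
    (prodForm a b).submatrix (simpleVar i) (simpleVar i) = prodForm a b := by
  have := prodForm_submatrix a b (simpleVar i)
  rwa [simpleVar_symm, permForm_simpleVar_of_xFree i ha, permForm_simpleVar_of_xFree i hb] at this

theorem type_sub_submatrix {κ : Fin m → Var m r → ℤ} (hκ : ∀ k, XFree (κ k)) (i : Fin (m - 1))
    {C : Matrix (Var m r) (Var m r) ℤ} (hC : C.submatrix (simpleVar i) (simpleVar i) = C) :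
    (C + linMat fun k ↦ κ k - (k : ℤ) • coord .h) -
      (C + linMat fun k ↦ κ k - (k : ℤ) • coord .h).submatrix (simpleVar i) (simpleVar i) =
    prodForm (root i) (κ (pos i) - κ (posSucc i) + coord .h) := by
  rw [Matrix.submatrix_add, Pi.add_apply, Pi.add_apply, hC, add_sub_add_left_eq_sub,
    linMat_submatrix i fun k ↦ (hκ k).sub (xFree_h.zsmul _), linMat_sub_comp_simple]
  congr 1
  simp only [pos, posSucc]
  push_cast
  module

/-- The shift by `-k h` in the definition of weight contributes `h` to `∂_i`, which the `-h` in the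
admissible parameter removes. Uniqueness uses that a nonzero function has one type. -/
theorem HasWeight.admissible_iff {τ : ℍ} {f : Mero (Var m r)} {κ : Fin m → Var m r → ℤ}
    (h : HasWeight τ f κ) (hf : f ≠ 0) (i : Fin (m - 1)) (ν : Var m r → ℤ) :
    Admissible τ i f ν ↔ ν = κ (pos i) - κ (posSucc i) := by
  obtain ⟨hκ, C, hC, hfC⟩ := h
  have key := type_sub_submatrix hκ i (hC i)
  constructor
  · rintro ⟨-, A, hA, hν⟩
    rw [hA.unique hf hfC, key] at hν
    exact (add_right_cancel (prodForm_right_injective (root_ne_zero i) hν)).symm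
  · rintro rfl
    exact ⟨hf, _, hfC, key⟩

theorem HasWeight.demBar {τ : ℍ} {f : Mero (Var m r)} {κ : Fin m → Var m r → ℤ}
    (h : HasWeight τ f κ) (i : Fin (m - 1)) :
    HasWeight τ (demBar τ i (κ (pos i) - κ (posSucc i)) f) (κ ∘ simple i) := by
  obtain ⟨hκ, C, hC, hfC⟩ := h
  have key := type_sub_submatrix hκ i (hC i)
  set ν := κ (pos i) - κ (posSucc i) with hν
  have hνf : XFree ν := (hκ _).sub (hκ _)
  set A := C + linMat fun k ↦ κ k - (k : ℤ) • coord .h with hA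
  refine ⟨fun k ↦ hκ _, C - prodForm ν (coord .h), fun j ↦ ?_, ?_⟩
  · rw [Matrix.submatrix_sub, Pi.sub_apply, Pi.sub_apply, hC,
      prodForm_submatrix_of_xFree j hνf xFree_h]
  · have t1 := (hasType_delta τ (-root i) ν).mul hfC
    have t2 := (hasType_delta τ (root i) (coord .h)).mul (hfC.permute (simpleVar i))
    -- The two summands of the operation have equal type precisely because `ν` is admissible.
    have e1 : prodForm (-root i) ν + A =
        prodForm (root i) (coord .h) + A.submatrix (simpleVar i) (simpleVar i) := by
      rw [prodForm_add_right, ← sub_eq_zero] at key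
      rw [prodForm_neg_left, ← sub_eq_zero, ← key]
      abel
    rw [simpleVar_symm, ← e1] at t2
    have t3 := (hasType_delta τ ν (coord .h)).inv.mul (t1.add t2)
    -- `s_i` permutes the shifts `-k h` along with the weights; the factor `δ(x_i / x_{i+1}, h)`
    -- restores them, leaving only `κ` permuted.
    have e2 : linMat (fun k ↦ (κ ∘ simple i) k - (k : ℤ) • coord .h) =
        (linMat fun k ↦ κ k - (k : ℤ) • coord .h).submatrix (simpleVar i) (simpleVar i) +
          prodForm (root i) (coord .h : Var m r → ℤ) := by
      have h1 := linMat_sub_comp_simple i (fun k : Fin m ↦ -((k : ℤ) • (coord .h : Var m r → ℤ)))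
      rw [show -((((pos i : Fin m) : ℕ) : ℤ) • (coord .h : Var m r → ℤ)) -
        -((((posSucc i : Fin m) : ℕ) : ℤ) • (coord .h : Var m r → ℤ)) = coord .h by
          simp only [pos, posSucc]; push_cast; module] at h1
      rw [linMat_submatrix i fun k ↦ (hκ k).sub (xFree_h.zsmul _), ← h1, ← linMat_sub,
        ← linMat_add]
      congr 1
      funext k
      simp only [Function.comp_apply, Pi.add_apply, Pi.sub_apply]
      abel
    have e3 : C - prodForm ν (coord .h) + linMat (fun k ↦ (κ ∘ simple i) k - (k : ℤ) • coord .h) =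
        -prodForm ν (coord .h) + (prodForm (-root i) ν + A) := by
      rw [e1, e2, hA, Matrix.submatrix_add, Pi.add_apply, Pi.add_apply, hC]
      abel
    rw [e3]
    exact t3

end Weights

section Minimal

variable {m r : ℕ}

/-! ### The elliptic class of the minimal pattern -/

theorem firstNode_injective (hmr : 2 * r ≤ m) : Function.Injective (firstNode hmr) :=
  fun i j h ↦ Fin.ext (by simpa [firstNode] using h)

theorem lastNode_injective (hmr : 2 * r ≤ m) : Function.Injective (lastNode hmr) :=
  fun i j h ↦ Fin.ext (by simpa [lastNode] using h)

theorem firstNode_ne_lastNode (hmr : 2 * r ≤ m) (i j : Fin r) :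
    firstNode hmr i ≠ lastNode hmr j := fun h ↦ by
  have := congrArg Fin.val h
  simp only [firstNode, lastNode] at this
  omega

/-- `k` is a loose node of the minimal pattern. -/
def IsLoose (r : ℕ) (k : Fin m) : Prop := r ≤ (k : ℕ) ∧ (k : ℕ) < m - r

theorem not_isLoose_firstNode (hmr : 2 * r ≤ m) (i : Fin r) : ¬IsLoose r (firstNode hmr i) := by
  simp only [IsLoose, firstNode]; omega

theorem not_isLoose_lastNode (hmr : 2 * r ≤ m) (i : Fin r) : ¬IsLoose r (lastNode hmr i) := by
  simp only [IsLoose, lastNode]; omega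

theorem node_cases (hmr : 2 * r ≤ m) (k : Fin m) :
    (∃ i, k = firstNode hmr i) ∨ (∃ i, k = lastNode hmr i) ∨ IsLoose r k := by
  by_cases h1 : (k : ℕ) < r
  · exact .inl ⟨⟨k, h1⟩, rfl⟩
  · by_cases h2 : (k : ℕ) < m - r
    · exact .inr (.inr ⟨by omega, h2⟩)
    · exact .inr (.inl ⟨⟨k - (m - r), by omega⟩, Fin.ext (by simp only [lastNode]; omega)⟩)

theorem filter_lastNode_lt (hmr : 2 * r ≤ m) (i : Fin r) :
    Finset.univ.filter (fun j : Fin m ↦ lastNode hmr i < j) =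
      (Finset.Ioi i).map ⟨lastNode hmr, lastNode_injective hmr⟩ := by
  ext j
  simp only [Finset.mem_filter, Finset.mem_univ, true_and, Finset.mem_map, Finset.mem_Ioi,
    Function.Embedding.coeFn_mk]
  constructor
  · intro h
    have h' : m - r + (i : ℕ) < j := h
    exact ⟨⟨j - (m - r), by omega⟩, by simp only [Fin.lt_def]; omega,
      Fin.ext (by simp only [lastNode]; omega)⟩
  · rintro ⟨k, hk, rfl⟩
    simp only [lastNode, Fin.lt_def] at hk ⊢
    omega

/-- The linear form `u + x_i - x_{m-r+j}`. -/
def pairForm (hmr : 2 * r ≤ m) (i j : Fin r) : Var m r → ℤ :=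
  coord .u + coord (.x (firstNode hmr i)) - coord (.x (lastNode hmr j))

theorem pairForm_ne_zero (hmr : 2 * r ≤ m) (i j : Fin r) : pairForm hmr i j ≠ 0 := fun h ↦ by
  have := congrFun h .u
  simp [pairForm, coord] at this

theorem ellMin_eq (τ : ℍ) (hmr : 2 * r ≤ m) :
    ellMin τ hmr = ∏ i, (delta τ (pairForm hmr i i) (coord (.mu i)) *
      ∏ j ∈ Finset.Ioi i, delta τ (pairForm hmr i j) (coord .h)) := by
  refine Finset.prod_congr rfl fun i _ ↦ ?_
  rw [filter_lastNode_lt, Finset.prod_map]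
  rfl

theorem pairForm_add_ne_zero (hmr : 2 * r ≤ m) (i j : Fin r) {v : Var m r} (hv : v ≠ .u) :
    pairForm hmr i j + coord v ≠ 0 := fun h ↦ by
  have := congrFun h .u
  simp [pairForm, coord, hv.symm] at this

theorem ellMin_ne_zero (τ : ℍ) (hmr : 2 * r ≤ m) : ellMin τ hmr ≠ 0 := by
  rw [ellMin_eq]
  refine Finset.prod_ne_zero_iff.mpr fun i _ ↦ mul_ne_zero
    (delta_ne_zero τ (pairForm_ne_zero hmr i i) (coord_ne_zero _)
      (pairForm_add_ne_zero hmr i i (by simp)))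
    (Finset.prod_ne_zero_iff.mpr fun j _ ↦
      delta_ne_zero τ (pairForm_ne_zero hmr i j) (coord_ne_zero _)
      (pairForm_add_ne_zero hmr i j (by simp)))

/-- The weight of the elliptic class of the minimal pattern. -/
def minWeight (m r : ℕ) (k : Fin m) : Var m r → ℤ :=
  if h : (k : ℕ) < r then coord (.mu ⟨k, h⟩) + ((r : ℤ) - 1) • coord .h
  else if h' : (k : ℕ) < m - r then (k : ℤ) • coord .h
  else -coord (.mu ⟨k - (m - r), by omega⟩) + ((m - r : ℕ) : ℤ) • coord .h

theorem minWeight_firstNode (hmr : 2 * r ≤ m) (i : Fin r) :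
    minWeight m r (firstNode hmr i) = coord (.mu i) + ((r : ℤ) - 1) • coord .h := by
  simp [minWeight, firstNode]

theorem minWeight_lastNode (hmr : 2 * r ≤ m) (i : Fin r) :
    minWeight m r (lastNode hmr i) = -coord (.mu i) + ((m - r : ℕ) : ℤ) • coord .h := by
  have h : ¬m - r + (i : ℕ) < r := by omega
  simp [minWeight, lastNode, h]

theorem minWeight_of_isLoose {k : Fin m} (hk : IsLoose r k) :
    minWeight m r k = (k : ℤ) • coord .h := by
  simp [minWeight, hk.1.not_gt, hk.2]

theorem xFree_minWeight (hmr : 2 * r ≤ m) (k : Fin m) : XFree (minWeight m r k) := by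
  rcases node_cases hmr k with ⟨i, rfl⟩ | ⟨i, rfl⟩ | hk
  · rw [minWeight_firstNode]; exact (xFree_mu i).add (xFree_h.zsmul _)
  · rw [minWeight_lastNode]; exact (xFree_mu i).neg.add (xFree_h.zsmul _)
  · rw [minWeight_of_isLoose hk]; exact xFree_h.zsmul _

theorem coord_h_mu (j : Fin r) : coord (.h : Var m r) (.mu j) = 0 := by simp [coord]

theorem coord_mu_mu (i j : Fin r) : coord (.mu i : Var m r) (.mu j) = if j = i then 1 else 0 := by
  simp [coord, Pi.single_apply]

/-- Unless both nodes are loose, the parameter involves some `μ_j`, so no multiple of `h` can cancel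
it. -/
theorem exists_minWeight_sub_apply_ne_zero (hmr : 2 * r ≤ m) {p q : Fin m} (hpq : p ≠ q)
    (h : ¬(IsLoose r p ∧ IsLoose r q)) :
    ∃ j, (minWeight m r p - minWeight m r q) (.mu j) ≠ 0 := by
  rcases node_cases hmr p with ⟨i, rfl⟩ | ⟨i, rfl⟩ | hp <;>
    rcases node_cases hmr q with ⟨j, rfl⟩ | ⟨j, rfl⟩ | hq
  · have hij : i ≠ j := fun e ↦ hpq (by rw [e])
    exact ⟨i, by simp [minWeight_firstNode, coord, hij]⟩
  · refine ⟨i, ?_⟩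
    simp only [minWeight_firstNode, minWeight_lastNode, coord_h_mu, coord_mu_mu, Pi.sub_apply,
      Pi.add_apply, Pi.neg_apply, Pi.smul_apply, smul_zero, if_true]
    split_ifs <;> decide
  · exact ⟨i, by simp [minWeight_firstNode, minWeight_of_isLoose hq, coord]⟩
  · refine ⟨i, ?_⟩
    simp only [minWeight_firstNode, minWeight_lastNode, coord_h_mu, coord_mu_mu, Pi.sub_apply,
      Pi.add_apply, Pi.neg_apply, Pi.smul_apply, smul_zero, if_true]
    split_ifs <;> decide
  · have hij : i ≠ j := fun e ↦ hpq (by rw [e])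
    exact ⟨i, by simp [minWeight_lastNode, coord, hij]⟩
  · exact ⟨i, by simp [minWeight_lastNode, minWeight_of_isLoose hq, coord]⟩
  · exact ⟨j, by simp [minWeight_firstNode, minWeight_of_isLoose hp, coord]⟩
  · exact ⟨j, by simp [minWeight_lastNode, minWeight_of_isLoose hp, coord]⟩
  · exact (h ⟨hp, hq⟩).elim

theorem minWeight_sub_add_ne_zero (hmr : 2 * r ≤ m) {p q : Fin m} (hpq : p ≠ q)
    (h : ¬(IsLoose r p ∧ IsLoose r q)) (c : ℤ) :
    minWeight m r p - minWeight m r q + c • coord .h ≠ 0 := fun h0 ↦ by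
  obtain ⟨j, hj⟩ := exists_minWeight_sub_apply_ne_zero hmr hpq h
  refine hj ?_
  have := congrFun h0 (.mu j)
  rw [Pi.add_apply] at this
  simpa [coord] using this

theorem minWeight_sub_ne_zero (hmr : 2 * r ≤ m) {p q : Fin m} (hpq : p ≠ q) :
    minWeight m r p - minWeight m r q ≠ 0 := by
  by_cases h : IsLoose r p ∧ IsLoose r q
  · rw [minWeight_of_isLoose h.1, minWeight_of_isLoose h.2]
    intro h0
    have := congrFun h0 .h
    simp only [coord, Pi.sub_apply, Pi.smul_apply, Pi.single_eq_same, Pi.zero_apply, smul_eq_mul,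
      mul_one] at this
    exact hpq (Fin.ext (by omega))
  · simpa using minWeight_sub_add_ne_zero hmr hpq h 0

theorem hasWeight_ellMin (τ : ℍ) (hmr : 2 * r ≤ m) :
    HasWeight τ (ellMin τ hmr) (minWeight m r) := by
  have hu : XFree (coord .u : Var m r → ℤ) := fun k ↦ by simp [coord]
  refine ⟨xFree_minWeight hmr, prodForm (coord .u) (∑ i : Fin r, (coord (.mu i) +
    ∑ j ∈ Finset.Ioi i, coord .h)), fun i ↦ prodForm_submatrix_of_xFree i hu ?_, ?_⟩
  · intro k
    simp [coord, Finset.sum_apply]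
  rw [ellMin_eq]
  -- Each factor with argument `u + x_i - x_{m-r+j}` and parameter `y` contributes `y` at node `i`
  -- and `-y` at node `m - r + j`; its `u`-part goes into the symmetric form.
  have key : (fun k : Fin m ↦ minWeight m r k - (k : ℤ) • coord .h) =
      ∑ i : Fin r, (Pi.single (firstNode hmr i) (coord (.mu i)) -
        Pi.single (lastNode hmr i) (coord (.mu i)) + ∑ j ∈ Finset.Ioi i,
        (Pi.single (firstNode hmr i) (coord .h) - Pi.single (lastNode hmr j) (coord .h))) := by
    funext k
    have hfl := firstNode_ne_lastNode hmr
    have hlf := fun i j ↦ (firstNode_ne_lastNode hmr i j).symm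
    simp only [Finset.sum_apply, Pi.add_apply, Pi.sub_apply, Finset.sum_add_distrib,
      Finset.sum_sub_distrib]
    rcases node_cases hmr k with ⟨a, rfl⟩ | ⟨a, rfl⟩ | hk
    · simp only [Pi.single_apply, (firstNode_injective hmr).eq_iff, hfl, if_false,
        Finset.sum_const_zero, sub_zero, Finset.sum_ite_eq, Finset.mem_univ, if_true,
        Finset.sum_const, Fin.card_Ioi, minWeight_firstNode]
      simp only [smul_ite, smul_zero, Finset.sum_ite_eq, Finset.mem_univ, if_true]
      have e1 : ((firstNode hmr a : Fin m) : ℕ) = a := rfl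
      -- There are `r - 1 - a` indices above `a`; adding the shift `a h` leaves `(r - 1) h`, the
      -- same for all targets.
      have e2 : ((r - 1 - a : ℕ) : ℤ) = (r : ℤ) - 1 - a := by omega
      rw [← natCast_zsmul, e1, e2]
      module
    · simp only [Pi.single_apply, (lastNode_injective hmr).eq_iff, hlf, if_false,
        Finset.sum_const_zero, zero_sub, Finset.sum_ite_eq, Finset.mem_univ, if_true,
        Finset.mem_Ioi, minWeight_lastNode]
      have e1 : (((lastNode hmr a : Fin m) : ℕ) : ℤ) = (m - r : ℕ) + (a : ℤ) := by simp [lastNode]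
      have e2 : (∑ x : Fin r, if x < a then (coord .h : Var m r → ℤ) else 0) =
          (a : ℤ) • coord .h := by
        rw [← Finset.sum_filter, Finset.sum_const, natCast_zsmul]
        congr 1
        rw [← Fin.card_Iio a]
        congr 1
        ext x
        simp
      rw [e1, e2]
      module
    · have h1 : ∀ i, k ≠ firstNode hmr i := fun i e ↦ not_isLoose_firstNode hmr i (e ▸ hk)
      have h2 : ∀ i, k ≠ lastNode hmr i := fun i e ↦ not_isLoose_lastNode hmr i (e ▸ hk)
      simp [h1, h2, minWeight_of_isLoose hk]
  have h := HasType.prod (τ := τ) (Finset.univ : Finset (Fin r)) (fun i _ ↦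
    (hasType_delta τ (pairForm hmr i i) (coord (.mu i))).mul
      (HasType.prod (τ := τ) (Finset.Ioi i) (fun j _ ↦
        hasType_delta τ (pairForm hmr i j) (coord .h))))
  convert h using 1
  rw [key, linMat_sum, prodForm_sum_right, ← Finset.sum_add_distrib]
  refine Finset.sum_congr rfl fun i _ ↦ ?_
  rw [linMat_add, linMat_sub, linMat_sum, linMat_single, linMat_single, prodForm_add_right,
    prodForm_sum_right]
  simp only [linMat_sub, linMat_single]
  simp only [pairForm, prodForm_sub_left, prodForm_add_left, Finset.sum_sub_distrib,
    Finset.sum_add_distrib]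
  abel

end Minimal

/-! ### Exchange of two adjacent labels of the minimal pattern. -/

section Swap

variable {m r : ℕ}

/-! ### The action of the permutations of the labels -/

theorem actMu_delta (τ : ℍ) (σ : Equiv.Perm (Fin r)) (a b : Var m r → ℤ) :
    actMu σ (delta τ a b) =
      delta τ (permForm (Var.permMu σ) a) (permForm (Var.permMu σ) b) := permute_delta τ _ a b

theorem actMu_mul (σ σ' : Equiv.Perm (Fin r)) (f : Mero (Var m r)) :
    actMu (σ * σ') f = actMu σ (actMu σ' f) := by
  have h : (Var.permMu (σ * σ') : Equiv.Perm (Var m r)) = Var.permMu σ * Var.permMu σ' :=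
    Equiv.ext fun v ↦ by cases v <;> rfl
  have e := permute_mul (Var.permMu σ) (Var.permMu σ') f
  rw [← h] at e
  exact e

theorem actMu_one (f : Mero (Var m r)) : actMu (1 : Equiv.Perm (Fin r)) f = f := by
  have h : (Var.permMu 1 : Equiv.Perm (Var m r)) = 1 :=
    Equiv.ext fun v ↦ by cases v <;> rfl
  have e := permute_one f
  rw [← h] at e
  exact e

theorem permForm_permMu_coord_x (σ : Equiv.Perm (Fin r)) (k : Fin m) :
    permForm (Var.permMu σ) (coord (.x k)) = coord (.x k) := permForm_coord _ _

theorem permForm_permMu_coord_u (σ : Equiv.Perm (Fin r)) :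
    permForm (Var.permMu σ) (coord (.u : Var m r)) = coord .u := permForm_coord _ _

theorem permForm_permMu_coord_h (σ : Equiv.Perm (Fin r)) :
    permForm (Var.permMu σ) (coord (.h : Var m r)) = coord .h := permForm_coord _ _

theorem permForm_permMu_coord_mu (σ : Equiv.Perm (Fin r)) (j : Fin r) :
    permForm (Var.permMu σ) (coord (.mu j : Var m r)) = coord (.mu (σ j)) := permForm_coord _ _

theorem permForm_permMu_root (σ : Equiv.Perm (Fin r)) (i : Fin (m - 1)) :
    permForm (Var.permMu σ) (root i) = root i := by
  rw [root, map_sub, permForm_permMu_coord_x, permForm_permMu_coord_x]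

theorem permForm_permMu_pairForm (σ : Equiv.Perm (Fin r)) (hmr : 2 * r ≤ m) (i j : Fin r) :
    permForm (Var.permMu σ) (pairForm hmr i j) = pairForm hmr i j := by
  rw [pairForm, map_sub, map_add, permForm_permMu_coord_x, permForm_permMu_coord_x,
    permForm_permMu_coord_u]

theorem actMu_simpleAct (σ : Equiv.Perm (Fin r)) (i : Fin (m - 1)) (f : Mero (Var m r)) :
    actMu σ (simpleAct i f) = simpleAct i (actMu σ f) := by
  have h : (Var.permMu σ * simpleVar i : Equiv.Perm (Var m r)) = simpleVar i * Var.permMu σ := by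
    refine Equiv.ext fun v ↦ ?_
    rw [Equiv.Perm.mul_apply, Equiv.Perm.mul_apply]
    by_cases hv : ∃ k, v = .x k
    · obtain ⟨k, rfl⟩ := hv
      rw [simpleVar_x]
      exact (simpleVar_x i k).symm
    · push Not at hv
      rw [simpleVar_of_ne_x i hv, simpleVar_of_ne_x i]
      rintro k hk
      cases v with
      | x j => exact hv j rfl
      | _ => cases hk
  have e := permute_mul (Var.permMu σ) (simpleVar i) f
  rw [h] at e
  exact e.symm.trans (permute_mul (simpleVar i) (Var.permMu σ) f)

theorem actMu_demBar (τ : ℍ) (σ : Equiv.Perm (Fin r)) (i : Fin (m - 1)) (ν : Var m r → ℤ)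
    (f : Mero (Var m r)) :
    actMu σ (demBar τ i ν f) = demBar τ i (permForm (Var.permMu σ) ν) (actMu σ f) := by
  rw [demBar, demBar, dem_eq, dem_eq, Mero.map_mul, Mero.map_inv, Mero.map_add, Mero.map_mul,
    Mero.map_mul, actMu_delta, actMu_delta, actMu_delta, actMu_simpleAct,
    (permForm (Var.permMu σ)).map_neg, permForm_permMu_root, permForm_permMu_coord_h]

/-! ### Adjacent transpositions of the labels of the minimal pattern -/

theorem permForm_simpleVar_coord_u (i : Fin (m - 1)) :
    permForm (simpleVar i) (coord (.u : Var m r)) = coord .u :=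
  permForm_simpleVar_of_xFree i fun k ↦ by simp [coord]

theorem simple_eq_swap_firstNode (hmr : 2 * r ≤ m) {a b : Fin r} (hab : (a : ℕ) + 1 = b)
    {i : Fin (m - 1)} (hi : (i : ℕ) = a) :
    simple i = Equiv.swap (firstNode hmr a) (firstNode hmr b) := by
  rw [simple, show pos i = firstNode hmr a from Fin.ext hi,
    show posSucc i = firstNode hmr b from Fin.ext (by simp only [posSucc, firstNode]; omega)]

theorem simple_eq_swap_lastNode (hmr : 2 * r ≤ m) {a b : Fin r} (hab : (a : ℕ) + 1 = b)
    {i : Fin (m - 1)} (hi : (i : ℕ) = m - r + a) :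
    simple i = Equiv.swap (lastNode hmr a) (lastNode hmr b) := by
  rw [simple, show pos i = lastNode hmr a from Fin.ext hi,
    show posSucc i = lastNode hmr b from Fin.ext (by simp only [posSucc, lastNode]; omega)]

theorem permForm_simpleVar_pairForm_left (hmr : 2 * r ≤ m) {a b : Fin r} (hab : (a : ℕ) + 1 = b)
    {i : Fin (m - 1)} (hi : (i : ℕ) = a) (k l : Fin r) :
    permForm (simpleVar i) (pairForm hmr k l) = pairForm hmr (Equiv.swap a b k) l := by
  rw [pairForm, map_sub, map_add, permForm_simpleVar_coord_x, permForm_simpleVar_coord_x,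
    permForm_simpleVar_coord_u, simple_eq_swap_firstNode hmr hab hi,
    (firstNode_injective hmr).swap_apply, Equiv.swap_apply_of_ne_of_ne
      (firstNode_ne_lastNode hmr _ _).symm (firstNode_ne_lastNode hmr _ _).symm, pairForm]

theorem permForm_simpleVar_pairForm_right (hmr : 2 * r ≤ m) {a b : Fin r} (hab : (a : ℕ) + 1 = b)
    {i : Fin (m - 1)} (hi : (i : ℕ) = m - r + a) (k l : Fin r) :
    permForm (simpleVar i) (pairForm hmr k l) = pairForm hmr k (Equiv.swap a b l) := by
  rw [pairForm, map_sub, map_add, permForm_simpleVar_coord_x, permForm_simpleVar_coord_x,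
    permForm_simpleVar_coord_u, simple_eq_swap_lastNode hmr hab hi,
    (lastNode_injective hmr).swap_apply, Equiv.swap_apply_of_ne_of_ne
      (firstNode_ne_lastNode hmr _ _) (firstNode_ne_lastNode hmr _ _), pairForm]

/-- The pairs `(i, j)` with `i < j`, except `(a, b)`. -/
def otherPairs (a b : Fin r) : Finset (Fin r × Fin r) :=
  (Finset.univ.filter fun p ↦ p.1 < p.2).erase (a, b)

theorem mem_otherPairs {a b : Fin r} {p : Fin r × Fin r} :
    p ∈ otherPairs a b ↔ p ≠ (a, b) ∧ p.1 < p.2 := by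
  simp [otherPairs]

/-- The factors of the class of the minimal pattern which are symmetric with respect to the
exchange of the labels `a` and `b`. -/
noncomputable def ellRest (τ : ℍ) (hmr : 2 * r ≤ m) (a b : Fin r) : Mero (Var m r) :=
  (∏ i ∈ {a, b}ᶜ, delta τ (pairForm hmr i i) (coord (.mu i))) *
    ∏ p ∈ otherPairs a b, delta τ (pairForm hmr p.1 p.2) (coord .h)

theorem ellMin_eq_ellRest_mul (τ : ℍ) (hmr : 2 * r ≤ m) {a b : Fin r} (hab : (a : ℕ) + 1 = b) :
    ellMin τ hmr = ellRest τ hmr a b * (delta τ (pairForm hmr a a) (coord (.mu a)) *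
      delta τ (pairForm hmr a b) (coord .h) * delta τ (pairForm hmr b b) (coord (.mu b))) := by
  have hne : a ≠ b := fun h ↦ by rw [h] at hab; omega
  have hlt : a < b := Fin.lt_def.mpr (by omega)
  have h1 : ∏ i, ∏ j ∈ Finset.Ioi i, delta τ (pairForm hmr i j) (coord .h) =
      delta τ (pairForm hmr a b) (coord .h) *
        ∏ p ∈ otherPairs a b, delta τ (pairForm hmr p.1 p.2) (coord .h) := by
    have hmem : (a, b) ∈ Finset.univ.filter fun p : Fin r × Fin r ↦ p.1 < p.2 := by
      simpa using hlt
    have e := Finset.mul_prod_erase (Finset.univ.filter fun p : Fin r × Fin r ↦ p.1 < p.2)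
      (fun p ↦ delta τ (pairForm hmr p.1 p.2) (coord .h)) hmem
    rw [otherPairs]
    refine Eq.trans ?_ e.symm
    rw [Finset.prod_filter, Fintype.prod_prod_type]
    refine Finset.prod_congr rfl fun i _ ↦ ?_
    rw [← Finset.prod_filter]
    congr 1
    ext j
    simp
  rw [ellMin_eq, Finset.prod_mul_distrib, h1, ellRest,
    ← Finset.prod_mul_prod_compl ({a, b} : Finset (Fin r)), Finset.prod_pair hne]
  ring

/-- Since `b = a + 1`, the pair `(a, b)` is the only one with `i < j` whose order is lost by
exchanging `a` and `b` in one coordinate; without it the set of pairs is stable. -/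
theorem simpleAct_ellRest_left (τ : ℍ) (hmr : 2 * r ≤ m) {a b : Fin r} (hab : (a : ℕ) + 1 = b)
    {i : Fin (m - 1)} (hi : (i : ℕ) = a) :
    simpleAct i (ellRest τ hmr a b) = ellRest τ hmr a b := by
  rw [ellRest, simpleAct_mul]
  simp only [simpleAct, Mero.map_prod, permute_delta, permForm_simpleVar_of_xFree i xFree_h,
    permForm_simpleVar_of_xFree i (xFree_mu _), permForm_simpleVar_pairForm_left hmr hab hi]
  refine congrArg₂ (· * ·) ?_ ?_
  · refine Finset.prod_congr rfl fun k hk ↦ ?_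
    simp only [Finset.mem_compl, Finset.mem_insert, Finset.mem_singleton, not_or] at hk
    rw [Equiv.swap_apply_of_ne_of_ne hk.1 hk.2]
  · refine Finset.prod_equiv ((Equiv.swap a b).prodCongr (Equiv.refl _)) (fun p ↦ ?_)
      fun p _ ↦ rfl
    simp only [mem_otherPairs, Equiv.prodCongr_apply, Prod.map_fst, Prod.map_snd, Equiv.refl_apply,
      ne_eq, Prod.ext_iff, Equiv.swap_apply_def, Fin.lt_def, Fin.ext_iff]
    split_ifs <;> omega

theorem simpleAct_ellRest_right (τ : ℍ) (hmr : 2 * r ≤ m) {a b : Fin r} (hab : (a : ℕ) + 1 = b)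
    {i : Fin (m - 1)} (hi : (i : ℕ) = m - r + a) :
    simpleAct i (ellRest τ hmr a b) = ellRest τ hmr a b := by
  rw [ellRest, simpleAct_mul]
  simp only [simpleAct, Mero.map_prod, permute_delta, permForm_simpleVar_of_xFree i xFree_h,
    permForm_simpleVar_of_xFree i (xFree_mu _), permForm_simpleVar_pairForm_right hmr hab hi]
  refine congrArg₂ (· * ·) ?_ ?_
  · refine Finset.prod_congr rfl fun k hk ↦ ?_
    simp only [Finset.mem_compl, Finset.mem_insert, Finset.mem_singleton, not_or] at hk
    rw [Equiv.swap_apply_of_ne_of_ne hk.1 hk.2]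
  · refine Finset.prod_equiv ((Equiv.refl _).prodCongr (Equiv.swap a b)) (fun p ↦ ?_)
      fun p _ ↦ rfl
    simp only [mem_otherPairs, Equiv.prodCongr_apply, Prod.map_fst, Prod.map_snd, Equiv.refl_apply,
      ne_eq, Prod.ext_iff, Equiv.swap_apply_def, Fin.lt_def, Fin.ext_iff]
    split_ifs <;> omega

theorem actMu_ellRest (τ : ℍ) (hmr : 2 * r ≤ m) (a b : Fin r) :
    actMu (Equiv.swap a b) (ellRest τ hmr a b) = ellRest τ hmr a b := by
  rw [ellRest, Mero.map_mul, Mero.map_prod, Mero.map_prod]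
  simp only [actMu_delta, permForm_permMu_pairForm, permForm_permMu_coord_h,
    permForm_permMu_coord_mu]
  refine congrArg₂ (· * ·) ?_ rfl
  refine Finset.prod_congr rfl fun k hk ↦ ?_
  simp only [Finset.mem_compl, Finset.mem_insert, Finset.mem_singleton, not_or] at hk
  rw [Equiv.swap_apply_of_ne_of_ne hk.1 hk.2]

/-- The base case of the independence. The symmetric factors pass through both operations, and what
remains is `delta_four_term` for the four forms `u + x_k - x_{m-r+l}` with `k, l ∈ {a, b}`. -/
theorem demBar_actMu_swap_ellMin (τ : ℍ) (hmr : 2 * r ≤ m) {a b : Fin r} (hab : (a : ℕ) + 1 = b)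
    {i j : Fin (m - 1)} (hi : (i : ℕ) = a) (hj : (j : ℕ) = m - r + a) :
    demBar τ i (coord (.mu b) - coord (.mu a)) (actMu (Equiv.swap a b) (ellMin τ hmr)) =
      demBar τ j (coord (.mu b) - coord (.mu a)) (ellMin τ hmr) := by
  have hne : a ≠ b := fun h ↦ by rw [h] at hab; omega
  have hac : firstNode hmr a ≠ firstNode hmr b := fun h ↦ hne (firstNode_injective hmr h)
  have hlc : lastNode hmr a ≠ lastNode hmr b := fun h ↦ hne (lastNode_injective hmr h)
  have ri : (root i : Var m r → ℤ) = pairForm hmr a a - pairForm hmr b a := by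
    rw [root, show pos i = firstNode hmr a from Fin.ext hi,
      show posSucc i = firstNode hmr b from Fin.ext (by simp only [posSucc, firstNode]; omega),
      pairForm, pairForm]
    abel
  have rj : (root j : Var m r → ℤ) = pairForm hmr a b - pairForm hmr a a := by
    rw [root, show pos j = lastNode hmr a from Fin.ext hj,
      show posSucc j = lastNode hmr b from Fin.ext (by simp only [posSucc, lastNode]; omega),
      pairForm, pairForm]
    abel
  have hd : pairForm hmr b b = pairForm hmr a b + pairForm hmr b a - pairForm hmr a a := by
    simp only [pairForm]
    abel
  have hmu : (coord (.mu b) - coord (.mu a) : Var m r → ℤ) ≠ 0 := fun h ↦ by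
    have := congrFun h (.mu b)
    rw [Pi.sub_apply, coord_mu_mu, coord_mu_mu, if_pos rfl, if_neg hne.symm] at this
    simp at this
  have key := delta_four_term τ (pairForm_ne_zero hmr a a) (pairForm_ne_zero hmr a b)
    (pairForm_ne_zero hmr b a) (by rw [← hd]; exact pairForm_ne_zero hmr b b)
    (by rw [← neg_sub, ← rj]; exact neg_ne_zero.mpr (root_ne_zero j))
    (by rw [← neg_sub, ← ri]; exact neg_ne_zero.mpr (root_ne_zero i))
    (coord_ne_zero (.mu a)) (coord_ne_zero (.mu b)) hmu (coord_ne_zero .h)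
  rw [← hd, ← rj, ← ri, ← neg_sub (pairForm hmr a b), ← rj,
    ← neg_sub (pairForm hmr a a) (pairForm hmr b a), ← ri] at key
  rw [demBar, demBar, ellMin_eq_ellRest_mul τ hmr hab, Mero.map_mul, actMu_ellRest,
    dem_mul τ i _ (simpleAct_ellRest_left τ hmr hab hi),
    dem_mul τ j _ (simpleAct_ellRest_right τ hmr hab hj), dem_eq, dem_eq]
  congr 2
  simp only [Mero.map_mul, simpleAct_mul, actMu_delta, simpleAct_delta, permForm_permMu_pairForm,
    permForm_permMu_coord_h, permForm_permMu_coord_mu, Equiv.swap_apply_left,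
    Equiv.swap_apply_right, permForm_simpleVar_of_xFree _ xFree_h,
    permForm_simpleVar_of_xFree _ (xFree_mu _), permForm_simpleVar_pairForm_left hmr hab hi,
    permForm_simpleVar_pairForm_right hmr hab hj]
  exact key.symm

end Swap

/-! ### The value attached to a permutation, and definedness along words. -/

section Main

variable {m r : ℕ}

theorem perm_apply_inv (w : Equiv.Perm (Fin m)) (k : Fin m) : w (w⁻¹ k) = k :=
  w.apply_symm_apply k

theorem perm_inv_apply (w : Equiv.Perm (Fin m)) (k : Fin m) : w⁻¹ (w k) = k :=
  w.symm_apply_apply k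

/-! ### The operations along a permutation -/

/-- The `i`-th normalized operation, applied to a function whose weight is the weight of the
minimal pattern permuted by `w`. -/
noncomputable def minOp (τ : ℍ) (r : ℕ) (i : Fin (m - 1)) (w : Equiv.Perm (Fin m))
    (g : Mero (Var m r)) : Mero (Var m r) :=
  demBar τ i (minWeight m r (w⁻¹ (pos i)) - minWeight m r (w⁻¹ (posSucc i))) g

/-- The value of the composition of the operations along `w`. -/
noncomputable def ellValue (τ : ℍ) (hmr : 2 * r ≤ m) (w : Equiv.Perm (Fin m)) : Mero (Var m r) :=
  descend (minOp τ r) (ellMin τ hmr) w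

theorem ellValue_one (τ : ℍ) (hmr : 2 * r ≤ m) : ellValue τ hmr 1 = ellMin τ hmr :=
  descend_one _ _

/-- Parameters are differences of weights carried by positions, so around a hexagon they are `p`, `p
+ q`, `q` on one side and the same in reverse on the other, as the braid relation requires. -/
theorem ellValue_eq (τ : ℍ) (hmr : 2 * r ≤ m) {w : Equiv.Perm (Fin m)} {i : Fin (m - 1)}
    (hi : IsDescent i w) :
    ellValue τ hmr w = minOp τ r i (simple i * w) (ellValue τ hmr (simple i * w)) := by
  refine descend_eq _ _ (fun i j h u g ↦ ?_) (fun i j h u g ↦ ?_) w i hi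
  · have e1 : simple j (pos i) = pos i := by apply simple_of_ne <;> simp only [pos] <;> omega
    have e2 : simple j (posSucc i) = posSucc i := by
      apply simple_of_ne <;> simp only [posSucc] <;> omega
    have e3 : simple i (pos j) = pos j := by apply simple_of_ne <;> simp only [pos] <;> omega
    have e4 : simple i (posSucc j) = posSucc j := by
      apply simple_of_ne <;> simp only [posSucc] <;> omega
    simp only [minOp, simple_mul_inv_apply, e1, e2, e3, e4]
    exact demBar_comm τ h ((xFree_minWeight hmr _).sub (xFree_minWeight hmr _))
      ((xFree_minWeight hmr _).sub (xFree_minWeight hmr _)) g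
  · have e1 : simple j (pos i) = pos i := by apply simple_of_ne <;> simp only [pos] <;> omega
    have e2 : simple i (posSucc j) = posSucc j := by
      apply simple_of_ne <;> simp only [posSucc] <;> omega
    have hp := posSucc_eq_pos h
    simp only [minOp, simple_mul_inv_apply, e1, e2, simple_pos, hp, simple_posSucc]
    simp only [← hp, simple_posSucc, e1]
    simp only [hp]
    have hne1 : u⁻¹ (pos i) ≠ u⁻¹ (pos j) := fun e ↦
      pos_ne_posSucc i (hp ▸ u⁻¹.injective e)
    have hne2 : u⁻¹ (pos j) ≠ u⁻¹ (posSucc j) := fun e ↦ pos_ne_posSucc j (u⁻¹.injective e)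
    have hne3 : u⁻¹ (pos i) ≠ u⁻¹ (posSucc j) := fun e ↦ by
      have := congrArg Fin.val (u⁻¹.injective e)
      simp only [pos, posSucc] at this
      omega
    have := demBar_braid τ h (p := minWeight m r (u⁻¹ (pos i)) - minWeight m r (u⁻¹ (pos j)))
      (q := minWeight m r (u⁻¹ (pos j)) - minWeight m r (u⁻¹ (posSucc j)))
      ((xFree_minWeight hmr _).sub (xFree_minWeight hmr _))
      ((xFree_minWeight hmr _).sub (xFree_minWeight hmr _)) (minWeight_sub_ne_zero hmr hne1)
      (minWeight_sub_ne_zero hmr hne2)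
      (by rw [sub_add_sub_cancel]; exact minWeight_sub_ne_zero hmr hne3) g
    rwa [sub_add_sub_cancel] at this

/-! ### Permutations which preserve the order of the loose nodes -/

/-- Exchanging two loose nodes in adjacent positions reverses their order, so it cannot be
increasing both before and after. -/
theorem PreservesLooseOrder.not_isLoose {w : Equiv.Perm (Fin m)} {i : Fin (m - 1)}
    (hw : PreservesLooseOrder r w) (hw' : PreservesLooseOrder r (simple i * w)) :
    ¬(IsLoose r (w⁻¹ (pos i)) ∧ IsLoose r (w⁻¹ (posSucc i))) := by
  rintro ⟨hp, hq⟩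
  rcases lt_trichotomy (w⁻¹ (pos i)) (w⁻¹ (posSucc i)) with h | h | h
  · have := hw' _ _ hp.1 h hq.2
    rw [Equiv.Perm.mul_apply, Equiv.Perm.mul_apply, perm_apply_inv,
      perm_apply_inv, simple_pos, simple_posSucc] at this
    simp [pos, posSucc, Fin.lt_def] at this
  · exact pos_ne_posSucc i (w⁻¹.injective h)
  · have := hw _ _ hq.1 h hp.2
    rw [perm_apply_inv, perm_apply_inv] at this
    simp [pos, posSucc, Fin.lt_def] at this

theorem PreservesLooseOrder.simple_mul {w : Equiv.Perm (Fin m)} {i : Fin (m - 1)}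
    (hw : PreservesLooseOrder r w)
    (hi : IsLoose r (w⁻¹ (pos i)) → IsLoose r (w⁻¹ (posSucc i)) →
      ¬w⁻¹ (pos i) < w⁻¹ (posSucc i)) : PreservesLooseOrder r (simple i * w) := by
  intro a b ha hab hb
  rw [Equiv.Perm.mul_apply, Equiv.Perm.mul_apply]
  refine simple_lt_simple (hw a b ha hab hb) fun h ↦ ?_
  rw [← h.1, ← h.2, perm_inv_apply, perm_inv_apply] at hi
  have hab' := Fin.lt_def.mp hab
  exact hi ⟨ha, by omega⟩ ⟨by omega, hb⟩ hab

theorem PreservesLooseOrder.of_isDescent {w : Equiv.Perm (Fin m)} {i : Fin (m - 1)}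
    (hw : PreservesLooseOrder r w) (hi : IsDescent i w) : PreservesLooseOrder r (simple i * w) :=
  hw.simple_mul fun _ _ ↦ not_lt_of_gt hi

/-- If `s_i` broke the order, positions `i`, `i + 1` would carry loose nodes `p < q`. They must be
consecutive, since the image of a loose node in between would lie strictly between `i` and `i + 1`.
Then `ν + h = (p - q + 1) h = 0`. -/
theorem PreservesLooseOrder.of_minWeight {w : Equiv.Perm (Fin m)} {i : Fin (m - 1)}
    (hw : PreservesLooseOrder r w) (hi : minWeight m r (w⁻¹ (pos i)) -
      minWeight m r (w⁻¹ (posSucc i)) + coord .h ≠ 0) : PreservesLooseOrder r (simple i * w) := by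
  refine hw.simple_mul fun hp hq hpq ↦ hi ?_
  rw [minWeight_of_isLoose hp, minWeight_of_isLoose hq]
  have hpq' := Fin.lt_def.mp hpq
  by_cases h : ((w⁻¹ (pos i) : Fin m) : ℕ) + 1 = w⁻¹ (posSucc i)
  · rw [← h]
    push_cast
    module
  · exfalso
    have hlt : ((w⁻¹ (pos i) : Fin m) : ℕ) + 1 < m := by
      have := (w⁻¹ (posSucc i)).isLt; omega
    have h1 := hw (w⁻¹ (pos i)) ⟨_, hlt⟩ hp.1 (Fin.lt_def.mpr (by simp)) (by
      have := hq.2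
      simp only
      omega)
    have h2 := hw ⟨_, hlt⟩ (w⁻¹ (posSucc i)) (by have := hp.1; simp only; omega)
      (Fin.lt_def.mpr (by simp only; omega)) hq.2
    rw [perm_apply_inv] at h1 h2
    have h1 := Fin.lt_def.mp h1
    have h2 := Fin.lt_def.mp h2
    simp only [pos, posSucc] at h1 h2
    omega

theorem preservesLooseOrder_one : PreservesLooseOrder r (1 : Equiv.Perm (Fin m)) :=
  fun _ _ _ h _ ↦ h

theorem PreservesLooseOrder.mul {w c : Equiv.Perm (Fin m)} (hw : PreservesLooseOrder r w)
    (hc : ∀ k, IsLoose r k → c k = k) : PreservesLooseOrder r (w * c) := by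
  intro a b ha hab hb
  have hab' := Fin.lt_def.mp hab
  rw [Equiv.Perm.mul_apply, Equiv.Perm.mul_apply, hc a ⟨ha, by omega⟩, hc b ⟨by omega, hb⟩]
  exact hw a b ha hab hb

theorem minOp_minOp (τ : ℍ) (hmr : 2 * r ≤ m) {w : Equiv.Perm (Fin m)} {i : Fin (m - 1)}
    (hw : PreservesLooseOrder r w) (hw' : PreservesLooseOrder r (simple i * w))
    (g : Mero (Var m r)) : minOp τ r i (simple i * w) (minOp τ r i w g) = g := by
  have hl := hw.not_isLoose hw'
  have hne : w⁻¹ (pos i) ≠ w⁻¹ (posSucc i) := fun e ↦ pos_ne_posSucc i (w⁻¹.injective e)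
  simp only [minOp, simple_mul_inv_apply, simple_pos, simple_posSucc]
  rw [← neg_sub]
  refine demBar_neg_demBar τ i ((xFree_minWeight hmr _).sub (xFree_minWeight hmr _))
    (minWeight_sub_ne_zero hmr hne) ?_ ?_ g
  · simpa using minWeight_sub_add_ne_zero hmr hne hl 1
  · rw [neg_sub]
    simpa using minWeight_sub_add_ne_zero hmr hne.symm (fun h ↦ hl h.symm) 1

/-- At a descent the operation undoes the last step of the composition, so the recursion holds in
both directions; this handles words that are not reduced. -/
theorem ellValue_simple_mul (τ : ℍ) (hmr : 2 * r ≤ m) {w : Equiv.Perm (Fin m)} {i : Fin (m - 1)}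
    (hw : PreservesLooseOrder r w) (hw' : PreservesLooseOrder r (simple i * w)) :
    ellValue τ hmr (simple i * w) = minOp τ r i w (ellValue τ hmr w) := by
  by_cases hi : IsDescent i w
  · rw [ellValue_eq τ hmr hi]
    have := minOp_minOp τ hmr hw' (by rwa [simple_mul_simple_mul]) (ellValue τ hmr (simple i * w))
    rw [simple_mul_simple_mul] at this
    exact this.symm
  · rw [ellValue_eq τ hmr ((not_isDescent_iff i w).mp hi), simple_mul_simple_mul]

theorem ellValue_of_isReducedWord (τ : ℍ) (hmr : 2 * r ≤ m) {s : List (Fin (m - 1))}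
    {w : Equiv.Perm (Fin m)} (hs : IsReducedWord s w) (hw : PreservesLooseOrder r w) :
    DiamondWord τ (ellMin τ hmr) s (ellValue τ hmr w) ∧
      HasWeight τ (ellValue τ hmr w) (minWeight m r ∘ ⇑w⁻¹) ∧ ellValue τ hmr w ≠ 0 := by
  induction s generalizing w with
  | nil =>
    obtain rfl : 1 = w := hs.1
    rw [ellValue_one]
    exact ⟨.nil, hasWeight_ellMin τ hmr, ellMin_ne_zero τ hmr⟩
  | cons i s ih =>
    obtain ⟨hs', hi⟩ := hs.tail
    have hw' := hw.of_isDescent hi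
    obtain ⟨h1, h2, h3⟩ := ih hs' hw'
    set u := simple i * w with hu
    have hwu : w = simple i * u := by rw [hu, simple_mul_simple_mul]
    have hne : u⁻¹ (pos i) ≠ u⁻¹ (posSucc i) := fun e ↦ pos_ne_posSucc i (u⁻¹.injective e)
    have hl := hw'.not_isLoose (i := i) (by rwa [← hwu])
    have hval : ellValue τ hmr w = minOp τ r i u (ellValue τ hmr u) := ellValue_eq τ hmr hi
    refine ⟨?_, ?_, ?_⟩
    · rw [hval]
      exact .cons i s _ _ h1 ((h2.admissible_iff h3 i _).mpr rfl) (minWeight_sub_ne_zero hmr hne)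
        (by simpa using minWeight_sub_add_ne_zero hmr hne hl 1)
    · rw [hval, hwu]
      have := h2.demBar i
      rwa [show (minWeight m r ∘ ⇑u⁻¹) ∘ simple i = minWeight m r ∘ ⇑(simple i * u)⁻¹ from
        funext fun k ↦ congrArg (minWeight m r) (simple_mul_inv_apply i u k).symm] at this
    -- Nonvanishing, needed for the next type to be unique, follows from invertibility of the
    -- operation.
    · intro h0
      have := minOp_minOp τ hmr hw' (by rwa [← hwu]) (ellValue τ hmr u)
      rw [← hval, h0, minOp, demBar_zero] at this
      exact h3 this.symm

/-- The condition `ν + h ≠ 0` keeps every partial product among the permutations preserving the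
loose order, where the recursion for `ellValue` is available. -/
theorem ellValue_of_diamondWord (τ : ℍ) (hmr : 2 * r ≤ m) {s : List (Fin (m - 1))}
    {g : Mero (Var m r)} (h : DiamondWord τ (ellMin τ hmr) s g) :
    PreservesLooseOrder r (wordProd s) ∧ g = ellValue τ hmr (wordProd s) ∧
      HasWeight τ g (minWeight m r ∘ ⇑(wordProd s)⁻¹) := by
  induction h with
  | nil => exact ⟨preservesLooseOrder_one, (ellValue_one τ hmr).symm, hasWeight_ellMin τ hmr⟩
  | cons i s g ν _ hν h0 hh ih =>
    obtain ⟨h1, h2, h3⟩ := ih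
    have hν' := (h3.admissible_iff hν.1 i ν).mp hν
    rw [hν'] at hh ⊢
    have hw' := h1.of_minWeight (i := i) hh
    rw [wordProd_cons]
    refine ⟨hw', ?_, ?_⟩
    · rw [ellValue_simple_mul τ hmr h1 hw', ← h2]
      rfl
    · have := h3.demBar i
      rwa [show (minWeight m r ∘ ⇑(wordProd s)⁻¹) ∘ simple i =
        minWeight m r ∘ ⇑(simple i * wordProd s)⁻¹ from
        funext fun k ↦ congrArg (minWeight m r) (simple_mul_inv_apply i _ k).symm] at this

theorem isDiamond_ellValue (τ : ℍ) (hmr : 2 * r ≤ m) {w : Equiv.Perm (Fin m)}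
    (hw : PreservesLooseOrder r w) : IsDiamond τ w (ellMin τ hmr) (ellValue τ hmr w) := by
  refine ⟨fun s hs ↦ (ellValue_of_isReducedWord τ hmr hs hw).1, ?_⟩
  rintro s g rfl h
  exact (ellValue_of_diamondWord τ hmr h).2.1

theorem IsDiamond.eq_ellValue {τ : ℍ} {hmr : 2 * r ≤ m} {w : Equiv.Perm (Fin m)}
    {g : Mero (Var m r)} (hw : PreservesLooseOrder r w) (h : IsDiamond τ w (ellMin τ hmr) g) :
    g = ellValue τ hmr w := by
  obtain ⟨s, hs⟩ := exists_isReducedWord w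
  exact ((isDiamond_ellValue τ hmr hw).2 s g hs.1 (h.1 s hs))

/-! ### Symmetries of the minimal pattern -/

/-- `c` permutes the arrows of the minimal pattern by `π` and fixes the loose nodes. -/
structure IsLabelPerm (hmr : 2 * r ≤ m) (π : Equiv.Perm (Fin r)) (c : Equiv.Perm (Fin m)) :
    Prop where
  first (i : Fin r) : c (firstNode hmr i) = firstNode hmr (π i)
  last (i : Fin r) : c (lastNode hmr i) = lastNode hmr (π i)
  loose (k : Fin m) : IsLoose r k → c k = k

/-- The multiples of `h` in the weights are the same for all targets and for all sources, so
permuting the arrows only permutes the `μ_j`. -/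
theorem IsLabelPerm.minWeight_apply {hmr : 2 * r ≤ m} {π : Equiv.Perm (Fin r)}
    {c : Equiv.Perm (Fin m)} (h : IsLabelPerm hmr π c) (k : Fin m) :
    minWeight m r (c k) = permForm (Var.permMu π) (minWeight m r k) := by
  rcases node_cases hmr k with ⟨i, rfl⟩ | ⟨i, rfl⟩ | hk
  · rw [h.first, minWeight_firstNode, minWeight_firstNode, map_add, map_zsmul,
      permForm_permMu_coord_h, permForm_permMu_coord_mu]
  · rw [h.last, minWeight_lastNode, minWeight_lastNode, map_add, map_neg, map_zsmul,
      permForm_permMu_coord_h, permForm_permMu_coord_mu]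
  · rw [h.loose k hk, minWeight_of_isLoose hk, map_zsmul, permForm_permMu_coord_h]

end Main

/-! ### Relabelling the arrows: from adjacent transpositions to all permutations. -/

section Symmetry

variable {m r : ℕ}

theorem simple_of_isLoose_left (hmr : 2 * r ≤ m) {a b : Fin r} (hab : (a : ℕ) + 1 = b)
    {i : Fin (m - 1)} (hi : (i : ℕ) = a) {k : Fin m} (hk : IsLoose r k) : simple i k = k := by
  rw [simple_eq_swap_firstNode hmr hab hi]
  exact Equiv.swap_apply_of_ne_of_ne (fun e ↦ not_isLoose_firstNode hmr a (e ▸ hk))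
    fun e ↦ not_isLoose_firstNode hmr b (e ▸ hk)

theorem simple_of_isLoose_right (hmr : 2 * r ≤ m) {a b : Fin r} (hab : (a : ℕ) + 1 = b)
    {j : Fin (m - 1)} (hj : (j : ℕ) = m - r + a) {k : Fin m} (hk : IsLoose r k) :
    simple j k = k := by
  rw [simple_eq_swap_lastNode hmr hab hj]
  exact Equiv.swap_apply_of_ne_of_ne (fun e ↦ not_isLoose_lastNode hmr a (e ▸ hk))
    fun e ↦ not_isLoose_lastNode hmr b (e ▸ hk)

theorem isLabelPerm_swap (hmr : 2 * r ≤ m) {a b : Fin r} (hab : (a : ℕ) + 1 = b)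
    {i j : Fin (m - 1)} (hi : (i : ℕ) = a) (hj : (j : ℕ) = m - r + a) :
    IsLabelPerm hmr (Equiv.swap a b) (simple i * simple j) := by
  refine ⟨fun k ↦ ?_, fun k ↦ ?_, fun k hk ↦ ?_⟩
  · rw [Equiv.Perm.mul_apply, simple_eq_swap_lastNode hmr hab hj, Equiv.swap_apply_of_ne_of_ne
      (firstNode_ne_lastNode hmr _ _) (firstNode_ne_lastNode hmr _ _),
      simple_eq_swap_firstNode hmr hab hi, (firstNode_injective hmr).swap_apply]
  · rw [Equiv.Perm.mul_apply, simple_eq_swap_lastNode hmr hab hj,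
      (lastNode_injective hmr).swap_apply, simple_eq_swap_firstNode hmr hab hi,
      Equiv.swap_apply_of_ne_of_ne (firstNode_ne_lastNode hmr _ _).symm
      (firstNode_ne_lastNode hmr _ _).symm]
  · rw [Equiv.Perm.mul_apply, simple_of_isLoose_right hmr hab hj hk,
      simple_of_isLoose_left hmr hab hi hk]

/-- The `j`-th operation on the class equals the `i`-th operation, with the same parameter `ν = μ_b
- μ_a`, on the relabelled class. The next operation is the `i`-th with parameter `-ν`, which inverts
it. -/
theorem ellValue_simple_mul_simple (τ : ℍ) (hmr : 2 * r ≤ m) {a b : Fin r}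
    (hab : (a : ℕ) + 1 = b) {i j : Fin (m - 1)} (hi : (i : ℕ) = a) (hj : (j : ℕ) = m - r + a) :
    ellValue τ hmr (simple i * simple j) = actMu (Equiv.swap a b) (ellMin τ hmr) := by
  have hG : PreservesLooseOrder r (simple j) := by
    simpa only [one_mul] using preservesLooseOrder_one.mul (c := simple j)
      fun k ↦ simple_of_isLoose_right hmr hab hj
  have hG' : PreservesLooseOrder r (simple i * simple j) := by
    simpa only [one_mul] using preservesLooseOrder_one.mul (c := simple i * simple j)
      (isLabelPerm_swap hmr hab hi hj).loose
  have hpi : pos i = firstNode hmr a := Fin.ext hi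
  have hsi : posSucc i = firstNode hmr b :=
    Fin.ext (by simp only [posSucc, firstNode]; omega)
  have hpj : pos j = lastNode hmr a := Fin.ext hj
  have hsj : posSucc j = lastNode hmr b :=
    Fin.ext (by simp only [posSucc, lastNode]; omega)
  have hne : lastNode hmr a ≠ lastNode hmr b := by
    rw [← hpj, ← hsj]
    exact pos_ne_posSucc j
  have hl : ¬(IsLoose r (lastNode hmr a) ∧ IsLoose r (lastNode hmr b)) :=
    fun h ↦ not_isLoose_lastNode hmr a h.1
  have hl' : ¬(IsLoose r (lastNode hmr b) ∧ IsLoose r (lastNode hmr a)) :=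
    fun h ↦ not_isLoose_lastNode hmr a h.2
  have e1 : minWeight m r (lastNode hmr a) - minWeight m r (lastNode hmr b) =
      coord (.mu b) - coord (.mu a) := by
    rw [minWeight_lastNode, minWeight_lastNode]
    abel
  have e2 : minWeight m r (firstNode hmr a) - minWeight m r (firstNode hmr b) =
      -(coord (.mu b) - coord (.mu a)) := by
    rw [minWeight_firstNode, minWeight_firstNode]
    abel
  have hj1 : ellValue τ hmr (simple j) =
      demBar τ j (coord (.mu b) - coord (.mu a)) (ellMin τ hmr) := by
    have := ellValue_simple_mul τ hmr preservesLooseOrder_one (i := j) (by rwa [mul_one])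
    rw [mul_one, ellValue_one, minOp, inv_one, Equiv.Perm.one_apply, Equiv.Perm.one_apply, hpj,
      hsj, e1] at this
    exact this
  rw [ellValue_simple_mul τ hmr hG hG', hj1, minOp, simple_inv, hpi, hsi,
    simple_eq_swap_lastNode hmr hab hj, Equiv.swap_apply_of_ne_of_ne
      (firstNode_ne_lastNode hmr _ _) (firstNode_ne_lastNode hmr _ _),
    Equiv.swap_apply_of_ne_of_ne
      (firstNode_ne_lastNode hmr _ _) (firstNode_ne_lastNode hmr _ _), e2,
    ← demBar_actMu_swap_ellMin τ hmr hab hi hj]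
  refine demBar_neg_demBar τ i ((xFree_mu b).sub (xFree_mu a)) ?_ ?_ ?_ _
  · rw [← e1]
    exact minWeight_sub_ne_zero hmr hne
  · rw [← e1]
    simpa using minWeight_sub_add_ne_zero hmr hne hl 1
  · rw [← e1, neg_sub]
    simpa using minWeight_sub_add_ne_zero hmr hne.symm hl' 1

/-- Letters are added to `w` on the left, while the symmetry sits on the right and acts only through
the weights, hence by exchanging `μ_a` and `μ_b` in each parameter. So the case `w = 1` propagates.
-/
theorem ellValue_mul_swap (τ : ℍ) (hmr : 2 * r ≤ m) {a b : Fin r} (hab : (a : ℕ) + 1 = b)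
    {i j : Fin (m - 1)} (hi : (i : ℕ) = a) (hj : (j : ℕ) = m - r + a) {w : Equiv.Perm (Fin m)}
    (hw : PreservesLooseOrder r w) :
    ellValue τ hmr (w * (simple i * simple j)) = actMu (Equiv.swap a b) (ellValue τ hmr w) := by
  have hd := isLabelPerm_swap hmr hab hi hj
  have hinv : (simple i * simple j)⁻¹ = simple i * simple j := by
    rw [mul_inv_rev, simple_inv, simple_inv]
    exact (simple_comm (by omega)).symm
  induction w using perm_descent_induction with
  | h1 => rw [one_mul, ellValue_simple_mul_simple τ hmr hab hi hj, ellValue_one]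
  | hs w k hk ih =>
    have hu := hw.of_isDescent hk
    have hud := hu.mul hd.loose
    set u := simple k * w with hu_def
    have hwu : w = simple k * u := by rw [hu_def, simple_mul_simple_mul]
    have hwd := hw.mul hd.loose
    have hinv' : ∀ x, (u * (simple i * simple j))⁻¹ x = (simple i * simple j) (u⁻¹ x) := fun x ↦ by
      rw [mul_inv_rev, hinv, Equiv.Perm.mul_apply]
    rw [hwu, mul_assoc] at hwd
    rw [hwu] at hw
    rw [hwu, mul_assoc, ellValue_simple_mul τ hmr hud hwd, ellValue_simple_mul τ hmr hu hw,
      ih hu, minOp, minOp, hinv', hinv', hd.minWeight_apply, hd.minWeight_apply, actMu_demBar,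
      map_sub]

theorem IsLabelPerm.eq_one {hmr : 2 * r ≤ m} {c : Equiv.Perm (Fin m)}
    (hc : IsLabelPerm hmr 1 c) : c = 1 := by
  refine Equiv.ext fun k ↦ ?_
  rcases node_cases hmr k with ⟨i, rfl⟩ | ⟨i, rfl⟩ | hk
  · exact hc.first i
  · exact hc.last i
  · exact hc.loose k hk

theorem IsLabelPerm.inv_mul {hmr : 2 * r ≤ m} {π σ : Equiv.Perm (Fin r)}
    {c d : Equiv.Perm (Fin m)} (hc : IsLabelPerm hmr π c) (hd : IsLabelPerm hmr σ d) :
    IsLabelPerm hmr (σ⁻¹ * π) (d⁻¹ * c) := by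
  refine ⟨fun i ↦ ?_, fun i ↦ ?_, fun k hk ↦ ?_⟩
  · rw [Equiv.Perm.mul_apply, Equiv.Perm.mul_apply, Equiv.Perm.inv_eq_iff_eq, hc.first, hd.first,
      perm_apply_inv]
  · rw [Equiv.Perm.mul_apply, Equiv.Perm.mul_apply, Equiv.Perm.inv_eq_iff_eq, hc.last, hd.last,
      perm_apply_inv]
  · rw [Equiv.Perm.mul_apply, Equiv.Perm.inv_eq_iff_eq, hc.loose k hk, hd.loose k hk]

theorem ellValue_mul (τ : ℍ) (hmr : 2 * r ≤ m) (π : Equiv.Perm (Fin r)) {c w : Equiv.Perm (Fin m)}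
    (hc : IsLabelPerm hmr π c) (hw : PreservesLooseOrder r w) :
    ellValue τ hmr (w * c) = actMu π⁻¹ (ellValue τ hmr w) := by
  induction π using perm_descent_induction generalizing c w with
  | h1 => rw [hc.eq_one, mul_one, inv_one, actMu_one]
  | hs π k _ ih =>
    -- Here `k` indexes a simple transposition of the labels; it is realised on nodes by
    -- simultaneous transpositions at the targets (`k`) and at the sources (`m - r + k`).
    have hd := isLabelPerm_swap hmr (a := pos k) (b := posSucc k) rfl
      (i := ⟨k, by omega⟩) (j := ⟨m - r + k, by omega⟩) rfl rfl
    have hdc := hc.inv_mul hd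
    rw [Equiv.swap_inv] at hdc
    have h1 := ih hdc (hw.mul hd.loose)
    rw [mul_assoc, mul_inv_cancel_left,
      ellValue_mul_swap τ hmr (a := pos k) (b := posSucc k) rfl rfl rfl hw, ← actMu_mul] at h1
    rw [h1, mul_inv_rev, simple_inv, simple, mul_assoc, Equiv.swap_mul_self, mul_one]

theorem isLabelPerm_of_permLabels_eq {hmr : 2 * r ≤ m} {σ₁ σ₂ : Equiv.Perm (Fin r)}
    {w₁ w₂ : Equiv.Perm (Fin m)}
    (h : ((minPattern hmr).permNodes w₁).permLabels σ₁ =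
      ((minPattern hmr).permNodes w₂).permLabels σ₂)
    (h₁ : PreservesLooseOrder r w₁) (h₂ : PreservesLooseOrder r w₂) :
    IsLabelPerm hmr (σ₂⁻¹ * σ₁) (w₂⁻¹ * w₁) := by
  have hs : ∀ i, w₁ (lastNode hmr i) = w₂ (lastNode hmr ((σ₂⁻¹ * σ₁) i)) := fun i ↦ by
    have := congrFun (congrArg LinkPattern.source h) (σ₁ i)
    simp only [LinkPattern.permLabels, LinkPattern.permNodes, minPattern, Function.comp_apply,
      Equiv.symm_apply_apply] at this
    exact this
  have ht : ∀ i, w₁ (firstNode hmr i) = w₂ (firstNode hmr ((σ₂⁻¹ * σ₁) i)) := fun i ↦ by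
    have := congrFun (congrArg LinkPattern.target h) (σ₁ i)
    simp only [LinkPattern.permLabels, LinkPattern.permNodes, minPattern, Function.comp_apply,
      Equiv.symm_apply_apply] at this
    exact this
  have hl : ∀ i, (w₂⁻¹ * w₁) (lastNode hmr i) = lastNode hmr ((σ₂⁻¹ * σ₁) i) := fun i ↦ by
    rw [Equiv.Perm.mul_apply, Equiv.Perm.inv_eq_iff_eq, hs]
  have hf : ∀ i, (w₂⁻¹ * w₁) (firstNode hmr i) = firstNode hmr ((σ₂⁻¹ * σ₁) i) := fun i ↦ by
    rw [Equiv.Perm.mul_apply, Equiv.Perm.inv_eq_iff_eq, ht]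
  set π := σ₂⁻¹ * σ₁
  set c := w₂⁻¹ * w₁ with hc
  have hwc : ∀ k, w₂ (c k) = w₁ k := fun k ↦ by
    rw [hc, Equiv.Perm.mul_apply, perm_apply_inv]
  have hloose : ∀ k, IsLoose r k → IsLoose r (c k) := fun k hk ↦ by
    rcases node_cases hmr (c k) with ⟨i, hi⟩ | ⟨i, hi⟩ | h'
    · rw [← perm_apply_inv π i, ← hf] at hi
      exact absurd (c.injective hi ▸ hk) (not_isLoose_firstNode hmr _)
    · rw [← perm_apply_inv π i, ← hl] at hi
      exact absurd (c.injective hi ▸ hk) (not_isLoose_lastNode hmr _)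
    · exact h'
  have hlt : ∀ p q, IsLoose r p → IsLoose r q → p < q → c p < c q := fun p q hp hq hpq ↦ by
    have h1 := h₁ p q hp.1 hpq hq.2
    rw [← hwc p, ← hwc q] at h1
    rcases lt_trichotomy (c p) (c q) with h' | h' | h'
    · exact h'
    · rw [h'] at h1
      exact absurd h1 (lt_irrefl _)
    · exact absurd (h₂ _ _ (hloose q hq).1 h' (hloose p hp).2) h1.asymm
  classical
  -- `c` is increasing on the interval of loose nodes, which it maps to itself, but not elsewhere.
  -- Replaced by the identity off this interval, it becomes a strictly increasing self-map of a
  -- finite chain, hence the identity.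
  have hmono : StrictMono fun k ↦ if IsLoose r k then c k else k := by
    intro p q hpq
    have hpq' := Fin.lt_def.mp hpq
    by_cases hp : IsLoose r p <;> by_cases hq : IsLoose r q <;>
      simp only [hp, hq, if_true, if_false]
    · exact hlt p q hp hq hpq
    · have := hloose p hp
      simp only [IsLoose] at *
      exact Fin.lt_def.mpr (by omega)
    · have := hloose q hq
      simp only [IsLoose] at *
      exact Fin.lt_def.mpr (by omega)
    · exact hpq
  refine ⟨hf, hl, fun k hk ↦ ?_⟩
  have := congrFun ((hmono.range_inj strictMono_id).mp (by
    rw [(Finite.injective_iff_surjective.mp hmono.injective).range_eq, Set.range_id])) k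
  simpa only [hk, if_true, id_eq] using this

end Symmetry

end EllLink

theorem mainTheorem4 (τ : UpperHalfPlane) (m r : ℕ) (hmr : 2 * r ≤ m)
    (P : EllLink.LinkPattern m r) :
    (∀ (σ : Equiv.Perm (Fin r)) (w : Equiv.Perm (Fin m)),
      P = ((EllLink.minPattern hmr).permNodes w).permLabels σ →
      EllLink.PreservesLooseOrder r w →
      ∃ g : EllLink.Mero (EllLink.Var m r), EllLink.IsDiamond τ w (EllLink.ellMin τ hmr) g) ∧
    (∀ (σ₁ σ₂ : Equiv.Perm (Fin r)) (w₁ w₂ : Equiv.Perm (Fin m))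
      (g₁ g₂ : EllLink.Mero (EllLink.Var m r)),
      P = ((EllLink.minPattern hmr).permNodes w₁).permLabels σ₁ →
      P = ((EllLink.minPattern hmr).permNodes w₂).permLabels σ₂ →
      EllLink.PreservesLooseOrder r w₁ → EllLink.PreservesLooseOrder r w₂ →
      EllLink.IsDiamond τ w₁ (EllLink.ellMin τ hmr) g₁ →
      EllLink.IsDiamond τ w₂ (EllLink.ellMin τ hmr) g₂ →
      EllLink.actMu σ₁ g₁ = EllLink.actMu σ₂ g₂) := by
  refine ⟨fun σ w _ hw ↦ ⟨_, EllLink.isDiamond_ellValue τ hmr hw⟩, ?_⟩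
  intro σ₁ σ₂ w₁ w₂ g₁ g₂ hP₁ hP₂ hw₁ hw₂ hg₁ hg₂
  have hc := EllLink.isLabelPerm_of_permLabels_eq (hP₁.symm.trans hP₂) hw₁ hw₂
  have h := EllLink.ellValue_mul τ hmr _ hc hw₂
  rw [mul_inv_cancel_left] at h
  -- The labels combine as `σ₁ (σ₂⁻¹ σ₁)⁻¹ = σ₂`.
  rw [hg₁.eq_ellValue hw₁, hg₂.eq_ellValue hw₂, h, ← EllLink.actMu_mul, mul_inv_rev, inv_inv,
    mul_inv_cancel_left]
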